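/- Let $n\ge 1$ and let $q\in\mathbb C^*$ with $q^2\neq 1$ and, if $n\ge 2$, also $q^4\ne 1$ (so that all $q$-numbers and Gaussian binomials in the definition below have non-zero denominators). Label the simple roots of type $A_{2n-1}$ along the Dynkin diagram as $\mu_{n-1},\dots,\mu_1,\beta,\nu_1,\dots,\nu_{n-1}$. Let $(a_{ij})$ be the Cartan matrix and $P$ the weight lattice, spanned by the fundamental weights $\lambda_i$, with $(\alpha_i|\lambda_j)=\delta_{ij}$ and $\alpha_i=\sum_j a_{ji}\lambda_j$. Let $U_q$ be the $\mathbb C$-algebra generated by $E_i,F_i$ ($1\le i\le 2n-1$) and $L_\zeta$ ($\zeta\in P$) with defining relations $L_0=1$, $L_\zeta L_\xi=L_{\zeta+\xi}$, $L_\zeta E_j=q^{(\alpha_j|\zeta)}E_jL_\zeta$, $L_\zeta F_j=q^{-(\alpha_j|\zeta)}F_jL_\zeta$, $E_iF_j-F_jE_i=\delta_{ij}\frac{L_{\alpha_i}-L_{-\alpha_i}}{q-q^{-1}}$, and the quantum Serre relations $E_iE_j=E_jE_i$, $F_iF_j=F_jF_i$ if $a_{ij}=0$, and $E_i^2E_j-(q+q^{-1})E_iE_jE_i+E_jE_i^2=0=F_i^2F_j-(q+q^{-1})F_iF_jF_i+F_jF_i^2$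 if $a_{ij}=-1$. For a simple root $\mu$ and an element $x$ of weight $\alpha$ put $(\mathrm{ad}\,E_\mu)(x)=E_\mu x-q^{-(\alpha|\mu)}xE_\mu$, and for $1\le i,j\le n$ let $$Z_{i,j}=(\mathrm{ad}\,E_{\mu_{i-1}})\cdots(\mathrm{ad}\,E_{\mu_1})(\mathrm{ad}\,E_{\nu_{j-1}})\cdots(\mathrm{ad}\,E_{\nu_1})(E_\beta),$$ an element of weight $\alpha_{i,j}=\mu_1+\cdots+\mu_{i-1}+\beta+\nu_1+\cdots+\nu_{j-1}$. For $\wp=(\zeta_1,\dots,\zeta_n,\xi_1,\dots,\xi_n)\in P^{2n}$ let $\tilde Z_{i,j}=Z_{i,j}L_{\zeta_i}L_{\xi_j}$, and let the modified algebra $M_q^\wp(n)$ be the (unital) subalgebra of $U_q$ generated by all $\tilde Z_{i,j}$, $1\le i,j\le n$. Theorem. For every such $n,q$ and every $\wp\in P^{2n}$: (1) $M_q^\wp(n)$ is an iterated Ore extension of $\mathbb C$ in the $n^2$ variables $\tilde Z_{i,j}$, adjoined in lexicographic order: if $M_k$ is the subalgebra generated by the first $k$ of the $\tilde Z_{i,j}$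 and $x$ is the next one, then $M_{k+1}$ is a free left $M_k$-module with basis $1,x,x^2,\dots$, and there are an automorphism $\sigma$ of $M_k$ and a $\sigma$-derivation $\delta$ of $M_k$ with $xa=\sigma(a)x+\delta(a)$ for all $a\in M_k$. (2) $M_q^\wp(n)$ is a domain. (3) $M_q^\wp(n)$ is the direct sum of the subspaces $M_d$ ($d\ge 0$) spanned by all products of $d$ of the generators $\tilde Z_{i,j}$, and its Hilbert series $\sum_d \dim(M_d)\,t^d$ equals that of the commutative polynomial ring in $n^2$ variables over $\mathbb C$. (4) The following are defining relations of $M_q^\wp(n)$ on the generators $\tilde Z_{i,j}$: \begin{align*} \tilde Z_{i,j}\tilde Z_{i,k}&=q^{(\alpha_{i,k}|\zeta_i+\xi_j)-(\alpha_{i,j}|\zeta_i+\xi_k)+1}\tilde Z_{i,k}\tilde Z_{i,j} && (j<k),\\ \tilde Z_{i,j}\tilde Z_{k,j}&=q^{(\alpha_{k,j}|\zeta_i+\xi_j)-(\alpha_{i,j}|\zeta_k+\xi_j)+1}\tilde Z_{k,j}\tilde Z_{i,j} && (i<k),\\ \tilde Z_{i,j}\tilde Z_{s,t}&=q^{(\alpha_{s,t}|\zeta_i+\xi_j)-(\alpha_{i,j}|\zeta_s+\xi_t)}\tilde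 Z_{s,t}\tilde Z_{i,j} && (i<s,\ t<j),\\ \tilde Z_{i,j}\tilde Z_{s,t}&=q^{(\alpha_{s,t}|\zeta_i+\xi_j)-(\alpha_{i,j}|\zeta_s+\xi_t)}\tilde Z_{s,t}\tilde Z_{i,j}+(q-q^{-1})\,q^{(\alpha_{s,t}|\zeta_i+\xi_j)-(\alpha_{s,j}|\zeta_i+\xi_t)}\tilde Z_{i,t}\tilde Z_{s,j} && (i<s,\ j<t). \end{align*} -/

import Mathlib

namespace QuantumMatrix

noncomputable section

/-! ### Ore extensions -/

/-- `S = R[x; σ, δ]` inside an ambient `K`-algebra `A`: `S` is generated over its subalgebra `R`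
by `x`, it is a free left `R`-module with basis `1, x, x ^ 2, …`, and
`x * a = σ a * x + δ a` for an automorphism `σ` of `R` and a `σ`-derivation `δ` of `R`. -/
structure IsOreExtension {K A : Type*} [Field K] [Ring A] [Algebra K A]
    (R S : Subalgebra K A) (x : A) : Prop where
  le : R ≤ S
  mem : x ∈ S
  skew : ∃ (σ : R ≃ₐ[K] R) (δ : R →ₗ[K] R),
    (∀ a b : R, δ (a * b) = σ a * δ b + δ a * b) ∧
    ∀ a : R, x * (a : A) = (σ a : A) * x + (δ a : A)
  free : ∀ s ∈ S, ∃! c : ℕ →₀ R, s = c.sum fun i a => (a : A) * x ^ i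

/-- `A` is an iterated Ore extension `K[x₀][x₁; σ₁, δ₁]⋯[x_{N-1}; σ_{N-1}, δ_{N-1}]` of the base
field in the variables `x₀, …, x_{N-1}`, adjoined in this order. -/
def IsIteratedOreExtension (K : Type*) {A : Type*} [Field K] [Ring A] [Algebra K A] {N : ℕ}
    (x : Fin N → A) : Prop :=
  ∃ R : Fin (N + 1) → Subalgebra K A,
    R 0 = ⊥ ∧ R (Fin.last N) = ⊤ ∧ ∀ k : Fin N, IsOreExtension (R k.castSucc) (R k.succ) (x k)

/-! ### Hilbert series -/

/-- The Hilbert series `∑ d, (dim V d) t ^ d` of a sequence of subspaces. -/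
def hilbertSeries {K A : Type*} [Semiring K] [AddCommMonoid A] [Module K A]
    (V : ℕ → Submodule K A) : PowerSeries ℕ :=
  PowerSeries.mk fun d => Module.finrank K (V d)

/-! ### The quantized enveloping algebra of type `A` -/

/-- Elements of the root lattice of type `A_r`, in the basis of the simple roots. -/
abbrev RootLattice (r : ℕ) := Fin r → ℤ

/-- Elements of the weight lattice of type `A_r`, in the basis of the fundamental weights. -/
abbrev WeightLattice (r : ℕ) := Fin r → ℤ

/-- The simple root `α_k`. -/
def simpleRoot {r : ℕ} (k : Fin r) : RootLattice r := Pi.single k 1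

/-- The inclusion of the root lattice into the weight lattice, `α_k = ∑ j, a_{jk} λ_j`. -/
def toWeight {r : ℕ} (γ : RootLattice r) : WeightLattice r :=
  fun j => ∑ k, CartanMatrix.A r j k * γ k

/-- The pairing `(γ | ζ)` of a root lattice element with a weight,
determined by `(α_i | λ_j) = δ_{ij}`. -/
def pairing {r : ℕ} (γ : RootLattice r) (ζ : WeightLattice r) : ℤ := ∑ k, γ k * ζ k

/-- Generators `E_i`, `F_i` and `L_ζ` (`ζ` in the weight lattice). -/
inductive Gen (r : ℕ) : Type
  | E (i : Fin r)
  | F (i : Fin r)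
  | L (ζ : WeightLattice r)

/-- The defining relations of the quantized enveloping algebra of type `A_r` (all `d_i = 1`).
The first two say that the `L_ζ` are the monomials in the commuting invertible
elements `L_i = L_{λ_i}`. -/
inductive UqRel (r : ℕ) (q : ℂ) : FreeAlgebra ℂ (Gen r) → FreeAlgebra ℂ (Gen r) → Prop
  | L_zero : UqRel r q (FreeAlgebra.ι ℂ (Gen.L 0)) 1
  | L_add (ζ ξ : WeightLattice r) :
      UqRel r q (FreeAlgebra.ι ℂ (Gen.L ζ) * FreeAlgebra.ι ℂ (Gen.L ξ))
        (FreeAlgebra.ι ℂ (Gen.L (ζ + ξ)))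
  | L_E (ζ : WeightLattice r) (i : Fin r) :
      UqRel r q (FreeAlgebra.ι ℂ (Gen.L ζ) * FreeAlgebra.ι ℂ (Gen.E i))
        (q ^ pairing (simpleRoot i) ζ •
          (FreeAlgebra.ι ℂ (Gen.E i) * FreeAlgebra.ι ℂ (Gen.L ζ)))
  | L_F (ζ : WeightLattice r) (i : Fin r) :
      UqRel r q (FreeAlgebra.ι ℂ (Gen.L ζ) * FreeAlgebra.ι ℂ (Gen.F i))
        (q ^ (-pairing (simpleRoot i) ζ) •
          (FreeAlgebra.ι ℂ (Gen.F i) * FreeAlgebra.ι ℂ (Gen.L ζ)))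
  | E_F_self (i : Fin r) :
      UqRel r q
        (FreeAlgebra.ι ℂ (Gen.E i) * FreeAlgebra.ι ℂ (Gen.F i) -
          FreeAlgebra.ι ℂ (Gen.F i) * FreeAlgebra.ι ℂ (Gen.E i))
        ((q - q⁻¹)⁻¹ • (FreeAlgebra.ι ℂ (Gen.L (toWeight (simpleRoot i))) -
          FreeAlgebra.ι ℂ (Gen.L (-toWeight (simpleRoot i)))))
  | E_F_ne (i j : Fin r) (h : i ≠ j) :
      UqRel r q (FreeAlgebra.ι ℂ (Gen.E i) * FreeAlgebra.ι ℂ (Gen.F j))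
        (FreeAlgebra.ι ℂ (Gen.F j) * FreeAlgebra.ι ℂ (Gen.E i))
  | E_comm (i j : Fin r) (h : CartanMatrix.A r i j = 0) :
      UqRel r q (FreeAlgebra.ι ℂ (Gen.E i) * FreeAlgebra.ι ℂ (Gen.E j))
        (FreeAlgebra.ι ℂ (Gen.E j) * FreeAlgebra.ι ℂ (Gen.E i))
  | F_comm (i j : Fin r) (h : CartanMatrix.A r i j = 0) :
      UqRel r q (FreeAlgebra.ι ℂ (Gen.F i) * FreeAlgebra.ι ℂ (Gen.F j))
        (FreeAlgebra.ι ℂ (Gen.F j) * FreeAlgebra.ι ℂ (Gen.F i))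
  | E_serre (i j : Fin r) (h : CartanMatrix.A r i j = -1) :
      UqRel r q
        (FreeAlgebra.ι ℂ (Gen.E i) ^ 2 * FreeAlgebra.ι ℂ (Gen.E j) -
          (q + q⁻¹) • (FreeAlgebra.ι ℂ (Gen.E i) * FreeAlgebra.ι ℂ (Gen.E j) *
            FreeAlgebra.ι ℂ (Gen.E i)) +
          FreeAlgebra.ι ℂ (Gen.E j) * FreeAlgebra.ι ℂ (Gen.E i) ^ 2) 0
  | F_serre (i j : Fin r) (h : CartanMatrix.A r i j = -1) :
      UqRel r q
        (FreeAlgebra.ι ℂ (Gen.F i) ^ 2 * FreeAlgebra.ι ℂ (Gen.F j) -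
          (q + q⁻¹) • (FreeAlgebra.ι ℂ (Gen.F i) * FreeAlgebra.ι ℂ (Gen.F j) *
            FreeAlgebra.ι ℂ (Gen.F i)) +
          FreeAlgebra.ι ℂ (Gen.F j) * FreeAlgebra.ι ℂ (Gen.F i) ^ 2) 0

/-- The quantized enveloping algebra `U_q(sl_{r+1})`, with torus part the group algebra of the
weight lattice. -/
abbrev Uq (r : ℕ) (q : ℂ) : Type := RingQuot (UqRel r q)

/-- The generator `E_i` of the quantized enveloping algebra. -/
def E {r : ℕ} (q : ℂ) (i : Fin r) : Uq r q :=
  RingQuot.mkAlgHom ℂ (UqRel r q) (FreeAlgebra.ι ℂ (Gen.E i))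

/-- The element `L_ζ` of the quantized enveloping algebra. -/
def L {r : ℕ} (q : ℂ) (ζ : WeightLattice r) : Uq r q :=
  RingQuot.mkAlgHom ℂ (UqRel r q) (FreeAlgebra.ι ℂ (Gen.L ζ))

/-- For `x` of weight `γ`, the `q`-commutator
`(ad E_k)(x) = E_k x - q ^ (-⟨γ, α_k⟩) x E_k`. -/
def adE {r : ℕ} (q : ℂ) (k : Fin r) (γ : RootLattice r) (x : Uq r q) : Uq r q :=
  E q k * x - q ^ (-pairing γ (toWeight (simpleRoot k))) • (x * E q k)

/-! ### The elements `Z_{i,j}`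

The Dynkin diagram of type `A_{2n-1}` is
`μ_{n-1} - ⋯ - μ_1 - β - ν_1 - ⋯ - ν_{n-1}`; its nodes are numbered `0, …, 2n-2` from the left.
Rows and columns `i, j` are numbered `0, …, n-1`. -/

/-- The position of the noncompact simple root `β`. -/
def betaNode (n : ℕ) (h : 0 < n) : Fin (2 * n - 1) := ⟨n - 1, by omega⟩

/-- The position of the compact simple root `μ_k`, for `k = 1, …, n-1`. -/
def muNode (n k : ℕ) (h : k < n) : Fin (2 * n - 1) := ⟨n - 1 - k, by omega⟩

/-- The position of the compact simple root `ν_k`, for `k = 1, …, n-1`. -/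
def nuNode (n k : ℕ) (h : k < n) : Fin (2 * n - 1) := ⟨n - 1 + k, by omega⟩

/-- The root `(μ_1 + ⋯ + μ_i) + β + (ν_1 + ⋯ + ν_j)` of `Z_{i,j}` (numbered from `0`). -/
def rootNat (n : ℕ) : (i j : ℕ) → i < n → j < n → RootLattice (2 * n - 1)
  | 0, 0, hi, _ => simpleRoot (betaNode n hi)
  | 0, j + 1, hi, hj =>
      rootNat n 0 j hi (Nat.lt_of_succ_lt hj) + simpleRoot (nuNode n (j + 1) hj)
  | i + 1, j, hi, hj =>
      simpleRoot (muNode n (i + 1) hi) + rootNat n i j (Nat.lt_of_succ_lt hi) hj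

/-- `Z_{i,j} = (ad E_{μ_i}) ⋯ (ad E_{μ_1}) (ad E_{ν_j}) ⋯ (ad E_{ν_1}) (E_β)`
(numbered from `0`). -/
def ZNat (n : ℕ) (q : ℂ) : (i j : ℕ) → i < n → j < n → Uq (2 * n - 1) q
  | 0, 0, hi, _ => E q (betaNode n hi)
  | 0, j + 1, hi, hj =>
      adE q (nuNode n (j + 1) hj) (rootNat n 0 j hi (Nat.lt_of_succ_lt hj))
        (ZNat n q 0 j hi (Nat.lt_of_succ_lt hj))
  | i + 1, j, hi, hj =>
      adE q (muNode n (i + 1) hi) (rootNat n i j (Nat.lt_of_succ_lt hi) hj)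
        (ZNat n q i j (Nat.lt_of_succ_lt hi) hj)

/-- The root `α_{i,j}` of `Z_{i,j}`. -/
def root {n : ℕ} (i j : Fin n) : RootLattice (2 * n - 1) := rootNat n i j i.isLt j.isLt

/-- The generator `Z_{i,j}` of the standard quantized matrix algebra inside `U_q(sl_{2n})`. -/
def Z {n : ℕ} (q : ℂ) (i j : Fin n) : Uq (2 * n - 1) q := ZNat n q i j i.isLt j.isLt

/-! ### Modified algebras -/

variable {n : ℕ}

/-- `Z̃_{i,j} = Z_{i,j} L_{ζ_i} L_{ξ_j}`. -/
def Zt (q : ℂ) (ζ ξ : Fin n → WeightLattice (2 * n - 1)) (i j : Fin n) : Uq (2 * n - 1) q :=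
  Z q i j * L q (ζ i) * L q (ξ j)

/-- The modified algebra: the subalgebra of `U_q(sl_{2n})` generated by all `Z̃_{i,j}`. -/
def modifiedAlgebra (q : ℂ) (ζ ξ : Fin n → WeightLattice (2 * n - 1)) :
    Subalgebra ℂ (Uq (2 * n - 1) q) :=
  Algebra.adjoin ℂ (Set.range fun p : Fin n × Fin n => Zt q ζ ξ p.1 p.2)

/-- `Z̃_{i,j}` as an element of the modified algebra. -/
def genM (q : ℂ) (ζ ξ : Fin n → WeightLattice (2 * n - 1)) (p : Fin n × Fin n) :
    modifiedAlgebra q ζ ξ :=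
  ⟨Zt q ζ ξ p.1 p.2, Algebra.subset_adjoin ⟨p, rfl⟩⟩

/-- The degree `d` part of the modified algebra: the span of all products of `d` generators
`Z̃_{i,j}`. -/
def gradedPart (q : ℂ) (ζ ξ : Fin n → WeightLattice (2 * n - 1)) (d : ℕ) :
    Submodule ℂ (modifiedAlgebra q ζ ξ) :=
  Submodule.span ℂ (Set.range (genM q ζ ξ)) ^ d

/-- The free generator `X_{i,j}`. -/
def X (i j : Fin n) : FreeAlgebra ℂ (Fin n × Fin n) := FreeAlgebra.ι ℂ (i, j)

/-- The quadratic relations between the generators of a modified algebra. -/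
inductive ModRel (q : ℂ) (ζ ξ : Fin n → WeightLattice (2 * n - 1)) :
    FreeAlgebra ℂ (Fin n × Fin n) → FreeAlgebra ℂ (Fin n × Fin n) → Prop
  | row (i j k : Fin n) (h : j < k) :
      ModRel q ζ ξ (X i j * X i k)
        (q ^ (pairing (root i k) (ζ i + ξ j) - pairing (root i j) (ζ i + ξ k) + 1) •
          (X i k * X i j))
  | col (i j k : Fin n) (h : i < k) :
      ModRel q ζ ξ (X i j * X k j)
        (q ^ (pairing (root k j) (ζ i + ξ j) - pairing (root i j) (ζ k + ξ j) + 1) •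
          (X k j * X i j))
  | anti (i j s t : Fin n) (h : i < s) (h' : t < j) :
      ModRel q ζ ξ (X i j * X s t)
        (q ^ (pairing (root s t) (ζ i + ξ j) - pairing (root i j) (ζ s + ξ t)) •
          (X s t * X i j))
  | diag (i j s t : Fin n) (h : i < s) (h' : j < t) :
      ModRel q ζ ξ (X i j * X s t)
        (q ^ (pairing (root s t) (ζ i + ξ j) - pairing (root i j) (ζ s + ξ t)) •
            (X s t * X i j) +
          ((q - q⁻¹) *
              q ^ (pairing (root s t) (ζ i + ξ j) - pairing (root s j) (ζ i + ξ t))) •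
            (X i t * X s j))

end

end QuantumMatrix

/-! All claims follow from two facts about the monomials in the `Z̃_{i,j}` taken in lexicographic
order: they span, and they are linearly independent.

Spanning. The quantum Serre relations imply quadratic relations for the `Z_{i,j}` (`gridZ_row`,
`gridZ_col`, `gridZ_anti`, `gridZ_diag`). The torus factors only change scalars, because the two
quadratic terms of a diagonal relation carry the same total twist (`lift_genM_rel`). Each relation
rewrites a later variable times an earlier one as a non-zero multiple of the sorted product plus
quadratic terms in variables before the later one. Such relations are homogeneous and suffice for
sorting (`firstSpan_pow`). The abstract algebra presented by these relations has the same property.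

Independence. Let `U_q` act on the algebra `UPos` presented by the positive Serre relations, as a
Verma module with lowest weight zero (`vermaRep`). On the vacuum vector `1` every `L_θ` acts
trivially, so a twisted monomial gives a non-zero multiple of the same monomial in `UPos`. A Feigin
homomorphism sends each generator `e_i` of `UPos` to a sum of variables `y_{i,k}`, `|i| + k < n`, of
a quantum torus. In the image of `Z_{i,j}` only products with second index weakly increasing
outwards from node `0` survive. For a suitable weight the leading one is `∏_{-i ≤ t ≤ j} y_{t,c}` up
to a non-zero scalar, with `c = n - 1 - max i j` (`hasLeading_gridZ`). These `n²` exponents have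
dual functionals (`dualForm_gridM`), so distinct ordered monomials have distinct leading terms.

With both facts, adjoining one variable is an Ore extension whose automorphism scales ordered
monomials; leading coefficients exclude zero divisors; the degree of monomials gives the grading and
the Hilbert series; and the map from the presented algebra is injective because it sends a spanning
family to an independent one. -/

namespace QuantumMatrix

/-! ### Ordered monomials in straightening generators -/

section OrderedMonomials

variable {K A : Type*} [Field K] [Ring A] [Algebra K A]

/-- The ordered monomial `x₀ ^ a₀ * ⋯ * x_{k-1} ^ a_{k-1}`. -/
def ordMon (x : ℕ → A) : (k : ℕ) → (Fin k → ℕ) → A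
  | 0, _ => 1
  | k + 1, a => ordMon x k (Fin.init a) * x k ^ a (Fin.last k)

variable (K) in
/-- The span of the variables `x₀, …, x_{k-1}`. -/
def firstSpan (x : ℕ → A) (k : ℕ) : Submodule K A := Submodule.span K (x '' Set.Iio k)

variable (K) in
/-- The subalgebra generated by the variables `x₀, …, x_{k-1}`. -/
def firstAdjoin (x : ℕ → A) (k : ℕ) : Subalgebra K A := Algebra.adjoin K (x '' Set.Iio k)

variable (K) in
/-- The span of the ordered monomials of degree `d` in `x₀, …, x_{k-1}`. -/
def ordSpan (x : ℕ → A) (k d : ℕ) : Submodule K A :=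
  Submodule.span K (ordMon x k '' {a | ∑ i, a i = d})

variable (K) in
/-- The variables `x₀, …, x_{N-1}` can be put in increasing order by quadratic relations
`x_k x_l = c x_l x_k + ⋯` for `l < k`, the remaining terms involving only variables before
`x_k`. -/
def Straightens (x : ℕ → A) (N : ℕ) : Prop :=
  ∀ k < N, ∀ l < k, ∃ c : K, c ≠ 0 ∧ x k * x l - c • (x l * x k) ∈ firstSpan K x k ^ 2

theorem Straightens.mono {x : ℕ → A} {N k : ℕ} (h : Straightens K x N) (hk : k ≤ N) :
    Straightens K x k := fun m hm l hl => h m (hm.trans_le hk) l hl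

theorem ordMon_succ_snoc (x : ℕ → A) (k : ℕ) (a : Fin k → ℕ) (i : ℕ) :
    ordMon x (k + 1) (Fin.snoc (α := fun _ => ℕ) a i) = ordMon x k a * x k ^ i := by
  simp [ordMon]

theorem ordMon_zero (x : ℕ → A) (k : ℕ) : ordMon x k 0 = 1 := by
  induction k with
  | zero => rfl
  | succ k ih => rw [ordMon, show Fin.init (0 : Fin (k + 1) → ℕ) = 0 from rfl, ih]; simp

theorem firstSpan_succ (x : ℕ → A) (k : ℕ) :
    firstSpan K x (k + 1) = firstSpan K x k ⊔ Submodule.span K {x k} := by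
  rw [firstSpan, firstSpan, ← Submodule.span_union, ← Set.image_singleton, ← Set.image_union]
  congr 2
  ext i
  simp [le_iff_lt_or_eq]

theorem mem_firstSpan {x : ℕ → A} {l k : ℕ} (h : l < k) : x l ∈ firstSpan K x k :=
  Submodule.subset_span ⟨l, h, rfl⟩

theorem ordMon_mem_pow (x : ℕ → A) (k : ℕ) (a : Fin k → ℕ) :
    ordMon x k a ∈ firstSpan K x k ^ ∑ i, a i := by
  induction k with
  | zero => simp [ordMon, Submodule.one_le.1 le_rfl]
  | succ k ih =>
    rw [ordMon, Fin.sum_univ_castSucc, pow_add]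
    refine Submodule.mul_mem_mul ?_ (Submodule.pow_mem_pow _ (mem_firstSpan k.lt_succ_self) _)
    have hle : firstSpan K x k ≤ firstSpan K x (k + 1) := by
      rw [firstSpan_succ]; exact le_sup_left
    exact (pow_le_pow_left' hle _) (ih (Fin.init a))

theorem ordSpan_mul_le (x : ℕ → A) (k : ℕ) {i j d : ℕ} (h : i + j = d) :
    ordSpan K x k i * Submodule.span K {x k} ^ j ≤ ordSpan K x (k + 1) d := by
  rw [Submodule.span_pow, Set.singleton_pow, ordSpan, Submodule.span_mul_span, Submodule.span_le]
  rintro _ ⟨_, ⟨a, ha, rfl⟩, _, rfl, rfl⟩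
  refine Submodule.subset_span ⟨Fin.snoc (α := fun _ => ℕ) a j, ?_, ordMon_succ_snoc x k a j⟩
  simp only [Set.mem_ofPred_eq] at ha
  simp [Fin.sum_univ_castSucc, ha, h]

theorem Straightens.span_mul_firstSpan_le {x : ℕ → A} {k : ℕ} (h : Straightens K x (k + 1)) :
    Submodule.span K {x k} * firstSpan K x k ≤
      firstSpan K x k * Submodule.span K {x k} ⊔ firstSpan K x k ^ 2 := by
  rw [firstSpan, Submodule.span_mul_span, Submodule.span_le]
  rintro _ ⟨_, rfl, _, ⟨l, hl, rfl⟩, rfl⟩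
  obtain ⟨c, -, hc⟩ := h k k.lt_succ_self l hl
  show x k * x l ∈ _
  rw [← sub_add_cancel (x k * x l) (c • (x l * x k)), add_comm]
  exact Submodule.add_mem_sup (Submodule.smul_mem _ _ (Submodule.mul_mem_mul
    (mem_firstSpan hl) (Submodule.mem_span_singleton_self _))) hc

/-- Moving `x k` to the right past earlier variables either keeps it or absorbs it into one more
earlier factor. No second `x k` appears and the total degree is unchanged, so sorting terminates. -/
theorem Straightens.span_mul_pow_le {x : ℕ → A} {k : ℕ} (h : Straightens K x (k + 1)) (d : ℕ) :
    Submodule.span K {x k} * firstSpan K x k ^ d ≤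
      firstSpan K x k ^ d * Submodule.span K {x k} ⊔ firstSpan K x k ^ (d + 1) := by
  induction d with
  | zero => simp
  | succ d ih =>
    calc Submodule.span K {x k} * firstSpan K x k ^ (d + 1)
        = (Submodule.span K {x k} * firstSpan K x k ^ d) * firstSpan K x k := by
          rw [pow_succ, mul_assoc]
      _ ≤ (firstSpan K x k ^ d * Submodule.span K {x k} ⊔ firstSpan K x k ^ (d + 1)) *
            firstSpan K x k := mul_le_mul' ih le_rfl
      _ = firstSpan K x k ^ d * (Submodule.span K {x k} * firstSpan K x k) ⊔
            firstSpan K x k ^ (d + 2) := by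
          rw [Submodule.sup_mul, mul_assoc, ← pow_succ]
      _ ≤ _ := by
          refine sup_le ((mul_le_mul' le_rfl h.span_mul_firstSpan_le).trans ?_) le_sup_right
          rw [Submodule.mul_sup, ← mul_assoc, ← pow_succ, ← pow_add]

/-- Induction on the number of variables and on the degree. Independence plays no role, so this
applies equally to the abstractly presented algebra; exactness in `d` is what later yields the
grading. -/
theorem firstSpan_pow {x : ℕ → A} {k : ℕ} (h : Straightens K x k) (d : ℕ) :
    firstSpan K x k ^ d = ordSpan K x k d := by
  apply le_antisymm
  · induction k generalizing d with
    | zero =>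
      cases d with
      | zero =>
        rw [pow_zero, Submodule.one_le]
        exact Submodule.subset_span ⟨0, by simp, rfl⟩
      | succ d => simp [firstSpan, pow_succ]
    | succ k ih =>
      have ih := ih (h.mono k.le_succ)
      have key : ∀ i j e, i + j = e → firstSpan K x k ^ i * Submodule.span K {x k} ^ j ≤
          ordSpan K x (k + 1) e := fun i j e he =>
        (mul_le_mul' (ih i) le_rfl).trans (ordSpan_mul_le x k he)
      induction d with
      | zero =>
        rw [pow_zero, Submodule.one_le]
        exact Submodule.subset_span ⟨0, by simp, ordMon_zero x _⟩
      | succ d ihd =>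
        rw [pow_succ']
        refine (mul_le_mul' le_rfl ihd).trans ?_
        rw [Submodule.mul_le]
        intro y hy z hz
        refine Submodule.span_induction (p := fun z _ => y * z ∈ ordSpan K x (k + 1) (d + 1))
          ?_ (by simp) (fun _ _ _ _ h1 h2 => by rw [mul_add]; exact add_mem h1 h2)
          (fun c _ _ h1 => by rw [mul_smul_comm]; exact Submodule.smul_mem _ _ h1) hz
        rintro _ ⟨a, ha, rfl⟩
        rw [firstSpan_succ] at hy
        rw [Set.mem_ofPred_eq, Fin.sum_univ_castSucc] at ha
        have hm : ordMon x (k + 1) a ∈ firstSpan K x k ^ (∑ i, Fin.init a i) *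
            Submodule.span K {x k} ^ a (Fin.last k) :=
          Submodule.mul_mem_mul (ordMon_mem_pow x k _)
            (Submodule.pow_mem_pow _ (Submodule.mem_span_singleton_self _) _)
        have hs : (∑ i, Fin.init a i) + a (Fin.last k) = d := ha
        generalize (∑ i, Fin.init a i) = i at hm hs
        generalize a (Fin.last k) = j at hm hs
        -- The new left factor is a combination of earlier variables, which joins the first block,
        -- or a multiple of `x k`, which has to be moved through that block.
        refine (?_ : (firstSpan K x k ⊔ Submodule.span K {x k}) *
          (firstSpan K x k ^ i * Submodule.span K {x k} ^ j) ≤ _) (Submodule.mul_mem_mul hy hm)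
        rw [Submodule.sup_mul]
        refine sup_le ?_ ?_
        · rw [← mul_assoc, ← pow_succ']
          exact key _ _ _ (by omega)
        · rw [← mul_assoc]
          refine (mul_le_mul' (h.span_mul_pow_le i) le_rfl).trans ?_
          rw [Submodule.sup_mul, mul_assoc, ← pow_succ']
          exact sup_le (key _ _ _ (by omega)) (key _ _ _ (by omega))
  · rw [ordSpan, Submodule.span_le]
    rintro _ ⟨a, ha, rfl⟩
    rw [← (ha : ∑ i, a i = d)]
    exact ordMon_mem_pow x k a

theorem ordMon_mem_adjoin (x : ℕ → A) (k : ℕ) (a : Fin k → ℕ) :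
    ordMon x k a ∈ firstAdjoin K x k := by
  induction k with
  | zero => exact one_mem _
  | succ k ih =>
    refine mul_mem (Algebra.adjoin_mono (Set.image_mono ?_) (ih _))
      (pow_mem (Algebra.subset_adjoin (Set.mem_image_of_mem x (Set.mem_Iio.2 k.lt_succ_self))) _)
    exact Set.Iio_subset_Iio k.le_succ

theorem span_range_ordMon {x : ℕ → A} {k : ℕ} (h : Straightens K x k) :
    Submodule.span K (Set.range (ordMon x k)) = Subalgebra.toSubmodule (firstAdjoin K x k) := by
  apply le_antisymm
  · rw [Submodule.span_le]
    rintro _ ⟨a, rfl⟩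
    exact ordMon_mem_adjoin x k a
  · have hle : ∀ d, firstSpan K x k ^ d ≤ Submodule.span K (Set.range (ordMon x k)) := fun d => by
      rw [firstSpan_pow h]
      exact Submodule.span_mono (Set.image_subset_range _ _)
    intro y hy
    refine Algebra.adjoin_induction (p := fun y _ => y ∈ Submodule.span K (Set.range (ordMon x k)))
      ?_ ?_ (fun _ _ _ _ h1 h2 => add_mem h1 h2) ?_ hy
    · intro y hy
      exact hle 1 (by rw [pow_one]; exact Submodule.subset_span hy)
    · intro r
      refine hle 0 ?_
      rw [pow_zero]
      exact Submodule.algebraMap_mem r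
    · intro y z _ _ hy hz
      have := Submodule.mul_mem_mul hy hz
      rw [Submodule.span_mul_span] at this
      refine Submodule.span_le.2 ?_ this
      rintro _ ⟨_, ⟨a, rfl⟩, _, ⟨b, rfl⟩, rfl⟩
      refine hle (∑ i, a i + ∑ i, b i) ?_
      rw [pow_add]
      exact Submodule.mul_mem_mul (ordMon_mem_pow x k a) (ordMon_mem_pow x k b)

theorem linearIndependent_ordMon_of_succ {x : ℕ → A} {k : ℕ}
    (h : LinearIndependent K (ordMon x (k + 1))) : LinearIndependent K (ordMon x k) := by
  have := h.comp (fun a : Fin k → ℕ => Fin.snoc (α := fun _ => ℕ) a 0) (fun a b hab => by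
    simpa using congrArg Fin.init hab)
  convert this using 1
  ext a
  simp [ordMon_succ_snoc]

theorem linearIndependent_ordMon_of_le {x : ℕ → A} {k N : ℕ} (hk : k ≤ N)
    (h : LinearIndependent K (ordMon x N)) : LinearIndependent K (ordMon x k) := by
  induction N, hk using Nat.le_induction with
  | base => exact h
  | succ N _ ih => exact ih (linearIndependent_ordMon_of_succ h)

/-- The basis of ordered monomials. -/
noncomputable def ordBasis {x : ℕ → A} {k : ℕ} (h : Straightens K x k)
    (hli : LinearIndependent K (ordMon x k)) :
    Module.Basis (Fin k → ℕ) K (firstAdjoin K x k) :=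
  (Module.Basis.span hli).map (LinearEquiv.ofEq _ _ (span_range_ordMon h))

theorem coe_ordBasis {x : ℕ → A} {k : ℕ} (h : Straightens K x k)
    (hli : LinearIndependent K (ordMon x k)) (a : Fin k → ℕ) :
    (ordBasis h hli a : A) = ordMon x k a := by
  rw [ordBasis, Module.Basis.map_apply]
  exact congrArg Subtype.val (Module.Basis.span_apply hli a)

end OrderedMonomials

/-! ### Ore extensions from straightening relations -/

section Ore

variable {K A : Type*} [Field K] [Ring A] [Algebra K A]

/-- The left polynomial `∑ cᵢ x ^ i` with coefficients in a subalgebra. -/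
noncomputable def oreSum (R : Subalgebra K A) (x : A) : (ℕ →₀ R) →ₗ[K] A :=
  Finsupp.lsum K fun i => (LinearMap.mulRight K (x ^ i)).comp R.val.toLinearMap

theorem oreSum_apply (R : Subalgebra K A) (x : A) (c : ℕ →₀ R) :
    oreSum R x c = c.sum fun i a => (a : A) * x ^ i := rfl

@[simp]
theorem oreSum_single (R : Subalgebra K A) (x : A) (i : ℕ) (a : R) :
    oreSum R x (Finsupp.single i a) = (a : A) * x ^ i := by
  rw [oreSum_apply, Finsupp.sum_single_index (by simp)]

/-- Coefficients of left polynomials are unique, so `r` and `s` are functions of `a`. Expanding `x *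
(a + b)`, `x * (c • a)`, `x * (a * b)` and `x * 1` in two ways forces every required identity. -/
theorem exists_skew_of_oreSum_injective (R : Subalgebra K A) (x : A)
    (hinj : Function.Injective (oreSum R x))
    (hex : ∀ a : R, ∃ r s : R, x * (a : A) = r * x + s) :
    ∃ (σ : R →ₐ[K] R) (δ : R →ₗ[K] R),
      (∀ a b : R, δ (a * b) = σ a * δ b + δ a * b) ∧
      ∀ a : R, x * (a : A) = (σ a : A) * x + (δ a : A) := by
  have uniq : ∀ r s r' s' : R, (r : A) * x + s = r' * x + s' → r = r' ∧ s = s' := by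
    intro r s r' s' h
    have h2 : Finsupp.single 1 r + Finsupp.single 0 s =
        Finsupp.single 1 r' + Finsupp.single 0 s' := hinj (by simpa using h)
    exact ⟨by simpa using DFunLike.congr_fun h2 1, by simpa using DFunLike.congr_fun h2 0⟩
  choose σ δ h using hex
  have hadd : ∀ a b, σ (a + b) = σ a + σ b ∧ δ (a + b) = δ a + δ b := fun a b => by
    apply uniq
    rw [← h]
    push_cast
    rw [mul_add, h, h, add_mul]
    abel
  have hsmul : ∀ (c : K) a, σ (c • a) = c • σ a ∧ δ (c • a) = c • δ a := fun c a => by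
    apply uniq
    rw [← h]
    simp only [Subalgebra.coe_smul, mul_smul_comm, h, smul_add, smul_mul_assoc]
  have hmul : ∀ a b, σ (a * b) = σ a * σ b ∧ δ (a * b) = σ a * δ b + δ a * b := fun a b => by
    apply uniq
    rw [← h]
    push_cast
    rw [← mul_assoc, h, add_mul, mul_assoc, h, mul_add, mul_assoc, add_assoc]
  have hone : σ 1 = 1 ∧ δ 1 = 0 := by
    apply uniq
    rw [← h]
    simp
  refine ⟨AlgHom.ofLinearMap ⟨⟨σ, fun a b => (hadd a b).1⟩, fun c a => (hsmul c a).1⟩ hone.1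
    fun a b => (hmul a b).1, ⟨⟨δ, fun a b => (hadd a b).2⟩, fun c a => (hsmul c a).2⟩,
    fun a b => (hmul a b).2, h⟩

theorem firstAdjoin_mono (x : ℕ → A) {k m : ℕ} (h : k ≤ m) :
    firstAdjoin K x k ≤ firstAdjoin K x m :=
  Algebra.adjoin_mono (Set.image_mono (Set.Iio_subset_Iio h))

theorem mem_firstAdjoin (x : ℕ → A) {l k : ℕ} (h : l < k) : x l ∈ firstAdjoin K x k :=
  Algebra.subset_adjoin (Set.mem_image_of_mem x h)

theorem firstSpan_pow_le_adjoin (x : ℕ → A) (k d : ℕ) :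
    firstSpan K x k ^ d ≤ Subalgebra.toSubmodule (firstAdjoin K x k) := by
  induction d with
  | zero =>
    rw [pow_zero, Submodule.one_le]
    exact one_mem (firstAdjoin K x k)
  | succ d ih =>
    rw [pow_succ, Submodule.mul_le]
    exact fun y hy z hz => (firstAdjoin K x k).mul_mem (ih hy) (Algebra.span_le_adjoin K _ hz)

theorem Straightens.exists_mul_eq {x : ℕ → A} {k : ℕ} (h : Straightens K x (k + 1))
    (a : firstAdjoin K x k) :
    ∃ r s : firstAdjoin K x k, x k * (a : A) = r * x k + s := by
  obtain ⟨a, ha⟩ := a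
  refine Algebra.adjoin_induction
    (p := fun a _ => ∃ r s : firstAdjoin K x k, x k * a = r * x k + s) ?_ ?_ ?_ ?_ ha
  · rintro _ ⟨l, hl, rfl⟩
    obtain ⟨c, -, hc⟩ := h k k.lt_succ_self l hl
    refine ⟨c • ⟨x l, mem_firstAdjoin x hl⟩, ⟨_, firstSpan_pow_le_adjoin x k 2 hc⟩, ?_⟩
    simp
  · intro r
    exact ⟨algebraMap K _ r, 0, by simp [Algebra.commutes]⟩
  · rintro a b _ _ ⟨r, s, h1⟩ ⟨r', s', h2⟩
    exact ⟨r + r', s + s', by push_cast; rw [mul_add, h1, h2, add_mul]; abel⟩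
  · rintro a b _ hb ⟨r, s, h1⟩ ⟨r', s', h2⟩
    exact ⟨r * r', r * s' + s * ⟨b, hb⟩, by
      push_cast
      rw [← mul_assoc, h1, add_mul, mul_assoc, h2, mul_add, mul_assoc, add_assoc]⟩

/-- Reduces freeness over the smaller subalgebra to linear independence over `K` of the ordered
monomials with one more variable. -/
theorem oreSum_eq_linearCombination {x : ℕ → A} {k : ℕ} (h : Straightens K x k)
    (hli : LinearIndependent K (ordMon x k)) :
    oreSum (firstAdjoin K x k) (x k) =
      (Finsupp.linearCombination K
        (fun p : Σ _ : ℕ, Fin k → ℕ => ordMon x k p.2 * x k ^ p.1)).comp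
      (Finsupp.basis fun _ : ℕ => ordBasis h hli).repr.toLinearMap := by
  apply (Finsupp.basis fun _ : ℕ => ordBasis h hli).ext
  rintro ⟨i, a⟩
  rw [LinearMap.comp_apply, LinearEquiv.coe_coe, Module.Basis.repr_self]
  simp [Finsupp.coe_basis, coe_ordBasis]

theorem oreSum_injective {x : ℕ → A} {k : ℕ} (h : Straightens K x (k + 1))
    (hli : LinearIndependent K (ordMon x (k + 1))) :
    Function.Injective (oreSum (firstAdjoin K x k) (x k)) := by
  rw [oreSum_eq_linearCombination (h.mono k.le_succ) (linearIndependent_ordMon_of_succ hli)]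
  have := hli.comp (fun p : Σ _ : ℕ, Fin k → ℕ => Fin.snoc (α := fun _ => ℕ) p.2 p.1) (by
    rintro ⟨i, a⟩ ⟨j, b⟩ hab
    have h1 := congrArg Fin.init hab
    have h2 := congrFun hab (Fin.last k)
    simp only [Fin.init_snoc, Fin.snoc_last] at h1 h2
    rw [h1, h2])
  have h3 : (fun p : Σ _ : ℕ, Fin k → ℕ => ordMon x k p.2 * x k ^ p.1) =
      ordMon x (k + 1) ∘ fun p => Fin.snoc (α := fun _ => ℕ) p.2 p.1 := by
    ext p
    simp [ordMon_succ_snoc]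
  rw [← h3] at this
  rw [LinearMap.coe_comp]
  exact Function.Injective.comp (g := Finsupp.linearCombination K _) this
    (LinearEquiv.injective _)

theorem mem_range_oreSum {x : ℕ → A} {k : ℕ} (h : Straightens K x (k + 1)) {s : A}
    (hs : s ∈ firstAdjoin K x (k + 1)) :
    s ∈ LinearMap.range (oreSum (firstAdjoin K x k) (x k)) := by
  rw [← Subalgebra.mem_toSubmodule, ← span_range_ordMon h] at hs
  refine Submodule.span_le.2 ?_ hs
  rintro _ ⟨a, rfl⟩
  exact ⟨Finsupp.single (a (Fin.last k)) ⟨_, ordMon_mem_adjoin x k (Fin.init a)⟩, by simp [ordMon]⟩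

/-- A homomorphism that scales the variables scales their ordered monomials. The domain `R` is
independent of `k` so that induction on `k` leaves `σ` fixed. -/
theorem Straightens.map_ordMon {x : ℕ → A} {k : ℕ} {R : Subalgebra K A} (σ : R →ₐ[K] R)
    (hσ : ∀ l < k, ∃ c : K, c ≠ 0 ∧ ∀ y : R, (y : A) = x l → (σ y : A) = c • x l)
    (hR : firstAdjoin K x k ≤ R) (a : Fin k → ℕ) :
    ∃ c : K, c ≠ 0 ∧ ∀ y : R, (y : A) = ordMon x k a → (σ y : A) = c • ordMon x k a := by
  induction k with
  | zero =>
    refine ⟨1, one_ne_zero, fun y hy => ?_⟩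
    obtain rfl : y = 1 := Subtype.ext hy
    simp [ordMon]
  | succ k ih =>
    obtain ⟨c, hc, h1⟩ := ih (fun l hl => hσ l (by omega))
      ((firstAdjoin_mono x k.le_succ).trans hR) (Fin.init a)
    obtain ⟨c', hc', h2⟩ := hσ k k.lt_succ_self
    refine ⟨c * c' ^ a (Fin.last k), mul_ne_zero hc (pow_ne_zero _ hc'), fun y hy => ?_⟩
    obtain rfl : y = ⟨ordMon x k (Fin.init a),
        hR (firstAdjoin_mono x k.le_succ (ordMon_mem_adjoin x k _))⟩ *
        ⟨x k, hR (mem_firstAdjoin x k.lt_succ_self)⟩ ^ a (Fin.last k) := Subtype.ext hy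
    rw [map_mul, map_pow]
    push_cast
    rw [h1 _ rfl, h2 _ rfl, smul_pow, smul_mul_smul_comm, ordMon]

theorem bijective_of_basis_smul {ι V : Type*} [AddCommGroup V] [Module K V]
    (b : Module.Basis ι K V) (f : V →ₗ[K] V)
    (hf : ∀ i, ∃ c : K, c ≠ 0 ∧ f (b i) = c • b i) : Function.Bijective f := by
  choose c hc hf using hf
  have h1 : (b.constr K fun i => (c i)⁻¹ • b i).comp f = LinearMap.id := b.ext fun i => by
    simp [hf, hc]
  have h2 : f.comp (b.constr K fun i => (c i)⁻¹ • b i) = LinearMap.id := b.ext fun i => by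
    simp [hf, hc]
  exact Function.bijective_iff_has_inverse.2
    ⟨_, fun v => LinearMap.congr_fun h1 v, fun v => LinearMap.congr_fun h2 v⟩

theorem isOreExtension_firstAdjoin {x : ℕ → A} {k : ℕ} (h : Straightens K x (k + 1))
    (hli : LinearIndependent K (ordMon x (k + 1))) :
    IsOreExtension (firstAdjoin K x k) (firstAdjoin K x (k + 1)) (x k) where
  le := firstAdjoin_mono x k.le_succ
  mem := mem_firstAdjoin x k.lt_succ_self
  skew := by
    have hinj := oreSum_injective h hli
    obtain ⟨σ, δ, hδ, hx⟩ := exists_skew_of_oreSum_injective _ _ hinj h.exists_mul_eq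
    -- In the basis of ordered monomials `σ` is diagonal with non-zero entries.
    have hbij : Function.Bijective σ := by
      refine bijective_of_basis_smul
        (ordBasis (h.mono k.le_succ) (linearIndependent_ordMon_of_succ hli)) σ.toLinearMap
        fun a => ?_
      obtain ⟨c, hc, h1⟩ := Straightens.map_ordMon (x := x) (k := k) σ (fun l hl => by
        obtain ⟨c, hc, h2⟩ := h k k.lt_succ_self l hl
        refine ⟨c, hc, fun y hy => ?_⟩
        have h3 := hx y
        -- Both sides expand `x k * x l`, by the skew rule and by straightening; the coefficient of
        -- `x k` gives `σ (x l) = c • x l`.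
        have h4 : Finsupp.single 1 (σ y) + Finsupp.single 0 (δ y) =
            Finsupp.single 1 (c • y) +
              Finsupp.single 0 ⟨_, firstSpan_pow_le_adjoin x k 2 h2⟩ := by
          apply hinj
          simp only [map_add, oreSum_single, pow_one, pow_zero, mul_one, Subalgebra.coe_smul]
          rw [← h3, hy]
          simp
        have h5 : σ y = c • y := by simpa using DFunLike.congr_fun h4 1
        rw [h5, Subalgebra.coe_smul, hy]) le_rfl a
      refine ⟨c, hc, Subtype.ext ?_⟩
      rw [AlgHom.toLinearMap_apply, h1 _ (coe_ordBasis _ _ a), Subalgebra.coe_smul, coe_ordBasis]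
    exact ⟨AlgEquiv.ofBijective σ hbij, δ, hδ, hx⟩
  free := fun s hs => by
    obtain ⟨c, rfl⟩ := mem_range_oreSum h hs
    exact ⟨c, rfl, fun c' hc' => oreSum_injective h hli hc'.symm⟩

end Ore

/-! ### Leading coefficients in Ore extensions and zero divisors -/

section Domain

variable {K A : Type*} [Field K] [Ring A] [Algebra K A]

/-- Left polynomials in `x` of degree less than `m`. -/
def oreFiltration (R : Subalgebra K A) (x : A) (m : ℕ) : Submodule K A :=
  Submodule.span K {y | ∃ r ∈ R, ∃ i < m, y = r * x ^ i}

variable {R : Subalgebra K A} {x : A}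

theorem oreFiltration_mono {m m' : ℕ} (h : m ≤ m') :
    oreFiltration R x m ≤ oreFiltration R x m' :=
  Submodule.span_mono fun _ ⟨r, hr, i, hi, hy⟩ => ⟨r, hr, i, hi.trans_le h, hy⟩

theorem mul_pow_mem_oreFiltration {r : A} (hr : r ∈ R) {i m : ℕ} (h : i < m) :
    r * x ^ i ∈ oreFiltration R x m := Submodule.subset_span ⟨r, hr, i, h, rfl⟩

theorem oreFiltration_le_comap {m : ℕ} {W : Submodule K A} (f : A →ₗ[K] A)
    (h : ∀ r ∈ R, ∀ i < m, f (r * x ^ i) ∈ W) {y : A} (hy : y ∈ oreFiltration R x m) :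
    f y ∈ W := by
  refine (Submodule.span_le (p := W.comap f)).2 ?_ hy
  rintro _ ⟨r, hr, i, hi, rfl⟩
  exact h r hr i hi

theorem mul_mem_oreFiltration {m : ℕ} {a : A} (ha : a ∈ R) {y : A}
    (hy : y ∈ oreFiltration R x m) : a * y ∈ oreFiltration R x m :=
  oreFiltration_le_comap (LinearMap.mulLeft K a) (fun r hr i hi => by
    rw [LinearMap.mulLeft_apply, ← mul_assoc]
    exact mul_pow_mem_oreFiltration (mul_mem ha hr) hi) hy

theorem mul_right_pow_mem_oreFiltration {m j : ℕ} {y : A} (hy : y ∈ oreFiltration R x m) :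
    y * x ^ j ∈ oreFiltration R x (m + j) :=
  oreFiltration_le_comap (LinearMap.mulRight K (x ^ j)) (fun r hr i hi => by
    rw [LinearMap.mulRight_apply, mul_assoc, ← pow_add]
    exact mul_pow_mem_oreFiltration hr (by omega)) hy

theorem oreSum_mem_oreFiltration {m : ℕ} {c : ℕ →₀ R} (hc : ∀ i, m ≤ i → c i = 0) :
    oreSum R x c ∈ oreFiltration R x m := by
  rw [oreSum_apply]
  refine Submodule.sum_mem _ fun i hi => mul_pow_mem_oreFiltration (c i).2 ?_
  by_contra h
  exact Finsupp.mem_support_iff.1 hi (hc i (not_lt.1 h))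

theorem exists_oreSum_of_mem_oreFiltration {m : ℕ} {y : A} (hy : y ∈ oreFiltration R x m) :
    ∃ c : ℕ →₀ R, (∀ i, m ≤ i → c i = 0) ∧ oreSum R x c = y := by
  refine Submodule.span_induction
    (p := fun y _ => ∃ c : ℕ →₀ R, (∀ i, m ≤ i → c i = 0) ∧ oreSum R x c = y) ?_
    ⟨0, by simp⟩ ?_ ?_ hy
  · rintro _ ⟨r, hr, i, hi, rfl⟩
    refine ⟨Finsupp.single i ⟨r, hr⟩, fun j hj => ?_, by simp⟩
    rw [Finsupp.single_eq_of_ne (by omega)]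
  · rintro _ _ _ _ ⟨c, hc, rfl⟩ ⟨c', hc', rfl⟩
    exact ⟨c + c', fun i hi => by simp [hc i hi, hc' i hi], by simp⟩
  · rintro t _ _ ⟨c, hc, rfl⟩
    exact ⟨t • c, fun i hi => by simp [hc i hi], by simp⟩

section Skew

variable {σ : R ≃ₐ[K] R} {δ : R →ₗ[K] R}

theorem pow_mul_mem_oreFiltration
    (hx : ∀ a : R, x * (a : A) = (σ a : A) * x + (δ a : A))
    {m : ℕ} (j : ℕ) {y : A} (hy : y ∈ oreFiltration R x m) :
    x ^ j * y ∈ oreFiltration R x (m + j) := by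
  induction j with
  | zero => simpa using hy
  | succ j ih =>
    rw [pow_succ', mul_assoc]
    refine oreFiltration_le_comap (LinearMap.mulLeft K x) (fun r hr i hi => ?_) ih
    have := hx ⟨r, hr⟩
    simp only at this
    rw [LinearMap.mulLeft_apply, ← mul_assoc, this, add_mul, mul_assoc, ← pow_succ']
    exact add_mem (mul_pow_mem_oreFiltration (Subtype.prop _) (by omega))
      (mul_pow_mem_oreFiltration (Subtype.prop _) (by omega))

/-- Each passage of `x` across a coefficient applies `σ` and leaves an error `δ` of lower degree. -/
theorem pow_mul_sub_mem_oreFiltration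
    (hx : ∀ a : R, x * (a : A) = (σ a : A) * x + (δ a : A))
    (m : ℕ) (a : R) :
    x ^ m * a - ((σ ^ m) a : R) * x ^ m ∈ oreFiltration R x m := by
  induction m with
  | zero => simp
  | succ m ih =>
    have h1 : x ^ (m + 1) * a - ((σ ^ (m + 1)) a : R) * x ^ (m + 1) =
        x ^ 1 * (x ^ m * a - ((σ ^ m) a : R) * x ^ m) + (δ ((σ ^ m) a) : A) * x ^ m := by
      have := hx ((σ ^ m) a)
      rw [mul_sub, ← mul_assoc (x ^ 1) (((σ ^ m) a : R) : A), pow_one, this, add_mul,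
        pow_succ' σ, AlgEquiv.mul_apply, pow_succ' x, mul_assoc x, mul_assoc _ x]
      abel
    rw [h1]
    exact add_mem (pow_mul_mem_oreFiltration hx 1 ih)
      (mul_pow_mem_oreFiltration (Subtype.prop _) (by omega))

theorem mul_right_mem_oreFiltration
    (hx : ∀ a : R, x * (a : A) = (σ a : A) * x + (δ a : A))
    {m : ℕ} {y : A} (hy : y ∈ oreFiltration R x m) (a : R) :
    y * a ∈ oreFiltration R x m :=
  oreFiltration_le_comap (LinearMap.mulRight K (a : A)) (fun r hr i hi => by
    rw [LinearMap.mulRight_apply, mul_assoc, ← sub_add_cancel (x ^ i * (a : A))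
      (((σ ^ i) a : R) * x ^ i), mul_add, ← mul_assoc]
    exact add_mem (mul_mem_oreFiltration hr (oreFiltration_mono hi.le
      (pow_mul_sub_mem_oreFiltration hx i a)))
      (mul_pow_mem_oreFiltration (mul_mem hr (Subtype.prop _)) hi)) hy

/-- The leading coefficient of a product is `a * σ ^ m b`; the four correction terms all have degree
below `m + n`. -/
theorem mul_sub_mem_oreFiltration
    (hx : ∀ a : R, x * (a : A) = (σ a : A) * x + (δ a : A))
    {m n : ℕ} (a b : R) {f g : A}
    (hf : f ∈ oreFiltration R x m) (hg : g ∈ oreFiltration R x n) :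
    (a * x ^ m + f) * (b * x ^ n + g) - ((a * (σ ^ m) b : R) : A) * x ^ (m + n) ∈
      oreFiltration R x (m + n) := by
  have h1 : (a * x ^ m + f) * (b * x ^ n + g) - ((a * (σ ^ m) b : R) : A) * x ^ (m + n) =
      a * ((x ^ m * b - ((σ ^ m) b : R) * x ^ m) * x ^ n) + f * b * x ^ n +
        a * (x ^ m * g) + f * g := by
    push_cast
    rw [pow_add]
    noncomm_ring
  rw [h1]
  refine add_mem (add_mem (add_mem ?_ ?_) ?_) ?_
  · exact mul_mem_oreFiltration a.2
      (mul_right_pow_mem_oreFiltration (pow_mul_sub_mem_oreFiltration hx m b))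
  · exact mul_right_pow_mem_oreFiltration (mul_right_mem_oreFiltration hx hf b)
  · rw [add_comm m]
    exact mul_mem_oreFiltration a.2 (pow_mul_mem_oreFiltration hx m hg)
  · refine oreFiltration_le_comap (LinearMap.mulRight K g) (fun r hr i hi => ?_) hf
    rw [LinearMap.mulRight_apply, mul_assoc]
    exact mul_mem_oreFiltration hr (oreFiltration_mono (by omega)
      (pow_mul_mem_oreFiltration hx i hg))

end Skew

theorem IsOreExtension.exists_leading {S : Subalgebra K A} (h : IsOreExtension R S x) {s : A}
    (hs : s ∈ S) (hs0 : s ≠ 0) :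
    ∃ (m : ℕ) (a : R) (f : A), a ≠ 0 ∧ f ∈ oreFiltration R x m ∧ s = a * x ^ m + f := by
  obtain ⟨c, hc, -⟩ := h.free s hs
  have hc0 : c.support.Nonempty := by
    rw [Finsupp.support_nonempty_iff]
    rintro rfl
    exact hs0 (by simpa using hc)
  set m := c.support.max' hc0
  refine ⟨m, c m, oreSum R x (c.erase m), Finsupp.mem_support_iff.1 (c.support.max'_mem hc0),
    oreSum_mem_oreFiltration fun i hi => ?_, ?_⟩
  · rcases hi.eq_or_lt with rfl | hi
    · simp
    · rw [Finsupp.erase_ne hi.ne']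
      by_contra h
      exact hi.not_ge (c.support.le_max' i (Finsupp.mem_support_iff.2 h))
  · have := congrArg (oreSum R x) (Finsupp.single_add_erase m c)
    rw [map_add, oreSum_single] at this
    rw [this, hc, oreSum_apply]

/-- If the product vanished, its top term would lie in lower degree, so by uniqueness of
coefficients `a * σ ^ m b = 0`. This is impossible for non-zero `a`, `b`, since `σ` is injective and
`R` has no zero divisors. -/
theorem IsOreExtension.eq_zero_or_eq_zero {S : Subalgebra K A} (h : IsOreExtension R S x)
    (hR : ∀ a b : R, a * b = 0 → a = 0 ∨ b = 0) {s t : A} (hs : s ∈ S) (ht : t ∈ S)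
    (hst : s * t = 0) : s = 0 ∨ t = 0 := by
  by_contra! hne
  obtain ⟨σ, δ, -, hx⟩ := h.skew
  obtain ⟨m, a, f, ha, hf, rfl⟩ := h.exists_leading hs hne.1
  obtain ⟨n, b, g, hb, hg, rfl⟩ := h.exists_leading ht hne.2
  have h1 := mul_sub_mem_oreFiltration hx a b hf hg
  rw [hst, zero_sub, neg_mem_iff] at h1
  obtain ⟨c, hc, hc2⟩ := exists_oreSum_of_mem_oreFiltration h1
  have h2 := (h.free (((a * (σ ^ m) b : R) : A) * x ^ (m + n))
    (mul_mem (h.le (Subtype.prop _)) (pow_mem h.mem _))).unique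
    (y₁ := c) (y₂ := Finsupp.single (m + n) (a * (σ ^ m) b)) hc2.symm (oreSum_single R x _ _).symm
  have h3 := hc (m + n) le_rfl
  rw [h2, Finsupp.single_eq_same] at h3
  rcases hR _ _ h3 with h4 | h4
  · exact ha h4
  · exact hb ((map_eq_zero_iff _ (σ ^ m).injective).1 h4)

theorem eq_zero_or_eq_zero_of_mem_firstAdjoin {x : ℕ → A} {k : ℕ} (h : Straightens K x k)
    (hli : LinearIndependent K (ordMon x k)) {s t : A} (hs : s ∈ firstAdjoin K x k)
    (ht : t ∈ firstAdjoin K x k) (hst : s * t = 0) : s = 0 ∨ t = 0 := by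
  induction k generalizing s t with
  | zero =>
    have : Nontrivial A := ⟨⟨_, _, hli.ne_zero 0⟩⟩
    have h0 : firstAdjoin K x 0 = ⊥ := by simp [firstAdjoin]
    rw [h0, Algebra.mem_bot] at hs ht
    obtain ⟨a, rfl⟩ := hs
    obtain ⟨b, rfl⟩ := ht
    rw [← map_mul, map_eq_zero] at hst
    simpa using hst
  | succ k ih =>
    refine (isOreExtension_firstAdjoin h hli).eq_zero_or_eq_zero (fun a b hab => ?_) hs ht hst
    simpa using ih (h.mono k.le_succ) (linearIndependent_ordMon_of_succ hli) a.2 b.2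
      (congrArg Subtype.val hab)

end Domain

/-! ### Consequences of linear independence of the ordered monomials -/

section PBW

variable {K A : Type*} [Field K] [Ring A] [Algebra K A]

theorem isIteratedOreExtension_of_straightens {x : ℕ → A} {N : ℕ} (h : Straightens K x N)
    (hli : LinearIndependent K (ordMon x N)) (hgen : firstAdjoin K x N = ⊤) :
    IsIteratedOreExtension K (fun k : Fin N => x k) :=
  ⟨fun k => firstAdjoin K x k, by simp [firstAdjoin], by simpa using hgen, fun k =>
    isOreExtension_firstAdjoin (h.mono k.isLt) (linearIndependent_ordMon_of_le k.isLt hli)⟩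

theorem isDomain_of_straightens {x : ℕ → A} {N : ℕ} (h : Straightens K x N)
    (hli : LinearIndependent K (ordMon x N)) (hgen : firstAdjoin K x N = ⊤) : IsDomain A := by
  have : Nontrivial A := ⟨⟨_, _, hli.ne_zero 0⟩⟩
  have : NoZeroDivisors A := ⟨fun {a b} hab => eq_zero_or_eq_zero_of_mem_firstAdjoin h hli
    (by rw [hgen]; trivial) (by rw [hgen]; trivial) hab⟩
  exact NoZeroDivisors.to_isDomain A

/-- Each power of the span of the variables is spanned by the ordered monomials of that degree;
these sets partition a basis. -/
theorem isInternal_of_straightens {x : ℕ → A} {N : ℕ} (h : Straightens K x N)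
    (hli : LinearIndependent K (ordMon x N)) (hgen : firstAdjoin K x N = ⊤) :
    DirectSum.IsInternal fun d : ℕ => firstSpan K x N ^ d := by
  simp only [firstSpan_pow h]
  apply DirectSum.isInternal_submodule_of_iSupIndep_of_iSup_eq_top
  · intro d
    refine (hli.disjoint_span_image (s := {a | ∑ i, a i = d}) (t := {a | ∑ i, a i ≠ d})
      ?_).mono_right ?_
    · exact Set.disjoint_left.2 fun a h1 h2 => h2 h1
    · refine iSup₂_le fun e he => Submodule.span_mono (Set.image_mono fun a ha => ?_)
      simp only [Set.mem_ofPred_eq] at ha ⊢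
      omega
  · rw [eq_top_iff, ← Algebra.top_toSubmodule, ← hgen, ← span_range_ordMon h, Submodule.span_le]
    rintro _ ⟨a, rfl⟩
    exact Submodule.mem_iSup_of_mem (∑ i, a i) (Submodule.subset_span ⟨a, rfl, rfl⟩)

theorem finrank_firstSpan_pow {x : ℕ → A} {N : ℕ} (h : Straightens K x N)
    (hli : LinearIndependent K (ordMon x N)) (d : ℕ) :
    Module.finrank K ↥(firstSpan K x N ^ d) = Nat.card {a : Fin N → ℕ // ∑ i, a i = d} := by
  have hli' : LinearIndependent K fun a : {a : Fin N → ℕ // ∑ i, a i = d} => ordMon x N a :=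
    hli.comp _ Subtype.val_injective
  rw [firstSpan_pow h, ordSpan, Set.image_eq_range]
  exact Module.finrank_eq_nat_card_basis (Module.Basis.span hli')

theorem finrank_homogeneousSubmodule {ι : Type*} [Fintype ι] (d : ℕ) :
    Module.finrank K (MvPolynomial.homogeneousSubmodule ι K d) =
      Nat.card {a : ι → ℕ // ∑ i, a i = d} := by
  rw [MvPolynomial.homogeneousSubmodule_eq_finsupp_supported]
  refine (Module.finrank_eq_nat_card_basis
    (MvPolynomial.basisRestrictSupport K {a : ι →₀ ℕ | a.degree = d})).trans ?_
  refine Nat.card_congr (Equiv.subtypeEquiv Finsupp.equivFunOnFinite fun a => ?_)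
  simp [Finsupp.degree_eq_sum]

theorem hilbertSeries_of_straightens {x : ℕ → A} {N : ℕ} (h : Straightens K x N)
    (hli : LinearIndependent K (ordMon x N)) {ι : Type*} [Fintype ι] (e : ι ≃ Fin N) :
    hilbertSeries (fun d : ℕ => firstSpan K x N ^ d) =
      hilbertSeries (MvPolynomial.homogeneousSubmodule ι K) := by
  ext d
  simp only [hilbertSeries, PowerSeries.coeff_mk]
  rw [finrank_firstSpan_pow h hli, finrank_homogeneousSubmodule]
  refine Nat.card_congr (Equiv.subtypeEquiv (Equiv.arrowCongr e.symm (Equiv.refl ℕ)) fun a => ?_)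
  simp [Equiv.sum_comp e a]

theorem map_ordMon {B : Type*} [Ring B] [Algebra K B] (f : B →ₐ[K] A) (y : ℕ → B) (k : ℕ)
    (a : Fin k → ℕ) : f (ordMon y k a) = ordMon (fun i => f (y i)) k a := by
  induction k with
  | zero => simp [ordMon]
  | succ k ih => simp [ordMon, ih]

theorem ordMon_congr {x y : ℕ → A} {k : ℕ} (h : ∀ l < k, x l = y l) (a : Fin k → ℕ) :
    ordMon x k a = ordMon y k a := by
  induction k with
  | zero => rfl
  | succ k ih => rw [ordMon, ordMon, ih fun l hl => h l (by omega), h k (by omega)]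

/-- Ordered monomials span the source and their images are independent in the target, so no
combination is killed. Independence in the source is obtained for free. -/
theorem bijective_of_straightens {B : Type*} [Ring B] [Algebra K B] (f : B →ₐ[K] A) {y : ℕ → B}
    {N : ℕ} (h : Straightens K y N) (hgen : firstAdjoin K y N = ⊤)
    (hli : LinearIndependent K (ordMon (fun i => f (y i)) N))
    (hgen' : firstAdjoin K (fun i => f (y i)) N = ⊤) : Function.Bijective f := by
  constructor
  · have hli' : LinearIndependent K (f.toLinearMap ∘ ordMon y N) := by
      convert hli using 1
      ext a
      exact map_ordMon f y N a
    rw [← AlgHom.coe_toLinearMap, ← LinearMap.ker_eq_bot]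
    have h1 := linearIndependent_iff_injective_finsuppLinearCombination.1 hli'
    rw [LinearMap.ker_eq_bot']
    intro b hb
    have hb2 : b ∈ Submodule.span K (Set.range (ordMon y N)) := by
      rw [span_range_ordMon h, hgen]; trivial
    obtain ⟨c, rfl⟩ := (Finsupp.mem_span_range_iff_exists_finsupp).1 hb2
    have h2 : c = 0 := h1 (by
      rw [map_zero, Finsupp.linearCombination_apply, ← hb, Finsupp.sum, Finsupp.sum, map_sum]
      simp)
    simp [h2]
  · rw [← AlgHom.range_eq_top, eq_top_iff, ← hgen', firstAdjoin, Algebra.adjoin_le_iff]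
    rintro _ ⟨l, -, rfl⟩
    exact ⟨y l, rfl⟩

end PBW

/-! ### Quadratic relations from the quantum Serre relations -/

section SerreRelations

variable {K A : Type*} [Field K] [Ring A] [Algebra K A]

/-- The quantum Serre expression `a² b - (q + q⁻¹) a b a + b a²`. -/
def serreElt (q : K) (a b : A) : A := a ^ 2 * b - (q + q⁻¹) • (a * b * a) + b * a ^ 2

/-- The `q`-commutator `a x - q x a`. -/
def qComm (q : K) (a x : A) : A := a * x - q • (x * a)

/-- A family indexed by `ℤ` which satisfies the quantum Serre relations of type `A_∞`. -/
structure IsSerreFamily (q : K) (e : ℤ → A) : Prop where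
  comm : ∀ i j, i ≠ j → j ≠ i + 1 → i ≠ j + 1 → e i * e j = e j * e i
  serre : ∀ i j, j = i + 1 ∨ i = j + 1 → serreElt q (e i) (e j) = 0

/-- Iterated `q`-commutators of `e₀` with `e₁, …, e_j`. -/
def rowZ (q : K) (e : ℤ → A) : ℕ → A
  | 0 => e 0
  | j + 1 => qComm q (e (j + 1 : ℕ)) (rowZ q e j)

/-- Iterated `q`-commutators of `e₀` with `e₁, …, e_j` and then with `e₋₁, …, e₋ᵢ`. -/
def gridZ (q : K) (e : ℤ → A) : ℕ → ℕ → A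
  | 0, j => rowZ q e j
  | i + 1, j => qComm q (e (-(i + 1 : ℕ))) (gridZ q e i j)

theorem qComm_left_comm {q : K} {a b : A} (h : a * b = b * a) (x : A) :
    qComm q a (qComm q b x) = qComm q b (qComm q a x) := by
  have h1 : ∀ y, a * (b * y) = b * (a * y) := fun y => by rw [← mul_assoc, h, mul_assoc]
  simp only [qComm, mul_sub, sub_mul, smul_mul_assoc, mul_smul_comm, mul_assoc, h1, h]
  module

theorem qComm_commute {q c : K} {a b x : A} (h : b * a = a * b) (hx : b * x = c • (x * b)) :
    b * qComm q a x = c • (qComm q a x * b) := by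
  have h1 : ∀ y, b * (a * y) = a * (b * y) := fun y => by rw [← mul_assoc, h, mul_assoc]
  have h2 : ∀ y, b * (x * y) = c • (x * (b * y)) := fun y => by
    rw [← mul_assoc, hx, smul_mul_assoc, mul_assoc]
  simp only [qComm, mul_sub, sub_mul, smul_mul_assoc, mul_smul_comm, mul_assoc, h1, h2, h, hx]
  module

theorem qComm_commute_one {q : K} {a b x : A} (h : b * a = a * b) (hx : b * x = x * b) :
    b * qComm q a x = qComm q a x * b := by
  simpa using qComm_commute (q := q) (c := 1) h (by simpa using hx)

/-- The Serre expression is linear in its second argument, and `x` can be pulled out because it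
commutes with `a`. -/
theorem serreElt_qComm {q : K} {a b x : A} (h : serreElt q a b = 0) (hx : a * x = x * a) :
    serreElt q a (qComm q b x) = 0 := by
  have h1 : ∀ y, a * (x * y) = x * (a * y) := fun y => by rw [← mul_assoc, hx, mul_assoc]
  have : serreElt q a (qComm q b x) = serreElt q a b * x - q • (x * serreElt q a b) := by
    simp only [serreElt, qComm, mul_sub, sub_mul, mul_add, add_mul, smul_mul_assoc,
      mul_smul_comm, mul_assoc, pow_two, h1, hx]
    module
  rw [this, h]
  simp

/-- The Serre expression factors as `a [a,x] - q⁻¹ [a,x] a`, where `[a,x]` is the `q`-commutator. -/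
theorem mul_qComm_self {q : K} (hq : q ≠ 0) {a x : A} (h : serreElt q a x = 0) :
    a * qComm q a x = q⁻¹ • (qComm q a x * a) := by
  rw [← sub_eq_zero, ← h]
  simp only [serreElt, qComm, mul_sub, sub_mul, smul_mul_assoc, mul_smul_comm, mul_assoc, pow_two]
  match_scalars <;> field_simp
  ring

/-- Here `b` and `y` play the two neighbours of the node `a`. The ordinary commutator, multiplied by
`q + q⁻¹`, is a combination of the two Serre expressions; cancelling that factor is where `q ^ 2 + 1
≠ 0` is needed. -/
theorem commute_qComm_qComm {q : K} (hq : q ≠ 0) (hq4 : q ^ 2 + 1 ≠ 0) {a b y : A}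
    (hb : serreElt q a b = 0) (hy : serreElt q a y = 0) (hby : b * y = y * b) :
    a * qComm q b (qComm q a y) = qComm q b (qComm q a y) * a := by
  have h1 : ∀ z, b * (y * z) = y * (b * z) := fun z => by rw [← mul_assoc, hby, mul_assoc]
  have : (q + q⁻¹) • (a * qComm q b (qComm q a y) - qComm q b (qComm q a y) * a) =
      b * serreElt q a y + (q ^ 2) • (y * serreElt q a b) - serreElt q a b * y
        - (q ^ 2) • (serreElt q a y * b) := by
    simp only [serreElt, qComm, mul_sub, sub_mul, mul_add, add_mul, smul_mul_assoc,
      mul_smul_comm, mul_assoc, pow_two, h1, hby]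
    match_scalars <;> field_simp <;> ring
  rw [hb, hy] at this
  simp only [mul_zero, zero_mul, smul_zero, sub_zero, add_zero] at this
  rw [← sub_eq_zero]
  refine (smul_eq_zero.1 this).resolve_left ?_
  field_simp
  simpa using hq4

theorem qComm_mul_eq {q c : K} {a x y : A} (h : x * y = c • (y * x)) (ha : a * y = y * a) :
    qComm q a x * y = c • (y * qComm q a x) := by
  have h1 : ∀ z, x * (y * z) = c • (y * (x * z)) := fun z => by
    rw [← mul_assoc, h, smul_mul_assoc, mul_assoc]
  have h2 : ∀ z, a * (y * z) = y * (a * z) := fun z => by rw [← mul_assoc, ha, mul_assoc]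
  simp only [qComm, mul_sub, sub_mul, smul_mul_assoc, mul_smul_comm, mul_assoc, h1, h2, ha, h]
  module

theorem mul_qComm_eq {q c : K} {a x y : A} (h : x * y = c • (y * x)) (ha : a * x = x * a) :
    x * qComm q a y = c • (qComm q a y * x) := by
  have h1 : ∀ z, x * (y * z) = c • (y * (x * z)) := fun z => by
    rw [← mul_assoc, h, smul_mul_assoc, mul_assoc]
  have h2 : ∀ z, x * (a * z) = a * (x * z) := fun z => by rw [← mul_assoc, ← ha, mul_assoc]
  simp only [qComm, mul_sub, sub_mul, smul_mul_assoc, mul_smul_comm, mul_assoc, h1, h2, ha, h]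
  module

theorem mul_qComm_sub_eq {q c : K} {a x y u v : A} (h : x * y - y * x = c • (u * v))
    (hx : a * x = x * a) (hu : a * u = u * a) :
    x * qComm q a y - qComm q a y * x = c • (u * qComm q a v) := by
  have h2 : ∀ z, x * (a * z) = a * (x * z) := fun z => by rw [← mul_assoc, ← hx, mul_assoc]
  have h3 : ∀ z, u * (a * z) = a * (u * z) := fun z => by rw [← mul_assoc, ← hu, mul_assoc]
  have : x * qComm q a y - qComm q a y * x - c • (u * qComm q a v) =
      qComm q a (x * y - y * x - c • (u * v)) := by
    simp only [qComm, mul_sub, sub_mul, smul_mul_assoc, mul_smul_comm, mul_assoc, h2, h3, hx]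
    module
  rw [← sub_eq_zero, this, h]
  simp [qComm]

/-- Applying the `q`-commutator with `a` to the relation `x y = q y x`. -/
theorem qComm_skew {q : K} {a x y : A} (h : x * y = q • (y * x)) :
    qComm q a x * y + q • (x * qComm q a y) =
      q • (qComm q a y * x) + q ^ 2 • (y * qComm q a x) := by
  have : qComm q a x * y + q • (x * qComm q a y) -
      (q • (qComm q a y * x) + q ^ 2 • (y * qComm q a x)) =
      a * (x * y - q • (y * x)) - (q ^ 2) • ((x * y - q • (y * x)) * a) := by
    simp only [qComm, mul_sub, sub_mul, smul_mul_assoc, mul_smul_comm, mul_assoc]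
    module
  rw [← sub_eq_zero, this, h]
  simp

/-- Apply the `q`-commutator with `a` twice. After the first application, `qComm_skew` relates the
mixed products; the second is an ordinary commutator with `a`, in which they cancel and `q + q⁻¹`
times the desired relation remains. -/
theorem qComm_mul_qComm {q : K} (hq : q ≠ 0) (hq4 : q ^ 2 + 1 ≠ 0) {a x y : A}
    (h : x * y = q • (y * x)) (hx : a * qComm q a x = q⁻¹ • (qComm q a x * a))
    (hy : a * qComm q a y = q⁻¹ • (qComm q a y * a)) :
    qComm q a x * qComm q a y = q • (qComm q a y * qComm q a x) := by
  have h1 := qComm_skew (a := a) h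
  have hax : a * x = qComm q a x + q • (x * a) := by rw [qComm]; abel
  have hay : a * y = qComm q a y + q • (y * a) := by rw [qComm]; abel
  generalize qComm q a x = x' at *
  generalize qComm q a y = y' at *
  have hax' : ∀ z, a * (x * z) = x' * z + q • (x * (a * z)) := fun z => by
    rw [← mul_assoc, hax, add_mul, smul_mul_assoc, mul_assoc]
  have hay' : ∀ z, a * (y * z) = y' * z + q • (y * (a * z)) := fun z => by
    rw [← mul_assoc, hay, add_mul, smul_mul_assoc, mul_assoc]
  have hx' : ∀ z, a * (x' * z) = q⁻¹ • (x' * (a * z)) := fun z => by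
    rw [← mul_assoc, hx, smul_mul_assoc, mul_assoc]
  have hy' : ∀ z, a * (y' * z) = q⁻¹ • (y' * (a * z)) := fun z => by
    rw [← mul_assoc, hy, smul_mul_assoc, mul_assoc]
  have h2 : (q + q⁻¹) • (x' * y' - q • (y' * x')) =
      a * (x' * y + q • (x * y') - (q • (y' * x) + q ^ 2 • (y * x'))) -
      (x' * y + q • (x * y') - (q • (y' * x) + q ^ 2 • (y * x'))) * a := by
    simp only [mul_sub, sub_mul, mul_add, add_mul, smul_mul_assoc, mul_smul_comm, mul_assoc,
      hx', hy', hax', hay', hx, hy, hax, hay]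
    match_scalars <;> field_simp <;> ring
  rw [sub_eq_zero.2 h1] at h2
  rw [← sub_eq_zero]
  refine (smul_eq_zero.1 (h2.trans (by simp))).resolve_left ?_
  field_simp
  simpa using hq4

/-! ### Quadratic relations in the grid of iterated `q`-commutators -/

section Grid

variable {q : K} {e : ℤ → A}

theorem gridZ_succ_left (i j : ℕ) :
    gridZ q e (i + 1) j = qComm q (e (-(i + 1 : ℕ))) (gridZ q e i j) := rfl

theorem gridZ_succ_right (he : IsSerreFamily q e) (i j : ℕ) :
    gridZ q e i (j + 1) = qComm q (e (j + 1 : ℕ)) (gridZ q e i j) := by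
  induction i with
  | zero => rfl
  | succ i ih =>
    rw [gridZ_succ_left, ih, gridZ_succ_left, qComm_left_comm]
    exact he.comm _ _ (by push_cast; omega) (by push_cast; omega) (by push_cast; omega)

theorem IsSerreFamily.neg (he : IsSerreFamily q e) : IsSerreFamily q fun i => e (-i) where
  comm i j h1 h2 h3 := he.comm _ _ (by omega) (by omega) (by omega)
  serre i j h := he.serre _ _ (by omega)

/-- The reflection of the diagram exchanges rows and columns, so each statement about positive nodes
yields one about negative nodes. -/
theorem gridZ_neg (he : IsSerreFamily q e) (i j : ℕ) :
    gridZ q (fun i => e (-i)) i j = gridZ q e j i := by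
  induction i generalizing j with
  | zero =>
    induction j with
    | zero => simp [gridZ, rowZ]
    | succ j ih => rw [gridZ_succ_right he.neg, ih, gridZ_succ_left]
  | succ i ih =>
    rw [gridZ_succ_left, ih, gridZ_succ_right he, neg_neg]

theorem commute_gridZ_of_lt (he : IsSerreFamily q e) {k j : ℕ} (i : ℕ) (h : j + 1 < k) :
    e k * gridZ q e i j = gridZ q e i j * e k := by
  induction i with
  | zero =>
    induction j with
    | zero => exact he.comm _ _ (by omega) (by omega) (by omega)
    | succ j ih =>
      exact qComm_commute_one
        (he.comm _ _ (by push_cast; omega) (by push_cast; omega) (by push_cast; omega))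
        (ih (by omega))
  | succ i ih =>
    rw [gridZ_succ_left]
    exact qComm_commute_one
      (he.comm _ _ (by push_cast; omega) (by push_cast; omega) (by push_cast; omega)) ih

theorem serreElt_gridZ_zero (he : IsSerreFamily q e) (j : ℕ) :
    serreElt q (e (j + 1 : ℕ)) (gridZ q e 0 j) = 0 := by
  cases j with
  | zero => exact he.serre _ _ (by simp)
  | succ j =>
    exact serreElt_qComm (he.serre _ _ (by push_cast; omega))
      (commute_gridZ_of_lt he 0 (by omega))

/-- At an end of the chain the Serre relation gives `q⁻¹`-commutation; adding negative nodes changes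
nothing since they commute with `e (j + 1)`. -/
theorem mul_gridZ_succ (hq : q ≠ 0) (he : IsSerreFamily q e) (i j : ℕ) :
    e (j + 1 : ℕ) * gridZ q e i (j + 1) = q⁻¹ • (gridZ q e i (j + 1) * e (j + 1 : ℕ)) := by
  induction i with
  | zero => exact mul_qComm_self hq (serreElt_gridZ_zero he j)
  | succ i ih =>
    rw [gridZ_succ_left]
    exact qComm_commute
      (he.comm _ _ (by push_cast; omega) (by push_cast; omega) (by push_cast; omega)) ih

/-- An interior node `k + 1` of the positive arm commutes with the chain as soon as its outer
neighbour has been attached (`commute_qComm_qComm`); further nodes are not adjacent to it. -/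
theorem commute_gridZ_of_gt (hq : q ≠ 0) (hq4 : q ^ 2 + 1 ≠ 0) (he : IsSerreFamily q e)
    {k j : ℕ} (i : ℕ) (h : k + 1 < j) :
    e (k + 1 : ℕ) * gridZ q e i j = gridZ q e i j * e (k + 1 : ℕ) := by
  induction i with
  | zero =>
    induction j, (show k + 2 ≤ j from h) using Nat.le_induction with
    | base =>
      refine commute_qComm_qComm hq hq4 (he.serre _ _ (by push_cast; omega))
        (serreElt_gridZ_zero he k) ?_
      exact commute_gridZ_of_lt he 0 (by omega)
    | succ j hj ih =>
      exact qComm_commute_one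
        (he.comm _ _ (by push_cast; omega) (by push_cast; omega) (by push_cast; omega))
        (ih (by omega))
  | succ i ih =>
    rw [gridZ_succ_left]
    exact qComm_commute_one
      (he.comm _ _ (by push_cast; omega) (by push_cast; omega) (by push_cast; omega)) ih

/-- The two exceptions are the node that ends the positive arm and the node that would extend it. -/
theorem commute_pos_gridZ (hq : q ≠ 0) (hq4 : q ^ 2 + 1 ≠ 0) (he : IsSerreFamily q e)
    {k j : ℕ} (i : ℕ) (h : k + 1 ≠ j) (h' : k ≠ j) :
    e (k + 1 : ℕ) * gridZ q e i j = gridZ q e i j * e (k + 1 : ℕ) := by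
  rcases lt_or_gt_of_ne h with h | h
  · exact commute_gridZ_of_gt hq hq4 he i h
  · exact commute_gridZ_of_lt he i (by omega)

theorem commute_neg_gridZ (hq : q ≠ 0) (hq4 : q ^ 2 + 1 ≠ 0) (he : IsSerreFamily q e)
    {k i : ℕ} (j : ℕ) (h : k + 1 ≠ i) (h' : k ≠ i) :
    e (-(k + 1 : ℕ)) * gridZ q e i j = gridZ q e i j * e (-(k + 1 : ℕ)) := by
  rw [← gridZ_neg he]
  exact commute_pos_gridZ hq hq4 he.neg j h h'

theorem mul_gridZ_succ_left (hq : q ≠ 0) (he : IsSerreFamily q e) (i j : ℕ) :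
    e (-(i + 1 : ℕ)) * gridZ q e (i + 1) j =
      q⁻¹ • (gridZ q e (i + 1) j * e (-(i + 1 : ℕ))) := by
  rw [← gridZ_neg he]
  exact mul_gridZ_succ hq he.neg j i

/-- In row `0` everything grows from one Serre relation between `e 0` and `e 1` by attaching nodes
that commute with the other factor. Passing to the next row applies a `q`-commutator to both
factors, which `qComm_mul_qComm` allows. -/
theorem gridZ_row (hq : q ≠ 0) (hq4 : q ^ 2 + 1 ≠ 0) (he : IsSerreFamily q e) (i : ℕ) {j k : ℕ}
    (h : j < k) : gridZ q e i j * gridZ q e i k = q • (gridZ q e i k * gridZ q e i j) := by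
  induction i with
  | zero =>
    induction j with
    | zero =>
      induction k, (show 1 ≤ k from h) using Nat.le_induction with
      | base =>
        have h1 : serreElt q (e 0) (e (0 + 1 : ℕ)) = 0 := he.serre _ _ (by simp)
        have h2 : gridZ q e 0 0 * gridZ q e 0 1 - q • (gridZ q e 0 1 * gridZ q e 0 0) =
            -(q • serreElt q (e 0) (e (0 + 1 : ℕ))) := by
          simp only [gridZ, rowZ, serreElt, qComm, mul_sub, sub_mul, smul_mul_assoc, mul_smul_comm,
            mul_assoc, pow_two]
          match_scalars <;> field_simp <;> ring
        rw [← sub_eq_zero, h2, h1, smul_zero, neg_zero]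
      | succ k hk ih =>
        exact mul_qComm_eq (ih hk) (commute_pos_gridZ hq hq4 he 0 (by omega) (by omega))
    | succ j ih =>
      exact qComm_mul_eq (ih (by omega)) (commute_pos_gridZ hq hq4 he 0 (by omega) (by omega))
  | succ i ih =>
    have h1 := mul_gridZ_succ_left hq he i j
    have h2 := mul_gridZ_succ_left hq he i k
    rw [gridZ_succ_left] at h1 h2
    rw [gridZ_succ_left, gridZ_succ_left]
    exact qComm_mul_qComm hq hq4 ih h1 h2

theorem gridZ_col (hq : q ≠ 0) (hq4 : q ^ 2 + 1 ≠ 0) (he : IsSerreFamily q e) {i k : ℕ} (j : ℕ)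
    (h : i < k) : gridZ q e i j * gridZ q e k j = q • (gridZ q e k j * gridZ q e i j) := by
  simpa only [gridZ_neg he] using gridZ_row hq hq4 he.neg j h

theorem gridZ_anti (hq : q ≠ 0) (hq4 : q ^ 2 + 1 ≠ 0) (he : IsSerreFamily q e) {i j s t : ℕ}
    (h : i < s) (h' : t < j) : gridZ q e i j * gridZ q e s t = gridZ q e s t * gridZ q e i j := by
  -- The row relation extended downwards and the column relation extended to the right both involve
  -- `Z₀₀ Z₁₁` and `Z₁₁ Z₀₀`; subtracting eliminates these and leaves `(q² + 1) [Z₀₁, Z₁₀] = 0`.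
  have base : gridZ q e 0 1 * gridZ q e 1 0 = gridZ q e 1 0 * gridZ q e 0 1 := by
    have h1 := qComm_skew (a := e (-(0 + 1 : ℕ))) (gridZ_row hq hq4 he 0 (Nat.zero_lt_one))
    have h2 := qComm_skew (a := e (0 + 1 : ℕ)) (gridZ_col hq hq4 he 0 (Nat.zero_lt_one))
    simp only [← gridZ_succ_left, ← gridZ_succ_right he, zero_add] at h1 h2
    have h3 : (q ^ 2 + 1) • (gridZ q e 0 1 * gridZ q e 1 0 - gridZ q e 1 0 * gridZ q e 0 1) =
        0 := by
      linear_combination (norm := module) h2 - h1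
    rw [← sub_eq_zero]
    exact (smul_eq_zero.1 h3).resolve_left hq4
  suffices gridZ q e i j * gridZ q e s t = (1 : K) • (gridZ q e s t * gridZ q e i j) by
    simpa using this
  -- The four indices are lowered to this base one at a time; the node removed at each step commutes
  -- with the other factor because the relevant inequality stays strict.
  induction i with
  | succ i ih =>
    rw [gridZ_succ_left]
    exact qComm_mul_eq (ih (by omega)) (commute_neg_gridZ hq hq4 he t (by omega) (by omega))
  | zero =>
  induction t with
  | succ t ih =>
    rw [gridZ_succ_right he s]
    exact mul_qComm_eq (ih (by omega)) (commute_pos_gridZ hq hq4 he 0 (by omega) (by omega))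
  | zero =>
  induction s, (show 1 ≤ s from h) using Nat.le_induction with
  | succ s hs ih =>
    rw [gridZ_succ_left]
    exact mul_qComm_eq (ih hs) (commute_neg_gridZ hq hq4 he j (by omega) (by omega))
  | base =>
  induction j, (show 1 ≤ j from h') using Nat.le_induction with
  | succ j hj ih =>
    rw [gridZ_succ_right he]
    exact qComm_mul_eq (ih hj) (commute_pos_gridZ hq hq4 he 1 (by omega) (by omega))
  | base => simpa using base

/-- For consecutive rows, the `q`-commutator with the new node turns the row relation into a
relation among four products, and `gridZ_anti` merges the two anti-diagonal ones. Later rows follow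
by attaching nodes that commute with the factors in rows `i`. -/
theorem gridZ_diag (hq : q ≠ 0) (hq4 : q ^ 2 + 1 ≠ 0) (he : IsSerreFamily q e) {i j s t : ℕ}
    (h : i < s) (h' : j < t) :
    gridZ q e i j * gridZ q e s t - gridZ q e s t * gridZ q e i j =
      (q - q⁻¹) • (gridZ q e i t * gridZ q e s j) := by
  induction s, (show i + 1 ≤ s from h) using Nat.le_induction with
  | succ s hs ih =>
    rw [gridZ_succ_left, gridZ_succ_left]
    exact mul_qComm_sub_eq (ih hs) (commute_neg_gridZ hq hq4 he j (by omega) (by omega))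
      (commute_neg_gridZ hq hq4 he t (by omega) (by omega))
  | base =>
    have h1 := qComm_skew (a := e (-(i + 1 : ℕ))) (gridZ_row hq hq4 he i h')
    simp only [← gridZ_succ_left] at h1
    rw [← gridZ_anti hq hq4 he i.lt_succ_self h'] at h1
    have h2 : gridZ q e i j * gridZ q e (i + 1) t - gridZ q e (i + 1) t * gridZ q e i j -
      (q - q⁻¹) • (gridZ q e i t * gridZ q e (i + 1) j) = q⁻¹ •
        (gridZ q e i t * gridZ q e (i + 1) j + q • (gridZ q e i j * gridZ q e (i + 1) t) -
        (q • (gridZ q e (i + 1) t * gridZ q e i j) +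
          q ^ 2 • (gridZ q e i t * gridZ q e (i + 1) j))) := by
      match_scalars <;> field_simp
      ring
    rw [← sub_eq_zero, h2, h1, sub_self, smul_zero]

end Grid

end SerreRelations

/-! ### The positive part and its Verma-type module structure -/

section PositivePart

noncomputable section

/-- The quantum Serre relations between the generators of the positive part. -/
inductive PosRel (r : ℕ) (q : ℂ) : FreeAlgebra ℂ (Fin r) → FreeAlgebra ℂ (Fin r) → Prop
  | comm (i j : Fin r) (h : CartanMatrix.A r i j = 0) :
      PosRel r q (FreeAlgebra.ι ℂ i * FreeAlgebra.ι ℂ j) (FreeAlgebra.ι ℂ j * FreeAlgebra.ι ℂ i)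
  | serre (i j : Fin r) (h : CartanMatrix.A r i j = -1) :
      PosRel r q (serreElt q (FreeAlgebra.ι ℂ i) (FreeAlgebra.ι ℂ j)) 0

/-- The algebra presented by the quantum Serre relations of type `A_r`. -/
def UPos (r : ℕ) (q : ℂ) : Type := RingQuot (PosRel r q)

instance (r : ℕ) (q : ℂ) : Ring (UPos r q) := inferInstanceAs (Ring (RingQuot (PosRel r q)))

instance (r : ℕ) (q : ℂ) : Algebra ℂ (UPos r q) :=
  inferInstanceAs (Algebra ℂ (RingQuot (PosRel r q)))

theorem map_serreElt {A B : Type*} [Ring A] [Algebra ℂ A] [Ring B] [Algebra ℂ B] (f : A →ₐ[ℂ] B)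
    (q : ℂ) (a b : A) : f (serreElt q a b) = serreElt q (f a) (f b) := by
  simp [serreElt]

theorem serreElt_smul {A : Type*} [Ring A] [Algebra ℂ A] (q c d : ℂ) (a b : A) :
    serreElt q (c • a) (d • b) = (c ^ 2 * d) • serreElt q a b := by
  simp only [serreElt, pow_two, smul_mul_assoc, mul_smul_comm]
  module

variable {r : ℕ} {q : ℂ}

variable (r q) in
/-- The quotient map onto the positive part. -/
def posMk : FreeAlgebra ℂ (Fin r) →ₐ[ℂ] UPos r q := RingQuot.mkAlgHom ℂ (PosRel r q)

variable (q) in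
/-- The generators of the positive part. -/
def posE (i : Fin r) : UPos r q := posMk r q (FreeAlgebra.ι ℂ i)

theorem posE_comm {i j : Fin r} (h : CartanMatrix.A r i j = 0) :
    posE q i * posE q j = posE q j * posE q i := by
  have : posMk r q _ = posMk r q _ := RingQuot.mkAlgHom_rel ℂ (PosRel.comm (q := q) i j h)
  simpa [posE] using this

theorem posE_serre {i j : Fin r} (h : CartanMatrix.A r i j = -1) :
    serreElt q (posE q i) (posE q j) = 0 := by
  have : posMk r q _ = posMk r q _ := RingQuot.mkAlgHom_rel ℂ (PosRel.serre (q := q) i j h)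
  rwa [map_serreElt, map_zero] at this

/-- The universal property of the positive part. -/
def posLift {A : Type*} [Ring A] [Algebra ℂ A] (f : Fin r → A)
    (hc : ∀ i j, CartanMatrix.A r i j = 0 → f i * f j = f j * f i)
    (hs : ∀ i j, CartanMatrix.A r i j = -1 → serreElt q (f i) (f j) = 0) : UPos r q →ₐ[ℂ] A :=
  RingQuot.liftAlgHom (S := ℂ) (s := PosRel r q) ⟨FreeAlgebra.lift ℂ f, fun a b h => by
    cases h with
    | comm i j h => simpa using hc i j h
    | serre i j h => simpa [map_serreElt] using hs i j h⟩

@[simp]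
theorem posLift_posE {A : Type*} [Ring A] [Algebra ℂ A] (f : Fin r → A) (hc)
    (hs : ∀ i j, CartanMatrix.A r i j = -1 → serreElt q (f i) (f j) = 0) (i : Fin r) :
    posLift f hc hs (posE q i) = f i :=
  (RingQuot.liftAlgHom_mkAlgHom_apply ℂ _ _ _).trans (FreeAlgebra.lift_ι_apply f i)

theorem adjoin_range_posE : Algebra.adjoin ℂ (Set.range (posE (r := r) q)) = ⊤ := by
  have h : Set.range (posE (r := r) q) =
      posMk r q '' Set.range (FreeAlgebra.ι ℂ) := by
    rw [← Set.range_comp]; rfl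
  rw [h, ← AlgHom.map_adjoin, FreeAlgebra.adjoin_range_ι, Algebra.map_top, AlgHom.range_eq_top]
  exact RingQuot.mkAlgHom_surjective ℂ _

theorem pos_submodule_eq_top (W : Submodule ℂ (UPos r q)) (h1 : 1 ∈ W)
    (hW : ∀ i, ∀ w ∈ W, posE q i * w ∈ W) : W = ⊤ := by
  rw [eq_top_iff]
  intro b _
  have hb : b ∈ Algebra.adjoin ℂ (Set.range (posE (r := r) q)) := by
    rw [adjoin_range_posE]; trivial
  have : ∀ w ∈ W, b * w ∈ W := by
    refine Algebra.adjoin_induction (p := fun b _ => ∀ w ∈ W, b * w ∈ W) ?_ ?_ ?_ ?_ hb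
    · rintro _ ⟨i, rfl⟩
      exact hW i
    · intro c w hw
      rw [← Algebra.smul_def]
      exact W.smul_mem c hw
    · intro a b _ _ ha hb w hw
      rw [add_mul]
      exact add_mem (ha w hw) (hb w hw)
    · intro a b _ _ ha hb w hw
      rw [mul_assoc]
      exact ha _ (hb w hw)
  simpa using this 1 h1

/-- The induction principle for the positive part: identities of operators are checked on `1` and
propagated under left multiplication by generators. -/
theorem pos_linearMap_eq_zero {V : Type*} [AddCommGroup V] [Module ℂ V] (D : UPos r q →ₗ[ℂ] V)
    (h1 : D 1 = 0) (hD : ∀ i v, D v = 0 → D (posE q i * v) = 0) : D = 0 := by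
  have := pos_submodule_eq_top (LinearMap.ker D) h1 fun i w hw => hD i w hw
  exact LinearMap.ker_eq_top.1 this

/-- Rescaling of the generators. -/
def posScale (χ : Fin r → ℂ) : UPos r q →ₐ[ℂ] UPos r q :=
  posLift (fun i => χ i • posE q i)
    (fun i j h => by simp only [smul_mul_smul_comm, posE_comm h, mul_comm])
    (fun i j h => by rw [serreElt_smul, posE_serre h, smul_zero])

@[simp]
theorem posScale_posE (χ : Fin r → ℂ) (i : Fin r) :
    posScale χ (posE q i) = χ i • posE q i := by
  simp [posScale]

theorem upper_mul_upper {A : Type*} [Ring A] (a b d a' b' d' : A) :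
    !![a, b; 0, d] * !![a', b'; 0, d'] = !![a * a', a * b' + b * d'; 0, d * d'] := by
  simp

theorem serreElt_upper {A : Type*} [Ring A] [Algebra ℂ A] (q : ℂ) (a b d a' b' d' : A) :
    serreElt q !![a, b; 0, d] !![a', b'; 0, d'] =
      !![serreElt q a a', a * (a * b' + b * d') + b * (d * d') -
          (q + q⁻¹) • (a * (a' * b + b' * d) + b * (d' * d)) + (a' * (a * b + b * d) + b' * (d * d));
        0, serreElt q d d'] := by
  simp only [serreElt, pow_two, upper_mul_upper, mul_assoc]
  ext i j
  fin_cases i <;> fin_cases j <;> simp [mul_add, add_mul, mul_assoc, add_assoc]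

theorem cartan_symm (i j : Fin r) : CartanMatrix.A r i j = CartanMatrix.A r j i :=
  congrFun (congrFun (CartanMatrix.A_transpose r).symm i) j

theorem cartan_self (i : Fin r) : CartanMatrix.A r i i = 2 := by simp [CartanMatrix.A]

theorem ne_of_cartan {i j : Fin r} {a : ℤ} (h : CartanMatrix.A r i j = a) (ha : a ≠ 2) :
    i ≠ j := by
  rintro rfl
  exact ha (h.symm.trans (cartan_self i))

/-- The matrices which define the skew derivation dual to the generator `k`. -/
def skewMatrix (q u : ℂ) (k j : Fin r) : Matrix (Fin 2) (Fin 2) (UPos r q) :=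
  !![posE q j, if j = k then 1 else 0; 0, u ^ CartanMatrix.A r j k • posE q j]

theorem skewMatrix_comm {u : ℂ} (k i j : Fin r) (h : CartanMatrix.A r i j = 0) :
    skewMatrix q u k i * skewMatrix q u k j = skewMatrix q u k j * skewMatrix q u k i := by
  have hij := ne_of_cartan h (by decide)
  have h' := (cartan_symm j i).trans h
  rw [skewMatrix, skewMatrix, upper_mul_upper, upper_mul_upper, posE_comm h, smul_mul_smul_comm,
    smul_mul_smul_comm, posE_comm h, mul_comm (u ^ _)]
  congr 3
  by_cases hi : i = k
  · subst hi
    simp [hij.symm, h']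
  · by_cases hj : j = k
    · subst hj
      simp [hij, h]
    · simp [hi, hj]

/-- A homomorphism `v ↦ !![v, D v; 0, K v]` encodes the rule `D (v w) = v D w + D v K w`, so skew
derivations come from the universal property. Only `u + u⁻¹` enters the Serre relation, so both `u =
q` and `u = q⁻¹` are allowed; the action of `F` needs both. -/
theorem skewMatrix_serre {u : ℂ} (hu : u ≠ 0) (huq : q + q⁻¹ = u + u⁻¹) (k i j : Fin r)
    (h : CartanMatrix.A r i j = -1) :
    serreElt q (skewMatrix q u k i) (skewMatrix q u k j) = 0 := by
  have hij := ne_of_cartan h (by decide)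
  have h' := (cartan_symm j i).trans h
  rw [skewMatrix, skewMatrix, serreElt_upper, serreElt_smul, posE_serre h, smul_zero]
  have : ∀ x : UPos r q, x = 0 → !![0, x; 0, 0] = (0 : Matrix (Fin 2) (Fin 2) (UPos r q)) := by
    rintro _ rfl
    ext a b
    fin_cases a <;> fin_cases b <;> rfl
  apply this
  rw [huq]
  by_cases hi : i = k
  · subst hi
    simp only [hij.symm, h', cartan_self, if_true, if_false, mul_zero, zero_add, one_mul, mul_one,
      smul_mul_assoc, mul_smul_comm, zero_mul, mul_add]
    match_scalars <;> simp only [zpow_neg, zpow_ofNat] <;> field_simp <;> ring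
  · by_cases hj : j = k
    · subst hj
      simp only [hij, h, cartan_self, if_true, if_false, mul_zero, zero_add, one_mul, mul_one,
        smul_mul_assoc, mul_smul_comm, zero_mul, mul_add]
      match_scalars
      simp only [zpow_neg, zpow_ofNat]
      field_simp
      ring
    · simp [hi, hj]

/-- The algebra homomorphism which encodes a skew derivation. -/
def skewHom {u : ℂ} (hu : u ≠ 0) (huq : q + q⁻¹ = u + u⁻¹) (k : Fin r) :
    UPos r q →ₐ[ℂ] Matrix (Fin 2) (Fin 2) (UPos r q) :=
  posLift (skewMatrix q u k) (skewMatrix_comm k) (skewMatrix_serre hu huq k)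

theorem skewHom_one_one {u : ℂ} (hu : u ≠ 0) (huq : q + q⁻¹ = u + u⁻¹) (k : Fin r)
    (v : UPos r q) :
    skewHom hu huq k v 1 1 = posScale (fun j => u ^ CartanMatrix.A r j k) v := by
  have := pos_linearMap_eq_zero ((Matrix.entryLinearMap ℂ (UPos r q) (1 : Fin 2) (1 : Fin 2)).comp
    (skewHom hu huq k).toLinearMap - (posScale fun j => u ^ CartanMatrix.A r j k).toLinearMap)
    (by simp) (fun i v hv => by
      simp only [LinearMap.sub_apply, LinearMap.comp_apply, AlgHom.toLinearMap_apply,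
        Matrix.entryLinearMap_apply, map_mul, posScale_posE] at hv ⊢
      rw [sub_eq_zero] at hv
      rw [← hv, Matrix.mul_apply, Fin.sum_univ_two]
      simp [skewHom, skewMatrix])
  exact sub_eq_zero.1 (LinearMap.congr_fun this v)

/-- The skew derivation dual to the generator `k`. -/
def skewDer {u : ℂ} (hu : u ≠ 0) (huq : q + q⁻¹ = u + u⁻¹) (k : Fin r) :
    UPos r q →ₗ[ℂ] UPos r q :=
  (Matrix.entryLinearMap ℂ (UPos r q) (0 : Fin 2) (1 : Fin 2)).comp
    (skewHom hu huq k).toLinearMap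

theorem skewDer_one {u : ℂ} (hu : u ≠ 0) (huq : q + q⁻¹ = u + u⁻¹) (k : Fin r) :
    skewDer hu huq k 1 = 0 := by
  simp [skewDer]

theorem skewDer_mul {u : ℂ} (hu : u ≠ 0) (huq : q + q⁻¹ = u + u⁻¹) (k j : Fin r) (v : UPos r q) :
    skewDer hu huq k (posE q j * v) = posE q j * skewDer hu huq k v +
      if j = k then posScale (fun j => u ^ CartanMatrix.A r j k) v else 0 := by
  rw [← skewHom_one_one hu huq]
  simp only [skewDer, LinearMap.comp_apply, AlgHom.toLinearMap_apply,
    Matrix.entryLinearMap_apply, map_mul, Matrix.mul_apply, Fin.sum_univ_two]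
  split_ifs with h <;> simp [skewHom, skewMatrix, h]

end

end PositivePart

/-! ### The Verma module on the positive part -/

section VermaModule

noncomputable section

/-- Intended reading: `x = F_i`, `y = F_j`, `e = E_i`, and `t`, `t'` are the actions of `L_{±α_i}`.
The torus terms produced by moving `e` through the Serre expression cancel. -/
theorem serreElt_mul_comm_left {A : Type*} [Ring A] [Algebra ℂ A] {q c : ℂ} (hq : q ≠ 0)
    {x y e t t' : A} (hx : x * e = e * x - c • (t - t')) (hy : y * e = e * y)
    (h1 : t * x = (q⁻¹ ^ 2) • (x * t)) (h2 : t * y = q • (y * t))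
    (h3 : t' * x = (q ^ 2) • (x * t')) (h4 : t' * y = q⁻¹ • (y * t')) :
    serreElt q x y * e = e * serreElt q x y := by
  have hx' : ∀ z, x * (e * z) = e * (x * z) - c • (t * z - t' * z) := fun z => by
    rw [← mul_assoc, hx, sub_mul, smul_mul_assoc, sub_mul, mul_assoc]
  have hy' : ∀ z, y * (e * z) = e * (y * z) := fun z => by rw [← mul_assoc, hy, mul_assoc]
  have h1' : ∀ z, t * (x * z) = (q⁻¹ ^ 2) • (x * (t * z)) := fun z => by
    rw [← mul_assoc, h1, smul_mul_assoc, mul_assoc]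
  have h2' : ∀ z, t * (y * z) = q • (y * (t * z)) := fun z => by
    rw [← mul_assoc, h2, smul_mul_assoc, mul_assoc]
  have h3' : ∀ z, t' * (x * z) = (q ^ 2) • (x * (t' * z)) := fun z => by
    rw [← mul_assoc, h3, smul_mul_assoc, mul_assoc]
  have h4' : ∀ z, t' * (y * z) = q⁻¹ • (y * (t' * z)) := fun z => by
    rw [← mul_assoc, h4, smul_mul_assoc, mul_assoc]
  rw [← sub_eq_zero]
  simp only [serreElt, pow_two x, mul_assoc, hx, hx', hy, hy', h1, h1', h2, h2', h3, h3', h4, h4',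
    mul_sub, sub_mul, mul_add, add_mul, smul_mul_assoc, mul_smul_comm]
  match_scalars <;> field_simp <;> ring

/-- The companion case, in which `e` pairs with the neighbour `y` that occurs once. -/
theorem serreElt_mul_comm_right {A : Type*} [Ring A] [Algebra ℂ A] {q c : ℂ} (hq : q ≠ 0)
    {x y e t t' : A} (hy : y * e = e * y - c • (t - t')) (hx : x * e = e * x)
    (h1 : t * x = q • (x * t)) (h2 : t' * x = q⁻¹ • (x * t')) :
    serreElt q x y * e = e * serreElt q x y := by
  have hy' : ∀ z, y * (e * z) = e * (y * z) - c • (t * z - t' * z) := fun z => by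
    rw [← mul_assoc, hy, sub_mul, smul_mul_assoc, sub_mul, mul_assoc]
  have hx' : ∀ z, x * (e * z) = e * (x * z) := fun z => by rw [← mul_assoc, hx, mul_assoc]
  have h1' : ∀ z, t * (x * z) = q • (x * (t * z)) := fun z => by
    rw [← mul_assoc, h1, smul_mul_assoc, mul_assoc]
  have h2' : ∀ z, t' * (x * z) = q⁻¹ • (x * (t' * z)) := fun z => by
    rw [← mul_assoc, h2, smul_mul_assoc, mul_assoc]
  rw [← sub_eq_zero]
  simp only [serreElt, pow_two x, mul_assoc, hx, hx', hy, hy', h1, h1', h2, h2',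
    mul_sub, sub_mul, mul_add, add_mul, smul_mul_assoc, mul_smul_comm]
  match_scalars <;> field_simp <;> ring

theorem mul_comm_mul_comm {A : Type*} [Ring A] [Algebra ℂ A] {c : ℂ}
    {x y e t t' : A} (hx : x * e = e * x - c • (t - t')) (hy : y * e = e * y)
    (h1 : t * y = y * t) (h2 : t' * y = y * t') :
    (x * y - y * x) * e = e * (x * y - y * x) := by
  have hy' : ∀ z, y * (e * z) = e * (y * z) := fun z => by rw [← mul_assoc, hy, mul_assoc]
  simp only [mul_assoc, hx, hy, hy', mul_sub, sub_mul, mul_smul_comm]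
  have hx' : ∀ z, x * (e * z) = e * (x * z) - c • (t * z - t' * z) := fun z => by
    rw [← mul_assoc, hx, sub_mul, smul_mul_assoc, sub_mul, mul_assoc]
  rw [hx', h1, h2]
  module

theorem sub_mul_comm_swap {A : Type*} [Ring A] {x y e : A}
    (h : (x * y - y * x) * e = e * (x * y - y * x)) :
    (y * x - x * y) * e = e * (y * x - x * y) := by
  rw [← neg_sub, neg_mul, mul_neg, h]

variable {r : ℕ} {q : ℂ}

variable (q) in
/-- The operator of left multiplication by `e_i`. -/
def opE (i : Fin r) : Module.End ℂ (UPos r q) := LinearMap.mulLeft ℂ (posE q i)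

variable (q) in
/-- The action of `L_ζ`. -/
def opL (ζ : WeightLattice r) : Module.End ℂ (UPos r q) :=
  (posScale fun i => q ^ ζ i).toLinearMap

theorem inv_ne_and_add {q : ℂ} (hq : q ≠ 0) : q⁻¹ ≠ 0 ∧ q + q⁻¹ = q⁻¹ + q⁻¹⁻¹ :=
  ⟨inv_ne_zero hq, by rw [inv_inv, add_comm]⟩

/-- The action of `F_i`. -/
def opF (hq : q ≠ 0) (i : Fin r) : Module.End ℂ (UPos r q) :=
  -((q - q⁻¹)⁻¹ • (skewDer hq rfl i -
    skewDer (inv_ne_and_add hq).1 (inv_ne_and_add hq).2 i))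

@[simp]
theorem opE_apply (i : Fin r) (v : UPos r q) : opE q i v = posE q i * v := rfl

theorem opL_one (ζ : WeightLattice r) : opL q ζ 1 = 1 := map_one (posScale fun i => q ^ ζ i)

theorem opL_posE_mul (ζ : WeightLattice r) (i : Fin r) (v : UPos r q) :
    opL q ζ (posE q i * v) = q ^ ζ i • (posE q i * opL q ζ v) := by
  simp [opL]

theorem toWeight_simpleRoot (i j : Fin r) :
    toWeight (simpleRoot i) j = CartanMatrix.A r j i := by
  simp [toWeight, simpleRoot, Pi.single_apply]

theorem pairing_simpleRoot (i : Fin r) (ζ : WeightLattice r) : pairing (simpleRoot i) ζ = ζ i := by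
  simp [pairing, simpleRoot, Pi.single_apply]

theorem opF_one (hq : q ≠ 0) (i : Fin r) : opF hq i 1 = 0 := by
  simp [opF, skewDer_one]

/-- The two skew derivations contribute `L_{α_i}` and `L_{-α_i}`; their normalised difference gives
exactly the commutator of `E_i` and `F_i`. -/
theorem opF_posE_mul (hq : q ≠ 0) (i j : Fin r) (v : UPos r q) :
    opF hq i (posE q j * v) = posE q j * opF hq i v -
      if j = i then (q - q⁻¹)⁻¹ • (opL q (toWeight (simpleRoot i)) v -
        opL q (-toWeight (simpleRoot i)) v) else 0 := by
  simp only [opF, LinearMap.neg_apply, LinearMap.smul_apply, LinearMap.sub_apply, skewDer_mul]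
  split_ifs
  · simp only [opL, AlgHom.toLinearMap_apply, Pi.neg_apply, toWeight_simpleRoot, zpow_neg, inv_zpow,
      mul_neg, mul_smul_comm, mul_sub]
    module
  · simp [mul_sub]

theorem op_ext {S T : Module.End ℂ (UPos r q)} (h1 : S 1 = T 1)
    (h : ∀ i v, S v = T v → S (posE q i * v) = T (posE q i * v)) : S = T := by
  rw [← sub_eq_zero]
  refine pos_linearMap_eq_zero _ (by simp [h1]) fun i v hv => ?_
  rw [LinearMap.sub_apply, sub_eq_zero] at hv ⊢
  exact h i v hv

/-- The vacuum `1` generates the module under the `E_i`. Relations among the `F_i` can therefore be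
proved by showing that they kill `1` and commute with every `E_i`. -/
theorem op_eq_zero_of_comm {D : Module.End ℂ (UPos r q)} (h1 : D 1 = 0)
    (h : ∀ i, D * opE q i = opE q i * D) : D = 0 :=
  pos_linearMap_eq_zero D h1 fun i v hv => by
    have := LinearMap.congr_fun (h i) v
    simpa [hv] using this

theorem opL_zero : opL q (0 : WeightLattice r) = 1 :=
  op_ext (by simp [opL_one]) fun i v h => by simp [opL_posE_mul, h]

theorem opL_add (hq : q ≠ 0) (ζ ξ : WeightLattice r) : opL q ζ * opL q ξ = opL q (ζ + ξ) :=
  op_ext (by simp [opL_one]) fun i v h => by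
    simp only [Module.End.mul_apply] at h
    simp only [Module.End.mul_apply, opL_posE_mul, map_smul, h, Pi.add_apply, zpow_add₀ hq,
      smul_smul, mul_comm]

theorem opL_mul_opE (ζ : WeightLattice r) (i : Fin r) :
    opL q ζ * opE q i = q ^ ζ i • (opE q i * opL q ζ) := by
  ext v
  simp [opL_posE_mul]

theorem opL_mul_opF (hq : q ≠ 0) (ζ : WeightLattice r) (i : Fin r) :
    opL q ζ * opF hq i = q ^ (-ζ i) • (opF hq i * opL q ζ) := by
  refine op_ext (by simp [opL_one, opF_one]) fun j v h => ?_
  simp only [Module.End.mul_apply, LinearMap.smul_apply] at h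
  have hc : ∀ ξ, opL q ζ (opL q ξ v) = opL q ξ (opL q ζ v) := fun ξ => by
    rw [← Module.End.mul_apply, ← Module.End.mul_apply, opL_add hq, opL_add hq, add_comm]
  simp only [Module.End.mul_apply, LinearMap.smul_apply, opL_posE_mul, opF_posE_mul, map_sub,
    map_smul, h]
  split_ifs with hj
  · subst hj
    have hz : q ^ ζ j ≠ 0 := zpow_ne_zero _ hq
    simp only [map_sub, map_smul, hc, mul_smul_comm, zpow_neg]
    match_scalars <;> field_simp
  · simp only [map_zero, mul_smul_comm, smul_smul, sub_zero, mul_comm]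

theorem opF_mul_opE_self (hq : q ≠ 0) (i : Fin r) :
    opF hq i * opE q i = opE q i * opF hq i - (q - q⁻¹)⁻¹ •
      (opL q (toWeight (simpleRoot i)) - opL q (-toWeight (simpleRoot i))) := by
  ext v
  simp [opF_posE_mul]

theorem opF_mul_opE_ne (hq : q ≠ 0) {i j : Fin r} (h : j ≠ i) :
    opF hq i * opE q j = opE q j * opF hq i := by
  ext v
  simp [opF_posE_mul, h]

theorem opF_comm (hq : q ≠ 0) {i j : Fin r} (h : CartanMatrix.A r i j = 0) :
    opF hq i * opF hq j = opF hq j * opF hq i := by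
  have key : ∀ i j : Fin r, CartanMatrix.A r i j = 0 →
      (opF hq i * opF hq j - opF hq j * opF hq i) * opE q i =
        opE q i * (opF hq i * opF hq j - opF hq j * opF hq i) := fun i j h => by
    have h' := (cartan_symm j i).trans h
    refine mul_comm_mul_comm (opF_mul_opE_self hq i) (opF_mul_opE_ne hq (ne_of_cartan h (by decide)))
      ?_ ?_
    · simp [opL_mul_opF, toWeight_simpleRoot, h']
    · simp [opL_mul_opF, toWeight_simpleRoot, h']
  rw [← sub_eq_zero]
  refine op_eq_zero_of_comm (by simp [opF_one]) fun k => ?_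
  by_cases hi : k = i
  · subst hi
    exact key _ _ h
  by_cases hj : k = j
  · subst hj
    exact sub_mul_comm_swap (key _ _ ((cartan_symm _ _).trans h))
  · have h1 := opF_mul_opE_ne hq hi
    have h2 := opF_mul_opE_ne hq hj
    rw [sub_mul, mul_assoc, h2, ← mul_assoc, h1, mul_assoc _ _ (opE q k), h1, ← mul_assoc _ (opE q k),
      h2, mul_sub, mul_assoc, mul_assoc]

theorem opF_serre (hq : q ≠ 0) {i j : Fin r} (h : CartanMatrix.A r i j = -1) :
    serreElt q (opF hq i) (opF hq j) = 0 := by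
  have hij := ne_of_cartan h (by decide)
  have h' := (cartan_symm j i).trans h
  refine op_eq_zero_of_comm (by simp [serreElt, opF_one, pow_two]) fun k => ?_
  by_cases hi : k = i
  · subst hi
    refine serreElt_mul_comm_left hq (opF_mul_opE_self hq k) (opF_mul_opE_ne hq hij) ?_ ?_ ?_ ?_ <;>
      simp [opL_mul_opF, toWeight_simpleRoot, h', cartan_self, zpow_ofNat, inv_pow]
  by_cases hj : k = j
  · subst hj
    refine serreElt_mul_comm_right hq (opF_mul_opE_self hq k) (opF_mul_opE_ne hq hij.symm) ?_ ?_ <;>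
      simp [opL_mul_opF, toWeight_simpleRoot, h]
  · have h1 := opF_mul_opE_ne hq hi
    have h2 := opF_mul_opE_ne hq hj
    -- Here `E_k` commutes with both `F_i` and `F_j`, the case of a vanishing torus correction.
    refine serreElt_mul_comm_right (c := 0) (t := 0) (t' := 0) hq (by simpa using h2) h1
      (by simp) (by simp)

/-- The action of the quantized enveloping algebra on its positive part, as the Verma module with
lowest weight `0`. -/
def vermaRep (hq : q ≠ 0) : Uq r q →ₐ[ℂ] Module.End ℂ (UPos r q) :=
  RingQuot.liftAlgHom ℂ ⟨FreeAlgebra.lift ℂ fun g => match g with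
    | Gen.E i => opE q i
    | Gen.F i => opF hq i
    | Gen.L ζ => opL q ζ, fun a b h => by
    cases h with
    | L_zero => simpa using opL_zero
    | L_add ζ ξ => simpa using opL_add hq ζ ξ
    | L_E ζ i => simpa [pairing_simpleRoot] using opL_mul_opE ζ i
    | L_F ζ i => simpa [pairing_simpleRoot] using opL_mul_opF hq ζ i
    | E_F_self i => simp [opF_mul_opE_self]
    | E_F_ne i j h => simpa using (opF_mul_opE_ne hq h).symm
    | E_comm i j h =>
      ext v
      simp [← mul_assoc, posE_comm h]
    | F_comm i j h => simpa using opF_comm hq h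
    | E_serre i j h =>
      ext v
      have := congrArg (· * v) (posE_serre (q := q) h)
      simpa [serreElt, pow_two, add_mul, sub_mul, mul_assoc] using this
    | F_serre i j h => simpa [serreElt] using opF_serre hq h⟩

theorem vermaRep_E (hq : q ≠ 0) (i : Fin r) : vermaRep hq (E q i) = opE q i := by
  simp [vermaRep, E]

theorem vermaRep_L (hq : q ≠ 0) (ζ : WeightLattice r) : vermaRep hq (L q ζ) = opL q ζ := by
  simp [vermaRep, L]

end

end VermaModule

/-! ### A Feigin homomorphism to a quantum torus -/

section Feigin

noncomputable section

/-- The Cartan matrix of type `A_∞`. -/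
def cartanInf (i j : ℤ) : ℤ := if i = j then 2 else if j = i + 1 ∨ i = j + 1 then -1 else 0

section Sum

variable {A : Type*} [Ring A] [Algebra ℂ A] {q : ℂ}

theorem serreElt_eq_zero_of_mul_eq (hq : q ≠ 0) {x y : A}
    (h : x * y = q • (y * x) ∨ y * x = q • (x * y)) : serreElt q x y = 0 := by
  rcases h with h | h
  · have h' : ∀ z, x * (y * z) = q • (y * (x * z)) := fun z => by
      rw [← mul_assoc, h, smul_mul_assoc, mul_assoc]
    simp only [serreElt, pow_two, mul_assoc, h, h', smul_mul_assoc, mul_smul_comm]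
    match_scalars
    field_simp
    ring
  · have h' : ∀ z, y * (x * z) = q • (x * (y * z)) := fun z => by
      rw [← mul_assoc, h, smul_mul_assoc, mul_assoc]
    simp only [serreElt, pow_two, mul_assoc, h, h', mul_smul_comm]
    match_scalars
    field_simp
    ring

/-- Once every `a` is moved to the right of every `b`, the cross terms have coefficients that sum to
zero. -/
theorem serreElt_add (hq : q ≠ 0) {a₁ a₂ b₁ b₂ : A} (h11 : a₁ * b₁ = (q⁻¹ ^ 2) • (b₁ * a₁))
    (h12 : a₁ * b₂ = q • (b₂ * a₁)) (h21 : a₂ * b₁ = q • (b₁ * a₂)) :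
    serreElt q (a₁ + b₁) (a₂ + b₂) = serreElt q a₁ a₂ + serreElt q b₁ b₂ := by
  have h11' : ∀ z, a₁ * (b₁ * z) = (q⁻¹ ^ 2) • (b₁ * (a₁ * z)) := fun z => by
    rw [← mul_assoc, h11, smul_mul_assoc, mul_assoc]
  have h12' : ∀ z, a₁ * (b₂ * z) = q • (b₂ * (a₁ * z)) := fun z => by
    rw [← mul_assoc, h12, smul_mul_assoc, mul_assoc]
  have h21' : ∀ z, a₂ * (b₁ * z) = q • (b₁ * (a₂ * z)) := fun z => by
    rw [← mul_assoc, h21, smul_mul_assoc, mul_assoc]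
  rw [← sub_eq_zero]
  simp only [serreElt, pow_two (_ + _), pow_two a₁, pow_two b₁, mul_add, add_mul, mul_assoc, h11,
    h11', h12, h12', h21, h21', smul_mul_assoc, mul_smul_comm]
  match_scalars <;> field_simp <;> ring

theorem isSerreFamily_zero : IsSerreFamily q (0 : ℤ → A) :=
  ⟨by simp, by simp [serreElt]⟩

/-- This is the braided coproduct in elementary form, and it lets the Feigin homomorphism be built
by adding one layer of variables at a time. -/
theorem IsSerreFamily.add (hq : q ≠ 0) {a b : ℤ → A} (ha : IsSerreFamily q a)
    (hb : IsSerreFamily q b) (h : ∀ i j, a i * b j = q ^ (-cartanInf i j) • (b j * a i)) :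
    IsSerreFamily q (a + b) where
  comm i j h1 h2 h3 := by
    have h4 := h i j
    have h5 := h j i
    rw [cartanInf, if_neg (by omega), if_neg (by omega), neg_zero, zpow_zero, one_smul] at h4 h5
    simp only [Pi.add_apply, mul_add, add_mul, h4, h5, ha.comm i j h1 h2 h3, hb.comm i j h1 h2 h3]
    abel
  serre i j hij := by
    have h1 := h i i
    have h2 := h i j
    have h3 := h j i
    rw [cartanInf, if_pos rfl] at h1
    rw [cartanInf, if_neg (by omega), if_pos (by omega), neg_neg, zpow_one] at h2 h3
    rw [Pi.add_apply, Pi.add_apply, serreElt_add hq (by rw [h1, zpow_neg, inv_pow]; rfl) h2 h3,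
      ha.serre i j hij, hb.serre i j hij, add_zero]

end Sum

/-- The exponent lattice of the quantum torus. -/
abbrev TorusLattice : Type := ℤ × ℕ →₀ ℤ

/-- The order in which the variables of the quantum torus are arranged. -/
def Earlier (p r : ℤ × ℕ) : Prop := p.2 < r.2 ∨ p.2 = r.2 ∧ p.1.natAbs < r.1.natAbs

open Classical in
/-- The exponents of the commutation relations in the quantum torus. -/
def torusForm (p : ℤ × ℕ) : TorusLattice →ₗ[ℤ] ℤ :=
  Finsupp.linearCombination ℤ fun r => if Earlier p r then -cartanInf p.1 r.1 else 0

/-- The variable `p` of the quantum torus, acting on Laurent polynomials. -/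
def torusOp (q : ℂ) (p : ℤ × ℕ) : Module.End ℂ (TorusLattice →₀ ℂ) :=
  Finsupp.linearCombination ℂ fun h => Finsupp.single (h + Finsupp.single p 1) (q ^ torusForm p h)

theorem torusOp_single (q : ℂ) (p : ℤ × ℕ) (h : TorusLattice) :
    torusOp q p (Finsupp.single h 1) =
      q ^ torusForm p h • Finsupp.single (h + Finsupp.single p 1) 1 := by
  simp [torusOp]

theorem torusForm_single (p r : ℤ × ℕ) [Decidable (Earlier p r)] :
    torusForm p (Finsupp.single r 1) = if Earlier p r then -cartanInf p.1 r.1 else 0 := by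
  simp only [torusForm, Finsupp.linearCombination_single, one_smul]
  congr

variable {q : ℂ}

theorem torusOp_mul (hq : q ≠ 0) (p r : ℤ × ℕ) : torusOp q p * torusOp q r =
    q ^ (torusForm p (Finsupp.single r 1) - torusForm r (Finsupp.single p 1)) •
      (torusOp q r * torusOp q p) := by
  apply Finsupp.lhom_ext'
  intro h
  ext1
  simp only [LinearMap.comp_apply, Finsupp.lsingle_apply, Module.End.mul_apply,
    LinearMap.smul_apply, torusOp_single, map_smul, map_add, smul_smul]
  rw [add_right_comm, ← zpow_add₀ hq, ← zpow_add₀ hq, ← zpow_add₀ hq]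
  congr 2
  ring

theorem torusOp_mul_of_earlier (hq : q ≠ 0) {p r : ℤ × ℕ} (h : Earlier p r) :
    torusOp q p * torusOp q r = q ^ (-cartanInf p.1 r.1) • (torusOp q r * torusOp q p) := by
  classical
  have h' : ¬ Earlier r p := by
    unfold Earlier at *
    omega
  rw [torusOp_mul hq, torusForm_single, torusForm_single, if_pos h, if_neg h', sub_zero]

theorem cartanInf_symm (i j : ℤ) : cartanInf i j = cartanInf j i := by
  unfold cartanInf
  split_ifs <;> omega

theorem torusOp_comm (hq : q ≠ 0) {p r : ℤ × ℕ} (h : cartanInf p.1 r.1 = 0) :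
    torusOp q p * torusOp q r = torusOp q r * torusOp q p := by
  classical
  rw [torusOp_mul hq, torusForm_single, torusForm_single, cartanInf_symm r.1, h]
  simp

/-- The variables of the quantum torus which are used in the Feigin homomorphism, the others being
replaced by zero. -/
def torusVar (n : ℕ) (q : ℂ) (i : ℤ) (k : ℕ) : Module.End ℂ (TorusLattice →₀ ℂ) :=
  if i.natAbs + k < n then torusOp q (i, k) else 0

theorem torusVar_mul_of_earlier (n : ℕ) (hq : q ≠ 0) {i j : ℤ} {k l : ℕ}
    (h : Earlier (i, k) (j, l)) : torusVar n q i k * torusVar n q j l =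
      q ^ (-cartanInf i j) • (torusVar n q j l * torusVar n q i k) := by
  unfold torusVar
  split_ifs
  · exact torusOp_mul_of_earlier hq h
  all_goals simp

theorem torusVar_comm (n : ℕ) (hq : q ≠ 0) {i j : ℤ} (k l : ℕ) (h : cartanInf i j = 0) :
    torusVar n q i k * torusVar n q j l = torusVar n q j l * torusVar n q i k := by
  unfold torusVar
  split_ifs
  · exact torusOp_comm hq h
  all_goals simp

/-- Within one layer neighbouring variables `q`-commute, which already implies the Serre relation;
adjacent nodes have different absolute values, so one of them is always the earlier. -/
theorem isSerreFamily_torusVar (n : ℕ) (hq : q ≠ 0) (k : ℕ) :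
    IsSerreFamily q fun i => torusVar n q i k where
  comm i j h1 h2 h3 := torusVar_comm n hq k k (by
    rw [cartanInf, if_neg h1, if_neg (by omega)])
  serre i j h := by
    apply serreElt_eq_zero_of_mul_eq hq
    have ha : cartanInf i j = -1 := by rw [cartanInf, if_neg (by omega), if_pos h]
    have ha' : cartanInf j i = -1 := by rw [cartanInf_symm, ha]
    rcases lt_or_ge i.natAbs j.natAbs with hij | hij
    · left
      simpa [ha] using torusVar_mul_of_earlier n hq (i := i) (j := j) (Or.inr ⟨rfl, hij⟩)
    · right
      have hij' : j.natAbs < i.natAbs := by omega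
      simpa [ha'] using torusVar_mul_of_earlier n hq (i := j) (j := i) (Or.inr ⟨rfl, hij'⟩)

/-- The partial sums of the images of the generators under the Feigin homomorphism. -/
def feiginE (n : ℕ) (q : ℂ) (m : ℕ) (i : ℤ) : Module.End ℂ (TorusLattice →₀ ℂ) :=
  ∑ k ∈ Finset.range m, torusVar n q i k

theorem isSerreFamily_feiginE (n : ℕ) (hq : q ≠ 0) (m : ℕ) : IsSerreFamily q (feiginE n q m) := by
  induction m with
  | zero => exact isSerreFamily_zero
  | succ m ih =>
    have : feiginE n q (m + 1) = feiginE n q m + fun i => torusVar n q i m := by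
      ext1 i
      simp only [feiginE, Finset.sum_range_succ, Pi.add_apply]
    rw [this]
    refine ih.add hq (isSerreFamily_torusVar n hq m) fun i j => ?_
    simp only [feiginE, Finset.sum_mul, Finset.mul_sum, Finset.smul_sum]
    exact Finset.sum_congr rfl fun k hk =>
      torusVar_mul_of_earlier n hq (Or.inl (Finset.mem_range.1 hk))

theorem feiginE_eq_zero (n : ℕ) (m : ℕ) {i : ℤ} (h : n ≤ i.natAbs) : feiginE n q m i = 0 :=
  Finset.sum_eq_zero fun _ _ => if_neg (by omega)

end

end Feigin

/-! ### Leading terms in the quantum torus -/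

section LeadingTerms

noncomputable section

/-- Variables, numbered by the nodes of the diagram of type `A_∞` and by natural numbers, with the
commutation relations of the quantum torus. -/
structure IsTorusFamily {A : Type*} [Ring A] [Algebra ℂ A] (q : ℂ) (y : ℤ → ℕ → A) : Prop where
  mul_of_earlier : ∀ {i j : ℤ} {k l : ℕ}, Earlier (i, k) (j, l) →
    y i k * y j l = q ^ (-cartanInf i j) • (y j l * y i k)
  comm : ∀ {i j : ℤ} (k l : ℕ), cartanInf i j = 0 → y i k * y j l = y j l * y i k

theorem isTorusFamily_torusVar (n : ℕ) {q : ℂ} (hq : q ≠ 0) : IsTorusFamily q (torusVar n q) :=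
  ⟨torusVar_mul_of_earlier n hq, torusVar_comm n hq⟩

/-- The product of the variables along a row chain. -/
def rowY {A : Type*} [Ring A] (y : ℤ → ℕ → A) (b : ℕ → ℕ) : ℕ → A
  | 0 => y 0 (b 0)
  | j + 1 => y (j + 1 : ℕ) (b (j + 1)) * rowY y b j

/-- The product of the variables along a hook-shaped chain. -/
def gridY {A : Type*} [Ring A] (y : ℤ → ℕ → A) (a b : ℕ → ℕ) (j : ℕ) : ℕ → A
  | 0 => rowY y b j
  | i + 1 => y (-(i + 1 : ℕ)) (a (i + 1)) * gridY y a b j i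

/-- The exponent of a row chain. -/
def rowM (b : ℕ → ℕ) : ℕ → TorusLattice
  | 0 => Finsupp.single (0, b 0) 1
  | j + 1 => rowM b j + Finsupp.single (((j + 1 : ℕ) : ℤ), b (j + 1)) 1

/-- The exponent of a hook-shaped chain. -/
def gridM (a b : ℕ → ℕ) (j : ℕ) : ℕ → TorusLattice
  | 0 => rowM b j
  | i + 1 => gridM a b j i + Finsupp.single (-((i + 1 : ℕ) : ℤ), a (i + 1)) 1

variable {A : Type*} [Ring A] {n : ℕ} {q : ℂ} {y : ℤ → ℕ → A}

variable (n y) in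
/-- The sum of the variables at a node. -/
def columnSum (i : ℤ) : A := ∑ k ∈ Finset.range n, y i k

theorem rowY_congr {b b' : ℕ → ℕ} {j : ℕ} (h : ∀ t ≤ j, b t = b' t) :
    rowY y b j = rowY y b' j := by
  induction j with
  | zero => rw [rowY, rowY, h 0 le_rfl]
  | succ j ih => rw [rowY, rowY, h _ le_rfl, ih fun t ht => h t (by omega)]

theorem gridY_congr {a a' b : ℕ → ℕ} {i j : ℕ} (h : ∀ t ≤ i, a t = a' t) :
    gridY y a b j i = gridY y a' b j i := by
  induction i with
  | zero => rfl
  | succ i ih => rw [gridY, gridY, h _ le_rfl, ih fun t ht => h t (by omega)]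

variable [Algebra ℂ A]

theorem cartanInf_eq_zero {i j : ℤ} (h1 : i ≠ j) (h2 : j ≠ i + 1) (h3 : i ≠ j + 1) :
    cartanInf i j = 0 := by
  rw [cartanInf, if_neg h1, if_neg (by omega)]

theorem cartanInf_adj {i j : ℤ} (h : j = i + 1 ∨ i = j + 1) : cartanInf i j = -1 := by
  rw [cartanInf, if_neg (by omega), if_pos h]

theorem torusVar_comm_rowY (hy : IsTorusFamily q y) {i : ℤ} {j : ℕ} (l : ℕ) (b : ℕ → ℕ)
    (h : i < -1 ∨ (j : ℤ) + 1 < i) :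
    y i l * rowY y b j = rowY y b j * y i l := by
  induction j with
  | zero =>
    exact hy.comm _ _ (cartanInf_eq_zero (by omega) (by omega) (by omega))
  | succ j ih =>
    rw [rowY, ← mul_assoc, hy.comm l (b (j + 1)) (cartanInf_eq_zero (by push_cast; omega)
      (by push_cast; omega) (by push_cast at *; omega)), mul_assoc, ih (by push_cast at *; omega),
      mul_assoc]

theorem qComm_mul_of_comm {x y z : A} (h : x * z = z * x) :
    qComm q x (y * z) = qComm q x y * z ∧ qComm q x (z * y) = z * qComm q x y := by
  simp only [qComm, sub_mul, mul_sub, mul_assoc, h, smul_mul_assoc, mul_smul_comm, true_and]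
  rw [← mul_assoc, h, mul_assoc]

/-- The ordering of the variables is chosen for this dichotomy: attaching the outer node `i` to the
inner node `j` gives zero when the layer decreases, and a multiple of the product otherwise. -/
theorem qComm_torusVar (hy : IsTorusFamily q y) {i j : ℤ} (h : j = i + 1 ∨ i = j + 1)
    (hij : j.natAbs < i.natAbs) (l k : ℕ) : qComm q (y i l) (y j k) =
      if l < k then 0 else (1 - q ^ 2) • (y i l * y j k) := by
  have ha := cartanInf_adj h
  rw [qComm]
  split_ifs with hlk
  · have := hy.mul_of_earlier (i := i) (j := j) (Or.inl hlk)
    rw [ha, neg_neg, zpow_one] at this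
    rw [this, sub_self]
  · have := hy.mul_of_earlier (i := j) (j := i) (k := k) (l := l)
      (by unfold Earlier; simp only; omega)
    rw [cartanInf_symm, ha, neg_neg, zpow_one] at this
    rw [this]
    module

theorem qComm_torusVar_rowY (hy : IsTorusFamily q y) (b : ℕ → ℕ) (j l : ℕ) :
    qComm q (y (j + 1 : ℕ) l) (rowY y b j) =
      if l < b j then 0 else (1 - q ^ 2) • (y (j + 1 : ℕ) l * rowY y b j) := by
  cases j with
  | zero => exact qComm_torusVar hy (by simp) (by simp) l (b 0)
  | succ j =>
    rw [rowY, (qComm_mul_of_comm (torusVar_comm_rowY hy l b (by push_cast; omega))).1,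
      qComm_torusVar hy (by push_cast; omega) (by omega)]
    split_ifs
    · rw [zero_mul]
    · rw [smul_mul_assoc, mul_assoc]

theorem qComm_neg_torusVar_rowY (hy : IsTorusFamily q y) (b : ℕ → ℕ) (j l : ℕ) :
    qComm q (y (-(0 + 1 : ℕ)) l) (rowY y b j) =
      if l < b 0 then 0 else (1 - q ^ 2) • (y (-(0 + 1 : ℕ)) l * rowY y b j) := by
  induction j with
  | zero => exact qComm_torusVar hy (by simp) (by simp) l (b 0)
  | succ j ih =>
    have hc : y (-(0 + 1 : ℕ)) l * y (j + 1 : ℕ) (b (j + 1)) =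
        y (j + 1 : ℕ) (b (j + 1)) * y (-(0 + 1 : ℕ)) l :=
      hy.comm _ _ (cartanInf_eq_zero (by push_cast; omega) (by push_cast; omega)
        (by push_cast; omega))
    rw [rowY, (qComm_mul_of_comm hc).2, ih]
    split_ifs
    · rw [mul_zero]
    · rw [mul_smul_comm, ← mul_assoc, ← mul_assoc, hc]

theorem torusVar_comm_gridY (hy : IsTorusFamily q y) {i k : ℕ} (j l : ℕ) (a b : ℕ → ℕ) (h : i + 1 < k) :
    y (-k) l * gridY y a b j i = gridY y a b j i * y (-k) l := by
  induction i with
  | zero => exact torusVar_comm_rowY hy l b (by omega)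
  | succ i ih =>
    rw [gridY, ← mul_assoc, hy.comm l (a (i + 1)) (cartanInf_eq_zero (by push_cast; omega)
      (by push_cast; omega) (by push_cast; omega)), mul_assoc, ih (by omega), mul_assoc]

/-- Only the current end of the negative arm is adjacent to the new node, so the dichotomy is
decided by that entry. At `i = 0` the end is the corner, shared by both arms. -/
theorem qComm_torusVar_gridY (hy : IsTorusFamily q y) {a b : ℕ → ℕ} (hab : a 0 = b 0) (i j l : ℕ) :
    qComm q (y (-(i + 1 : ℕ)) l) (gridY y a b j i) =
      if l < a i then 0
      else (1 - q ^ 2) • (y (-(i + 1 : ℕ)) l * gridY y a b j i) := by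
  cases i with
  | zero => rw [hab]; exact qComm_neg_torusVar_rowY hy b j l
  | succ i =>
    rw [gridY, (qComm_mul_of_comm (torusVar_comm_gridY hy j l a b (by omega))).1,
      qComm_torusVar hy (by push_cast; omega) (by omega)]
    split_ifs
    · rw [zero_mul]
    · rw [smul_mul_assoc, mul_assoc]

variable (y) in
/-- The span of the non-constant hook-shaped chains. -/
def chainSpan (i j : ℕ) : Submodule ℂ A :=
  Submodule.span ℂ {T | ∃ a b : ℕ → ℕ, Monotone a ∧ Monotone b ∧ a 0 = b 0 ∧
    (a 0 < a i ∨ b 0 < b j) ∧ T = gridY y a b j i}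

/-- A chain reads only finitely many entries; taking the value `l` everywhere beyond `i` keeps the
sequence monotone on all of `ℕ`. -/
theorem exists_extend {a : ℕ → ℕ} (ha : Monotone a) {i l : ℕ} (hl : a i ≤ l) :
    ∃ a' : ℕ → ℕ, Monotone a' ∧ (∀ t ≤ i, a' t = a t) ∧ a' (i + 1) = l := by
  refine ⟨fun t => if t ≤ i then a t else l, fun s t hst => ?_, fun t ht => if_pos ht,
    if_neg (by omega)⟩
  dsimp only
  split_ifs with h1 h2 h2
  · exact ha hst
  · exact (ha h1).trans hl
  · omega
  · exact le_rfl

theorem torusVar_mul_gridY_mem (i j l : ℕ) {a b : ℕ → ℕ} (ha : Monotone a)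
    (hb : Monotone b) (hab : a 0 = b 0) (hl : a i ≤ l) (hne : a 0 < l ∨ b 0 < b j) :
    y (-(i + 1 : ℕ)) l * gridY y a b j i ∈ chainSpan y (i + 1) j := by
  obtain ⟨a', ha', h1, h2⟩ := exists_extend ha hl
  refine Submodule.subset_span ⟨a', b, ha', hb, by rw [h1 0 (by omega), hab], ?_, ?_⟩
  · rwa [h2, h1 0 (by omega)]
  · rw [gridY, h2, gridY_congr h1]

theorem torusVar_mul_rowY_mem (j l : ℕ) {b : ℕ → ℕ} (hb : Monotone b) (hl : b j ≤ l)
    (hne : b 0 < l) : y (j + 1 : ℕ) l * rowY y b j ∈ chainSpan y 0 (j + 1) := by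
  obtain ⟨b', hb', h1, h2⟩ := exists_extend hb hl
  refine Submodule.subset_span ⟨fun _ => b' 0, b', monotone_const, hb', rfl, Or.inr ?_, ?_⟩
  · rwa [h2, h1 0 (by omega)]
  · rw [gridY, rowY, h2, rowY_congr h1]

theorem qComm_sum_left {A ι : Type*} [Ring A] [Algebra ℂ A] (s : Finset ι) (f : ι → A) (x : A) :
    qComm q (∑ i ∈ s, f i) x = ∑ i ∈ s, qComm q (f i) x := by
  simp only [qComm, Finset.sum_mul, Finset.mul_sum, Finset.smul_sum, Finset.sum_sub_distrib]

/-- `qComm` as a linear map in its second argument. -/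
def qCommHom (q : ℂ) (a : A) : A →ₗ[ℂ] A :=
  LinearMap.mulLeft ℂ a - q • LinearMap.mulRight ℂ a

theorem qCommHom_apply (q : ℂ) (a x : A) :
    qCommHom q a x = qComm q a x := by
  simp [qCommHom, qComm]

theorem qComm_mem_of_span {s : Set A} {W : Submodule ℂ A}
    {a : A} (h : ∀ x ∈ s, qComm q a x ∈ W) {x : A} (hx : x ∈ Submodule.span ℂ s) :
    qComm q a x ∈ W := by
  rw [← qCommHom_apply]
  refine (Submodule.span_le (p := W.comap (qCommHom q a))).2 (fun y hy => ?_) hx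
  simpa [qCommHom_apply] using h y hy

variable (n y) in
/-- The sum of the constant chains. -/
def constSum (i j : ℕ) : A :=
  ∑ c ∈ Finset.range n, gridY y (fun _ => c) (fun _ => c) j i

/-- Terms with `l < c` vanish, those with `l = c` prolong the constant chains, and those with `l >
c` produce non-constant ones. -/
theorem sum_qComm_const_mem {W : Submodule ℂ A}
    (f g : ℕ → A) (hfg : ∀ l c, qComm q (f l) (g c) =
      if l < c then 0 else (1 - q ^ 2) • (f l * g c))
    (hW : ∀ l c, c < l → f l * g c ∈ W) :
    qComm q (∑ l ∈ Finset.range n, f l) (∑ c ∈ Finset.range n, g c) -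
      (1 - q ^ 2) • ∑ c ∈ Finset.range n, f c * g c ∈ W := by
  rw [← qCommHom_apply, map_sum, Finset.smul_sum, ← Finset.sum_sub_distrib]
  refine W.sum_mem fun c hc => ?_
  rw [qCommHom_apply, qComm_sum_left, ← Finset.add_sum_erase _ _ hc, hfg, if_neg (lt_irrefl c),
    add_sub_cancel_left]
  refine W.sum_mem fun l hl => ?_
  rw [hfg]
  split_ifs with h
  · exact W.zero_mem
  · exact W.smul_mem _ (hW l c (lt_of_le_of_ne (not_lt.1 h) (Finset.ne_of_mem_erase hl).symm))

theorem qComm_sub_smul_mem {W : Submodule ℂ A} {e g s s' : A}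
    {c k : ℂ} (h1 : qComm q e (g - c • s) ∈ W) (h2 : qComm q e s - k • s' ∈ W) :
    qComm q e g - (c * k) • s' ∈ W := by
  have h3 := add_mem h1 (W.smul_mem c h2)
  rw [← qCommHom_apply, map_sub, map_smul, qCommHom_apply, qCommHom_apply] at h3
  convert h3 using 1
  module

theorem qComm_mem_of_chainSpan {i j : ℕ} {x T : A}
    {W : Submodule ℂ A}
    (h : ∀ a b : ℕ → ℕ, Monotone a → Monotone b → a 0 = b 0 → (a 0 < a i ∨ b 0 < b j) →
      qComm q x (gridY y a b j i) ∈ W) (hT : T ∈ chainSpan y i j) : qComm q x T ∈ W := by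
  rw [chainSpan] at hT
  refine qComm_mem_of_span ?_ hT
  rintro _ ⟨a, b, ha, hb, hab, hne, rfl⟩
  exact h a b ha hb hab hne

/-- Each attached node multiplies every constant chain by `1 - q ^ 2`. Non-constant weakly
increasing chains stay non-constant, so their coefficients need not be tracked. -/
theorem gridZ_sub_mem (hy : IsTorusFamily q y) (i j : ℕ) :
    gridZ q (columnSum n y) i j - (1 - q ^ 2) ^ (i + j) • constSum n y i j ∈
      chainSpan y i j := by
  induction i with
  | zero =>
    induction j with
    | zero =>
      rw [add_zero, pow_zero, one_smul, gridZ, rowZ, constSum]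
      simp only [columnSum, gridY, rowY, sub_self]
      exact Submodule.zero_mem _
    | succ j ih =>
      have h1 : qComm q (columnSum n y (j + 1 : ℕ)) (gridZ q (columnSum n y) 0 j -
          (1 - q ^ 2) ^ (0 + j) • constSum n y 0 j) ∈ chainSpan y 0 (j + 1) := by
        refine qComm_mem_of_chainSpan (fun a b ha hb hab hne => ?_) ih
        rw [columnSum, qComm_sum_left]
        refine Submodule.sum_mem _ fun l _ => ?_
        rw [gridY, qComm_torusVar_rowY hy]
        split_ifs with hl
        · exact Submodule.zero_mem _
        · exact Submodule.smul_mem _ _ (torusVar_mul_rowY_mem j l hb (by omega) (by omega))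
      have h2 := sum_qComm_const_mem (n := n) (q := q) (W := chainSpan y 0 (j + 1))
        (fun l => y (j + 1 : ℕ) l) (fun c => rowY y (fun _ => c) j)
        (fun l c => qComm_torusVar_rowY hy _ j l)
        (fun l c hcl => torusVar_mul_rowY_mem j l monotone_const hcl.le hcl)
      rw [← add_assoc, pow_succ]
      exact qComm_sub_smul_mem h1 h2
  | succ i ih =>
    have h1 : qComm q (columnSum n y (-(i + 1 : ℕ))) (gridZ q (columnSum n y) i j -
        (1 - q ^ 2) ^ (i + j) • constSum n y i j) ∈ chainSpan y (i + 1) j := by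
      refine qComm_mem_of_chainSpan (fun a b ha hb hab hne => ?_) ih
      rw [columnSum, qComm_sum_left]
      refine Submodule.sum_mem _ fun l _ => ?_
      rw [qComm_torusVar_gridY hy hab]
      split_ifs with hl
      · exact Submodule.zero_mem _
      · exact Submodule.smul_mem _ _
          (torusVar_mul_gridY_mem i j l ha hb hab (by omega) (by omega))
    have h2 := sum_qComm_const_mem (n := n) (q := q) (W := chainSpan y (i + 1) j)
      (fun l => y (-(i + 1 : ℕ)) l) (fun c => gridY y (fun _ => c) (fun _ => c) j i)
      (fun l c => qComm_torusVar_gridY hy rfl i j l)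
      (fun l c hcl => torusVar_mul_gridY_mem i j l monotone_const monotone_const rfl hcl.le
        (Or.inl hcl))
    rw [add_right_comm, pow_succ]
    exact qComm_sub_smul_mem h1 h2

end

end LeadingTerms

/-! ### Weights and leading terms of operators -/

section Weights

noncomputable section

/-- The weight by which monomials of the quantum torus are compared. -/
def torusWeight (n : ℕ) : TorusLattice →ₗ[ℤ] ℤ :=
  Finsupp.linearCombination ℤ fun p => if p.1 = 0 then 2 * n * (p.2 : ℤ) else -(p.2 : ℤ)

theorem torusWeight_single (n : ℕ) (p : ℤ × ℕ) :
    torusWeight n (Finsupp.single p 1) = if p.1 = 0 then 2 * n * (p.2 : ℤ) else -(p.2 : ℤ) := by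
  simp [torusWeight]

theorem torusWeight_rowM_le (n : ℕ) {b : ℕ → ℕ} (hb : Monotone b) (j : ℕ) :
    torusWeight n (rowM b j) ≤ (2 * n - j) * b 0 - (b j - b 0) := by
  induction j with
  | zero => simp [rowM, torusWeight_single]
  | succ j ih =>
    have h0 : (b 0 : ℤ) ≤ b j := by exact_mod_cast hb (Nat.zero_le j)
    rw [rowM, map_add, torusWeight_single, if_neg (by simp only; omega)]
    push_cast
    linarith

/-- The corner counts `2 n` times its layer and every other node counts minus its layer. Each entry
is at least the corner value, and the excess at the two ends is kept to give strictness for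
non-constant chains. -/
theorem torusWeight_gridM_le (n : ℕ) {a b : ℕ → ℕ} (ha : Monotone a) (hb : Monotone b)
    (hab : a 0 = b 0) (i j : ℕ) : torusWeight n (gridM a b j i) ≤
      (2 * n - i - j) * a 0 - (a i - a 0) - (b j - b 0) := by
  induction i with
  | zero =>
    have := torusWeight_rowM_le n hb j
    simp only [gridM, hab] at *
    push_cast
    linarith
  | succ i ih =>
    have h0 : (a 0 : ℤ) ≤ a i := by exact_mod_cast ha (Nat.zero_le i)
    rw [gridM, map_add, torusWeight_single, if_neg (by simp only; omega)]
    push_cast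
    linarith

theorem torusWeight_gridM_const (n c i j : ℕ) :
    torusWeight n (gridM (fun _ => c) (fun _ => c) j i) = (2 * n - i - j) * c := by
  induction i with
  | zero =>
    induction j with
    | zero => simp [gridM, rowM, torusWeight_single]
    | succ j ih =>
      rw [gridM] at *
      rw [rowM, map_add, ih, torusWeight_single, if_neg (by simp only; omega)]
      push_cast
      ring
  | succ i ih =>
    rw [gridM, map_add, ih, torusWeight_single, if_neg (by simp only; omega)]
    push_cast
    ring

/-- The span of the monomials of weight less than `d`. -/
def weightLT (n : ℕ) (d : ℤ) : Submodule ℂ (TorusLattice →₀ ℂ) :=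
  Finsupp.supported ℂ ℂ {h | torusWeight n h < d}

theorem single_mem_weightLT {n : ℕ} {d : ℤ} {h : TorusLattice} (hd : torusWeight n h < d) :
    Finsupp.single h 1 ∈ weightLT n d := Finsupp.single_mem_supported ℂ _ hd

theorem weightLT_mono (n : ℕ) {d d' : ℤ} (h : d ≤ d') : weightLT n d ≤ weightLT n d' :=
  Finsupp.supported_mono fun _ hx => lt_of_lt_of_le hx h

theorem map_mem_of_weightLT {n : ℕ} {d : ℤ} {T : Module.End ℂ (TorusLattice →₀ ℂ)}
    {W : Submodule ℂ (TorusLattice →₀ ℂ)}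
    (h : ∀ m, torusWeight n m < d → T (Finsupp.single m 1) ∈ W) {v : TorusLattice →₀ ℂ}
    (hv : v ∈ weightLT n d) : T v ∈ W := by
  rw [weightLT, Finsupp.supported_eq_span_single] at hv
  refine (Submodule.span_le (p := W.comap T)).2 ?_ hv
  rintro _ ⟨m, hm, rfl⟩
  exact h m hm

/-- `T` multiplies monomials by terms of weight less than `d`. -/
def IsLower (n : ℕ) (d : ℤ) (T : Module.End ℂ (TorusLattice →₀ ℂ)) : Prop :=
  ∀ h, T (Finsupp.single h 1) ∈ weightLT n (torusWeight n h + d)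

/-- `T` multiplies monomials by `m` up to non-zero scalars and terms of lower weight. -/
def HasLeading (n : ℕ) (m : TorusLattice) (T : Module.End ℂ (TorusLattice →₀ ℂ)) : Prop :=
  ∀ h, ∃ s : ℂ, s ≠ 0 ∧ T (Finsupp.single h 1) - s • Finsupp.single (h + m) 1 ∈
    weightLT n (torusWeight n h + torusWeight n m)

theorem isLower_zero (n : ℕ) (d : ℤ) : IsLower n d 0 := fun _ => Submodule.zero_mem _

theorem IsLower.add {n : ℕ} {d : ℤ} {S T : Module.End ℂ (TorusLattice →₀ ℂ)}
    (hS : IsLower n d S) (hT : IsLower n d T) : IsLower n d (S + T) := fun h =>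
  Submodule.add_mem _ (hS h) (hT h)

theorem IsLower.smul {n : ℕ} {d : ℤ} {T : Module.End ℂ (TorusLattice →₀ ℂ)} (c : ℂ)
    (hT : IsLower n d T) : IsLower n d (c • T) := fun h => Submodule.smul_mem _ c (hT h)

theorem HasLeading.add_isLower {n : ℕ} {m : TorusLattice} {S T : Module.End ℂ (TorusLattice →₀ ℂ)}
    (hS : HasLeading n m S) (hT : IsLower n (torusWeight n m) T) : HasLeading n m (S + T) := by
  intro h
  obtain ⟨s, hs, h1⟩ := hS h
  refine ⟨s, hs, ?_⟩
  rw [LinearMap.add_apply, add_sub_right_comm]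
  exact Submodule.add_mem _ h1 (hT h)

theorem HasLeading.smul {n : ℕ} {m : TorusLattice} {T : Module.End ℂ (TorusLattice →₀ ℂ)} {c : ℂ}
    (hc : c ≠ 0) (hT : HasLeading n m T) : HasLeading n m (c • T) := by
  intro h
  obtain ⟨s, hs, h1⟩ := hT h
  refine ⟨c * s, mul_ne_zero hc hs, ?_⟩
  rw [LinearMap.smul_apply, mul_smul, ← smul_sub]
  exact Submodule.smul_mem _ _ h1

theorem hasLeading_one (n : ℕ) : HasLeading n 0 1 := fun h =>
  ⟨1, one_ne_zero, by simp⟩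

theorem HasLeading.mem {n : ℕ} {m : TorusLattice} {T : Module.End ℂ (TorusLattice →₀ ℂ)}
    (hT : HasLeading n m T) {d : ℤ} {v : TorusLattice →₀ ℂ} (hv : v ∈ weightLT n d) :
    T v ∈ weightLT n (d + torusWeight n m) := by
  refine map_mem_of_weightLT (fun h hh => ?_) hv
  obtain ⟨s, -, h1⟩ := hT h
  rw [← sub_add_cancel (T (Finsupp.single h 1)) (s • Finsupp.single (h + m) 1)]
  refine Submodule.add_mem _ (weightLT_mono n (by linarith) h1) (Submodule.smul_mem _ _
    (single_mem_weightLT ?_))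
  rw [map_add]
  linarith

theorem HasLeading.mul {n : ℕ} {m m' : TorusLattice} {S T : Module.End ℂ (TorusLattice →₀ ℂ)}
    (hS : HasLeading n m S) (hT : HasLeading n m' T) : HasLeading n (m + m') (S * T) := by
  intro h
  obtain ⟨t, ht, h1⟩ := hT h
  obtain ⟨s, hs, h2⟩ := hS (h + m')
  refine ⟨t * s, mul_ne_zero ht hs, ?_⟩
  have h3 : (S * T) (Finsupp.single h 1) - (t * s) • Finsupp.single (h + (m + m')) 1 =
      S (T (Finsupp.single h 1) - t • Finsupp.single (h + m') 1) +
      t • (S (Finsupp.single (h + m') 1) - s • Finsupp.single (h + m' + m) 1) := by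
    rw [map_sub, map_smul, smul_sub, mul_smul, Module.End.mul_apply, add_comm m m', add_assoc]
    abel
  rw [h3]
  refine Submodule.add_mem _ (weightLT_mono n ?_ (hS.mem h1)) (Submodule.smul_mem _ _
    (weightLT_mono n ?_ h2)) <;> simp only [map_add] <;> linarith

theorem HasLeading.pow {n : ℕ} {m : TorusLattice} {T : Module.End ℂ (TorusLattice →₀ ℂ)}
    (hT : HasLeading n m T) (k : ℕ) : HasLeading n (k • m) (T ^ k) := by
  induction k with
  | zero => simpa using hasLeading_one n
  | succ k ih =>
    rw [pow_succ, succ_nsmul]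
    exact ih.mul hT

theorem hasLeading_ordMon {n k : ℕ} {x : ℕ → Module.End ℂ (TorusLattice →₀ ℂ)}
    {m : ℕ → TorusLattice} (h : ∀ l < k, HasLeading n (m l) (x l)) (a : Fin k → ℕ) :
    HasLeading n (∑ l, a l • m l) (ordMon x k a) := by
  induction k with
  | zero => simpa [ordMon] using hasLeading_one n
  | succ k ih =>
    rw [Fin.sum_univ_castSucc, ordMon]
    exact (ih (fun l hl => h l (by omega)) (Fin.init a)).mul ((h k k.lt_succ_self).pow _)

/-- In a vanishing combination choose an index of maximal weight. At its leading exponent no other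
term contributes: lower terms have too small a weight, and the other leading exponents are
different. -/
theorem linearIndependent_of_hasLeading {ι : Type*} {n : ℕ} {m : ι → TorusLattice}
    (hm : Function.Injective m) {T : ι → Module.End ℂ (TorusLattice →₀ ℂ)}
    (hT : ∀ i, HasLeading n (m i) (T i)) (h₀ : TorusLattice) :
    LinearIndependent ℂ fun i => T i (Finsupp.single h₀ 1) := by
  rw [linearIndependent_iff]
  intro c hc
  by_contra hne
  obtain ⟨i₀, hi₀, hmax⟩ := c.support.exists_max_image (fun i => torusWeight n (m i))
    (Finsupp.support_nonempty_iff.2 hne)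
  have h1 := DFunLike.congr_fun hc (h₀ + m i₀)
  rw [Finsupp.linearCombination_apply, Finsupp.sum, Finsupp.finsetSum_apply,
    Finset.sum_eq_single_of_mem i₀ hi₀] at h1
  · obtain ⟨s, hs, h2⟩ := hT i₀ h₀
    have h3 := (Finsupp.mem_supported' ℂ _).1 h2 (h₀ + m i₀) (by simp)
    rw [Finsupp.sub_apply, Finsupp.smul_apply, Finsupp.single_eq_same, sub_eq_zero] at h3
    rw [Finsupp.smul_apply, h3, Finsupp.zero_apply] at h1
    simp only [smul_eq_mul, mul_one, mul_eq_zero] at h1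
    exact h1.elim (Finsupp.mem_support_iff.1 hi₀) hs
  · intro i hi hne
    obtain ⟨s, -, h2⟩ := hT i h₀
    have h3 := (Finsupp.mem_supported' ℂ _).1 h2 (h₀ + m i₀) (by
      have := hmax i hi
      simp only [Set.mem_ofPred_eq, map_add]
      linarith)
    rw [Finsupp.sub_apply, Finsupp.smul_apply, Finsupp.single_eq_of_ne
      (by simpa using hm.ne hne.symm), smul_zero, sub_zero] at h3
    rw [Finsupp.smul_apply, h3, smul_zero]

end

end Weights

/-! ### Leading terms of the grid elements -/

section GridLeading

noncomputable section

variable {n : ℕ} {q : ℂ}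

/-- `T` multiplies monomials by `m` up to scalars. -/
def IsMonomialOp (m : TorusLattice) (T : Module.End ℂ (TorusLattice →₀ ℂ)) : Prop :=
  ∀ h, ∃ s : ℂ, T (Finsupp.single h 1) = s • Finsupp.single (h + m) 1

theorem IsMonomialOp.mul {m m' : TorusLattice} {S T : Module.End ℂ (TorusLattice →₀ ℂ)}
    (hS : IsMonomialOp m S) (hT : IsMonomialOp m' T) : IsMonomialOp (m' + m) (S * T) := by
  intro h
  obtain ⟨t, ht⟩ := hT h
  obtain ⟨s, hs⟩ := hS (h + m')
  exact ⟨t * s, by rw [Module.End.mul_apply, ht, map_smul, hs, smul_smul, add_assoc]⟩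

theorem isMonomialOp_torusVar (i : ℤ) (k : ℕ) :
    IsMonomialOp (Finsupp.single (i, k) 1) (torusVar n q i k) := by
  intro h
  unfold torusVar
  split_ifs
  · exact ⟨_, torusOp_single q _ h⟩
  · exact ⟨0, by simp⟩

theorem isMonomialOp_gridY (a b : ℕ → ℕ) (i j : ℕ) :
    IsMonomialOp (gridM a b j i) (gridY (torusVar n q) a b j i) := by
  induction i with
  | zero =>
    induction j with
    | zero => exact isMonomialOp_torusVar _ _
    | succ j ih => exact (isMonomialOp_torusVar _ _).mul ih
  | succ i ih => exact (isMonomialOp_torusVar _ _).mul ih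

theorem IsMonomialOp.isLower {m : TorusLattice} {T : Module.End ℂ (TorusLattice →₀ ℂ)}
    (hT : IsMonomialOp m T) {d : ℤ} (hd : torusWeight n m < d) : IsLower n d T := by
  intro h
  obtain ⟨s, hs⟩ := hT h
  rw [hs]
  refine Submodule.smul_mem _ _ (single_mem_weightLT ?_)
  rw [map_add]
  linarith

theorem hasLeading_torusVar (hq : q ≠ 0) {i : ℤ} {k : ℕ} (h : i.natAbs + k < n) :
    HasLeading n (Finsupp.single (i, k) 1) (torusVar n q i k) := by
  intro m
  rw [torusVar, if_pos h, torusOp_single]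
  exact ⟨_, zpow_ne_zero _ hq, by rw [sub_self]; exact Submodule.zero_mem _⟩

theorem hasLeading_gridY_const (hq : q ≠ 0) {i j c : ℕ} (hi : i + c < n) (hj : j + c < n) :
    HasLeading n (gridM (fun _ => c) (fun _ => c) j i)
      (gridY (torusVar n q) (fun _ => c) (fun _ => c) j i) := by
  induction i with
  | zero =>
    induction j with
    | zero => exact hasLeading_torusVar hq (by simpa using hi)
    | succ j ih =>
      rw [gridM, rowM, add_comm]
      exact (hasLeading_torusVar hq (by omega)).mul (ih (by omega))
  | succ i ih =>
    rw [gridM, add_comm]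
    exact (hasLeading_torusVar hq (by omega)).mul (ih (by omega))

theorem rowY_eq_zero {b : ℕ → ℕ} {j : ℕ} (h : n ≤ j + b j) : rowY (torusVar n q) b j = 0 := by
  cases j with
  | zero => exact if_neg (by simpa using h)
  | succ j => rw [rowY, torusVar, if_neg (by omega), zero_mul]

/-- The truncation `|i| + k < n` kills a chain that leaves the triangle at the end of either arm.
This bounds the layer of the corner by `n - 1 - max i j`. -/
theorem gridY_eq_zero {a b : ℕ → ℕ} (hb : Monotone b) (hab : a 0 = b 0) {i j : ℕ}
    (h : n ≤ i + a i ∨ n ≤ j + b j) : gridY (torusVar n q) a b j i = 0 := by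
  rcases h with h | h
  · cases i with
    | zero => exact rowY_eq_zero (by have := hb (Nat.zero_le j); omega)
    | succ i => rw [gridY, torusVar, if_neg (by omega), zero_mul]
  · induction i with
    | zero => exact rowY_eq_zero h
    | succ i ih => rw [gridY, ih, mul_zero]

/-- A surviving chain has corner layer at most `n - 1 - max i j`, and being non-constant it loses at
least one more unit at an end. -/
theorem isLower_of_mem_chainSpan {i j : ℕ} (hi : i < n) (hj : j < n)
    {T : Module.End ℂ (TorusLattice →₀ ℂ)} (hT : T ∈ chainSpan (torusVar n q) i j) :
    IsLower n ((2 * n - i - j) * (n - 1 - max i j : ℕ)) T := by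
  refine Submodule.span_induction
    (p := fun T _ => IsLower n ((2 * n - i - j) * (n - 1 - max i j : ℕ)) T) ?_
    (isLower_zero n _) (fun _ _ _ _ => IsLower.add) (fun c _ _ => IsLower.smul c) hT
  rintro _ ⟨a, b, ha, hb, hab, hne, rfl⟩
  by_cases h : n ≤ i + a i ∨ n ≤ j + b j
  · rw [gridY_eq_zero hb hab h]
    exact isLower_zero n _
  refine (isMonomialOp_gridY a b i j).isLower ?_
  have h1 := torusWeight_gridM_le n ha hb hab i j
  have h2 := ha (Nat.zero_le i)
  have h3 := hb (Nat.zero_le j)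
  have h4 : (a 0 : ℤ) ≤ (n - 1 - max i j : ℕ) := by
    exact_mod_cast (by omega : a 0 ≤ n - 1 - max i j)
  have h5 := mul_le_mul_of_nonneg_left h4 (by omega : (0 : ℤ) ≤ 2 * n - i - j)
  omega

/-- Among constant chains the weight `(2 n - i - j) c` increases with `c`, so the largest layer that
fits wins. Its coefficient is a power of `1 - q ^ 2`, non-zero as `q ^ 2 ≠ 1`. -/
theorem hasLeading_gridZ (hq : q ≠ 0) (hq2 : q ^ 2 ≠ 1) {i j : ℕ} (hi : i < n) (hj : j < n) :
    HasLeading n (gridM (fun _ => n - 1 - max i j) (fun _ => n - 1 - max i j) j i)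
      (gridZ q (feiginE n q n) i j) := by
  have hk : (1 - q ^ 2) ^ (i + j) ≠ 0 := pow_ne_zero _ (sub_ne_zero.2 hq2.symm)
  have h1 := isLower_of_mem_chainSpan hi hj (gridZ_sub_mem (n := n) (isTorusFamily_torusVar n hq) i j)
  have h2 : IsLower n ((2 * n - i - j) * (n - 1 - max i j : ℕ))
      (∑ c ∈ (Finset.range n).erase (n - 1 - max i j),
        gridY (torusVar n q) (fun _ => c) (fun _ => c) j i) := by
    refine Finset.sum_induction _ _ (fun _ _ => IsLower.add) (isLower_zero n _) fun c hc => ?_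
    rcases lt_or_gt_of_ne (Finset.ne_of_mem_erase hc) with hc | hc
    · refine (isMonomialOp_gridY _ _ i j).isLower ?_
      rw [torusWeight_gridM_const]
      exact mul_lt_mul_of_pos_left (by exact_mod_cast hc) (by omega)
    · rw [gridY_eq_zero monotone_const rfl (by omega)]
      exact isLower_zero n _
  have h3 : gridZ q (feiginE n q n) i j =
      (1 - q ^ 2) ^ (i + j) • gridY (torusVar n q) (fun _ => n - 1 - max i j)
        (fun _ => n - 1 - max i j) j i +
      ((1 - q ^ 2) ^ (i + j) • (∑ c ∈ (Finset.range n).erase (n - 1 - max i j),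
        gridY (torusVar n q) (fun _ => c) (fun _ => c) j i) +
      (gridZ q (columnSum n (torusVar n q)) i j -
        (1 - q ^ 2) ^ (i + j) • constSum n (torusVar n q) i j)) := by
    rw [constSum, ← Finset.add_sum_erase (Finset.range n) _
      (Finset.mem_range.2 (by omega : n - 1 - max i j < n)), smul_add]
    change gridZ q (columnSum n (torusVar n q)) i j = _
    abel
  rw [h3]
  refine HasLeading.add_isLower ((hasLeading_gridY_const hq (by omega) (by omega)).smul hk) ?_
  rw [torusWeight_gridM_const]
  exact (h2.smul _).add h1

theorem rowM_apply (c j : ℕ) (t : ℤ) (k : ℕ) :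
    rowM (fun _ => c) j (t, k) = if k = c ∧ 0 ≤ t ∧ t ≤ j then 1 else 0 := by
  induction j with
  | zero =>
    simp only [rowM, Finsupp.single_apply, Prod.mk.injEq]
    split_ifs <;> omega
  | succ j ih =>
    rw [rowM, Finsupp.add_apply, ih, Finsupp.single_apply]
    simp only [Prod.mk.injEq]
    split_ifs <;> omega

theorem gridM_apply (c i j : ℕ) (t : ℤ) (k : ℕ) :
    gridM (fun _ => c) (fun _ => c) j i (t, k) = if k = c ∧ -i ≤ t ∧ t ≤ j then 1 else 0 := by
  induction i with
  | zero =>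
    rw [gridM, rowM_apply]
    simp
  | succ i ih =>
    rw [gridM, Finsupp.add_apply, ih, Finsupp.single_apply]
    simp only [Prod.mk.injEq]
    split_ifs <;> omega

/-- Functionals dual to the leading exponents. -/
def dualForm (n i j : ℕ) : TorusLattice →ₗ[ℤ] ℤ :=
  let ev : ℤ → TorusLattice →ₗ[ℤ] ℤ := fun t => Finsupp.lapply (t, n - 1 - max i j)
  if j < i then ev j - ev (j + 1) else if i < j then ev (-i) - ev (-i - 1)
  else ev i + ev (-i) - ev 0

/-- The layer determines `max i j`, and in it the exponent is the indicator of `[-i, j]`. A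
difference of adjacent evaluations detects the end of the shorter arm; for `i = j` the values at the
two ends minus the value at the centre detect the full interval. -/
theorem dualForm_gridM {i j s t : ℕ} (hi : i < n) (hj : j < n) (hs : s < n) (ht : t < n) :
    dualForm n i j (gridM (fun _ => n - 1 - max s t) (fun _ => n - 1 - max s t) t s) =
      if i = s ∧ j = t then 1 else 0 := by
  have h1 : n - 1 - max i j = n - 1 - max s t ↔ max i j = max s t := by omega
  unfold dualForm
  split_ifs <;> simp only [LinearMap.sub_apply, LinearMap.add_apply, Finsupp.lapply_apply,
    gridM_apply, h1] <;> split_ifs <;> omega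

variable (n q) in
/-- The ordered monomials in the images of the `Z_{i,j}` under the Feigin homomorphism, applied to
a basis vector, are linearly independent. -/
theorem linearIndependent_ordMon_feigin (hq : q ≠ 0) (hq2 : q ^ 2 ≠ 1) (h₀ : TorusLattice) :
    LinearIndependent ℂ fun a : Fin (n * n) → ℕ =>
      ordMon (fun l => gridZ q (feiginE n q n) (l / n) (l % n)) (n * n) a
        (Finsupp.single h₀ 1) := by
  have hd : ∀ l < n * n, l / n < n ∧ l % n < n := fun l hl =>
    ⟨Nat.div_lt_of_lt_mul hl, Nat.mod_lt _ (Nat.pos_of_ne_zero (by rintro rfl; simp at hl))⟩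
  refine linearIndependent_of_hasLeading (n := n) (m := fun a : Fin (n * n) → ℕ => ∑ l, a l •
    gridM (fun _ => n - 1 - max (l / n : ℕ) (l % n)) (fun _ => n - 1 - max (l / n : ℕ) (l % n))
      (l % n) (l / n)) ?_ (fun a => hasLeading_ordMon
    (m := fun l => gridM (fun _ => n - 1 - max (l / n) (l % n))
      (fun _ => n - 1 - max (l / n) (l % n)) (l % n) (l / n))
    (fun l hl => hasLeading_gridZ hq hq2 (hd l hl).1 (hd l hl).2) a) h₀
  intro a b hab
  ext k
  -- The dual functional of the `k`-th leading exponent recovers the `k`-th exponent of the ordered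
  -- monomial, which gives injectivity.
  have key : ∀ a : Fin (n * n) → ℕ, dualForm n (k / n) (k % n) (∑ l, a l •
      gridM (fun _ => n - 1 - max (l / n : ℕ) (l % n)) (fun _ => n - 1 - max (l / n : ℕ) (l % n))
        (l % n) (l / n)) = a k := by
    intro a
    rw [map_sum, Finset.sum_eq_single k]
    · rw [map_nsmul, dualForm_gridM (hd k k.2).1 (hd k k.2).2 (hd k k.2).1 (hd k k.2).2,
        if_pos ⟨rfl, rfl⟩]
      simp
    · intro l _ hl
      rw [map_nsmul, dualForm_gridM (hd k k.2).1 (hd k k.2).2 (hd l l.2).1 (hd l l.2).2, if_neg,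
        smul_zero]
      rintro ⟨h1, h2⟩
      apply hl
      ext
      rw [← Nat.div_add_mod (l : ℕ) n, ← h1, ← h2, Nat.div_add_mod]
    · simp
  have := congrArg (dualForm n (k / n) (k % n)) hab
  simp only [key] at this
  exact_mod_cast this

end

end GridLeading

/-! ### The generators `Z_{i,j}` as iterated `q`-commutators -/

section Nodes

noncomputable section

/-- A family indexed by the nodes of the diagram of type `A_{2n-1}`, renumbered so that the middle
node becomes `0`, and extended by zero. -/
def extendNodes {A : Type*} [Zero A] (n : ℕ) (f : Fin (2 * n - 1) → A) (k : ℤ) : A :=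
  if h : k.natAbs < n then f ⟨(n - 1 + k).toNat, by omega⟩ else 0

theorem cartan_eq_cartanInf {n : ℕ} (i j : Fin (2 * n - 1)) {k l : ℤ} (hi : (i : ℤ) = n - 1 + k)
    (hj : (j : ℤ) = n - 1 + l) : CartanMatrix.A (2 * n - 1) i j = cartanInf k l := by
  simp only [CartanMatrix.A, Matrix.of_apply, cartanInf, Fin.ext_iff]
  split_ifs <;> omega

theorem isSerreFamily_extendNodes {A : Type*} [Ring A] [Algebra ℂ A] {q : ℂ} {n : ℕ}
    {f : Fin (2 * n - 1) → A}
    (hc : ∀ i j, CartanMatrix.A (2 * n - 1) i j = 0 → f i * f j = f j * f i)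
    (hs : ∀ i j, CartanMatrix.A (2 * n - 1) i j = -1 → serreElt q (f i) (f j) = 0) :
    IsSerreFamily q (extendNodes n f) where
  comm i j h1 h2 h3 := by
    unfold extendNodes
    split_ifs
    · refine hc _ _ ?_
      rw [cartan_eq_cartanInf _ _ (k := i) (l := j) (by simp only; omega) (by simp only; omega)]
      exact cartanInf_eq_zero h1 h2 h3
    all_goals simp
  serre i j h := by
    unfold extendNodes
    split_ifs
    · refine hs _ _ ?_
      rw [cartan_eq_cartanInf _ _ (k := i) (l := j) (by simp only; omega) (by simp only; omega)]
      exact cartanInf_adj h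
    all_goals simp [serreElt]

theorem map_gridZ {A B : Type*} [Ring A] [Algebra ℂ A] [Ring B] [Algebra ℂ B] (f : A →ₐ[ℂ] B)
    (q : ℂ) (e : ℤ → A) (i j : ℕ) : f (gridZ q e i j) = gridZ q (fun k => f (e k)) i j := by
  induction i with
  | zero =>
    induction j with
    | zero => rfl
    | succ j ih =>
      simp only [gridZ] at ih
      simp [gridZ, rowZ, qComm, ih]
  | succ i ih => simp [gridZ, qComm, ih]

theorem ne_of_cartanInf_eq_zero {i j : ℤ} (h : cartanInf i j = 0) :
    i ≠ j ∧ j ≠ i + 1 ∧ i ≠ j + 1 := by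
  unfold cartanInf at h
  split_ifs at h <;> omega

theorem adj_of_cartanInf_eq_neg_one {i j : ℤ} (h : cartanInf i j = -1) :
    j = i + 1 ∨ i = j + 1 := by
  unfold cartanInf at h
  split_ifs at h
  omega

variable {q : ℂ}

/-- The Feigin homomorphism. -/
def feiginHom (n : ℕ) (hq : q ≠ 0) :
    UPos (2 * n - 1) q →ₐ[ℂ] Module.End ℂ (TorusLattice →₀ ℂ) :=
  posLift (fun i => feiginE n q n (i - (n - 1)))
    (fun i j h => by
      rw [cartan_eq_cartanInf i j (k := i - (n - 1)) (l := j - (n - 1)) (by ring) (by ring)] at h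
      obtain ⟨h1, h2, h3⟩ := ne_of_cartanInf_eq_zero h
      exact (isSerreFamily_feiginE n hq n).comm _ _ h1 h2 h3)
    (fun i j h => by
      rw [cartan_eq_cartanInf i j (k := i - (n - 1)) (l := j - (n - 1)) (by ring) (by ring)] at h
      exact (isSerreFamily_feiginE n hq n).serre _ _ (adj_of_cartanInf_eq_neg_one h))

theorem feiginHom_extendNodes (n : ℕ) (hq : q ≠ 0) (k : ℤ) :
    feiginHom n hq (extendNodes n (posE q) k) = feiginE n q n k := by
  unfold extendNodes
  split_ifs with h
  · rw [feiginHom, posLift_posE]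
    congr 1
    simp only
    omega
  · rw [map_zero, feiginE_eq_zero n n (by omega)]

theorem vermaRep_extendNodes (n : ℕ) (hq : q ≠ 0) (k : ℤ) :
    vermaRep hq (extendNodes n (E q) k) = Algebra.lmul ℂ _ (extendNodes n (posE q) k) := by
  unfold extendNodes
  split_ifs with h
  · exact vermaRep_E hq _
  · rw [map_zero, map_zero]

theorem vermaRep_gridZ (n : ℕ) (hq : q ≠ 0) (i j : ℕ) :
    vermaRep hq (gridZ q (extendNodes n (E q)) i j) =
      Algebra.lmul ℂ _ (gridZ q (extendNodes n (posE q)) i j) := by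
  rw [map_gridZ, map_gridZ]
  simp only [vermaRep_extendNodes]

theorem isSerreFamily_E (n : ℕ) : IsSerreFamily q (extendNodes n (E (r := 2 * n - 1) q)) := by
  refine isSerreFamily_extendNodes (fun i j h => ?_) (fun i j h => ?_)
  · have := RingQuot.mkAlgHom_rel ℂ (UqRel.E_comm (q := q) i j h)
    rwa [map_mul, map_mul] at this
  · have := RingQuot.mkAlgHom_rel ℂ (UqRel.E_serre (q := q) i j h)
    rw [map_zero] at this
    rw [← this]
    simp only [map_add, map_sub, map_mul, map_smul, map_pow]
    rfl

theorem pairing_add {r : ℕ} (γ γ' : RootLattice r) (ζ : WeightLattice r) :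
    pairing (γ + γ') ζ = pairing γ ζ + pairing γ' ζ := by
  simp [pairing, add_mul, Finset.sum_add_distrib]

theorem pairing_simpleRoot_toWeight {n : ℕ} (i j : Fin (2 * n - 1)) {k l : ℤ}
    (hi : (i : ℤ) = n - 1 + k) (hj : (j : ℤ) = n - 1 + l) :
    pairing (simpleRoot i) (toWeight (simpleRoot j)) = cartanInf k l := by
  rw [pairing_simpleRoot, toWeight_simpleRoot, cartan_eq_cartanInf i j hi hj]

theorem coe_nuNode {n k : ℕ} (h : k < n) : ((nuNode n k h : ℕ) : ℤ) = n - 1 + k := by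
  simp only [nuNode]
  omega

theorem coe_muNode {n k : ℕ} (h : k < n) : ((muNode n k h : ℕ) : ℤ) = n - 1 + -k := by
  simp only [muNode]
  omega

theorem coe_betaNode {n : ℕ} (h : 0 < n) : ((betaNode n h : ℕ) : ℤ) = n - 1 + 0 := by
  simp only [betaNode]
  omega

/-- Only `k = j + 1` is used afterwards, but the vanishing for more distant nodes is needed in the
induction. -/
theorem pairing_rootNat_nu {n j k : ℕ} (hn : 0 < n) (hj : j < n) (hk : k < n) (hjk : j < k) :
    pairing (rootNat n 0 j hn hj) (toWeight (simpleRoot (nuNode n k hk))) =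
      if k = j + 1 then -1 else 0 := by
  induction j with
  | zero =>
    rw [rootNat, pairing_simpleRoot_toWeight _ _ (coe_betaNode hn) (coe_nuNode hk), cartanInf]
    split_ifs <;> omega
  | succ j ih =>
    rw [rootNat, pairing_add, ih (by omega) (by omega),
      pairing_simpleRoot_toWeight _ _ (coe_nuNode hj) (coe_nuNode hk), cartanInf]
    split_ifs <;> omega

theorem pairing_rootNat_mu {n i j k : ℕ} (hi : i < n) (hj : j < n) (hk : k < n) (hik : i < k) :
    pairing (rootNat n i j hi hj) (toWeight (simpleRoot (muNode n k hk))) =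
      if k = i + 1 then -1 else 0 := by
  induction i with
  | zero =>
    induction j with
    | zero =>
      rw [rootNat, pairing_simpleRoot_toWeight _ _ (coe_betaNode hi) (coe_muNode hk), cartanInf]
      split_ifs <;> omega
    | succ j ih =>
      rw [rootNat, pairing_add, ih (by omega),
        pairing_simpleRoot_toWeight _ _ (coe_nuNode hj) (coe_muNode hk), cartanInf]
      split_ifs <;> omega
  | succ i ih =>
    rw [rootNat, pairing_add, ih (by omega) (by omega),
      pairing_simpleRoot_toWeight _ _ (coe_muNode hi) (coe_muNode hk), cartanInf]
    split_ifs <;> omega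

theorem extendNodes_nuNode {A : Type*} [Zero A] {n k : ℕ} (f : Fin (2 * n - 1) → A) (h : k < n) :
    extendNodes n f k = f (nuNode n k h) := by
  rw [extendNodes, dif_pos (by omega)]
  congr 1
  ext
  simp only [nuNode]
  omega

theorem extendNodes_muNode {A : Type*} [Zero A] {n k : ℕ} (f : Fin (2 * n - 1) → A) (h : k < n) :
    extendNodes n f (-k) = f (muNode n k h) := by
  rw [extendNodes, dif_pos (by omega)]
  congr 1
  ext
  simp only [muNode]
  omega

theorem adE_eq_qComm {r : ℕ} {k : Fin r} {γ : RootLattice r}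
    (h : pairing γ (toWeight (simpleRoot k)) = -1) (x : Uq r q) :
    adE q k γ x = qComm q (E q k) x := by
  rw [adE, h, neg_neg, zpow_one]
  rfl

/-- Every node attached in the definition pairs to `-1` with the root built so far, so each adjoint
action is the `q`-commutator with factor `q`. -/
theorem ZNat_eq_gridZ {n i j : ℕ} (hi : i < n) (hj : j < n) :
    ZNat n q i j hi hj = gridZ q (extendNodes n (E q)) i j := by
  induction i with
  | zero =>
    induction j with
    | zero =>
      rw [ZNat, gridZ, rowZ, ← Nat.cast_zero, extendNodes_nuNode _ hi]
      rfl
    | succ j ih =>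
      rw [ZNat, adE_eq_qComm (by rw [pairing_rootNat_nu _ _ _ (by omega), if_pos rfl]),
        ih (by omega), ← extendNodes_nuNode (E q) hj]
      rfl
  | succ i ih =>
    rw [ZNat, adE_eq_qComm (by rw [pairing_rootNat_mu _ _ _ (by omega), if_pos rfl]),
      ih (by omega), gridZ, extendNodes_muNode _ hi]

theorem Z_eq_gridZ {n : ℕ} (i j : Fin n) : Z q i j = gridZ q (extendNodes n (E q)) i j :=
  ZNat_eq_gridZ i.2 j.2

end

end Nodes

/-! ### The modified algebras -/

section Modified

variable {q : ℂ}

theorem L_zero {r : ℕ} : L (r := r) q 0 = 1 := by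
  rw [L, RingQuot.mkAlgHom_rel ℂ (UqRel.L_zero (r := r) (q := q)), map_one]

theorem L_mul_L {r : ℕ} (θ θ' : WeightLattice r) : L q θ * L q θ' = L q (θ + θ') := by
  rw [L, L, ← map_mul, RingQuot.mkAlgHom_rel ℂ (UqRel.L_add θ θ'), L]

/-- The element `x` has weight `γ`. -/
def HasWeight {r : ℕ} (γ : RootLattice r) (x : Uq r q) : Prop :=
  ∀ θ, L q θ * x = q ^ pairing γ θ • (x * L q θ)

theorem hasWeight_E {r : ℕ} (i : Fin r) : HasWeight (simpleRoot i) (E q i) := by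
  intro θ
  rw [L, E, ← map_mul, RingQuot.mkAlgHom_rel ℂ (UqRel.L_E θ i), map_smul, map_mul]

theorem hasWeight_one {r : ℕ} : HasWeight 0 (1 : Uq r q) := by
  intro θ
  simp [pairing]

theorem HasWeight.mul {r : ℕ} (hq : q ≠ 0) {γ γ' : RootLattice r} {x y : Uq r q}
    (hx : HasWeight γ x) (hy : HasWeight γ' y) : HasWeight (γ + γ') (x * y) := by
  intro θ
  rw [← mul_assoc, hx, smul_mul_assoc, mul_assoc, hy, mul_smul_comm, smul_smul, mul_assoc,
    pairing_add, zpow_add₀ hq]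

theorem HasWeight.adE {r : ℕ} (hq : q ≠ 0) {γ : RootLattice r} {x : Uq r q} (hx : HasWeight γ x)
    (k : Fin r) (γ' : RootLattice r) : HasWeight (γ + simpleRoot k) (adE q k γ' x) := by
  intro θ
  have h1 := (hasWeight_E k).mul hq hx θ
  rw [add_comm] at h1
  rw [QuantumMatrix.adE, mul_sub, mul_smul_comm, h1, hx.mul hq (hasWeight_E k) θ, sub_mul,
    smul_mul_assoc, smul_sub, smul_comm]

theorem hasWeight_ZNat (hq : q ≠ 0) {n i j : ℕ} (hi : i < n) (hj : j < n) :
    HasWeight (rootNat n i j hi hj) (ZNat n q i j hi hj) := by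
  induction i with
  | zero =>
    induction j with
    | zero =>
      rw [rootNat, ZNat]
      exact hasWeight_E _
    | succ j ih =>
      rw [rootNat, ZNat]
      exact (ih _).adE hq _ _
  | succ i ih =>
    rw [rootNat, ZNat, add_comm]
    exact (ih _).adE hq _ _

variable {n : ℕ}

theorem hasWeight_Z (hq : q ≠ 0) (i j : Fin n) : HasWeight (root i j) (Z q i j) :=
  hasWeight_ZNat hq i.2 j.2

variable (ζ ξ : Fin n → WeightLattice (2 * n - 1))

theorem Zt_eq (i j : Fin n) : Zt q ζ ξ i j = Z q i j * L q (ζ i + ξ j) := by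
  rw [Zt, mul_assoc, L_mul_L]

theorem HasWeight.mul_L_mul {r : ℕ} {γ : RootLattice r} {x y : Uq r q}
    (hy : HasWeight γ y) (θ θ' : WeightLattice r) :
    x * L q θ * (y * L q θ') = q ^ pairing γ θ • (x * y * L q (θ + θ')) := by
  rw [mul_assoc, ← mul_assoc (L q θ), hy, smul_mul_assoc, mul_smul_comm, mul_assoc y, L_mul_L,
    mul_assoc]

theorem Zt_mul_Zt (hq : q ≠ 0) (i j s t : Fin n) :
    Zt q ζ ξ i j * Zt q ζ ξ s t = q ^ pairing (root s t) (ζ i + ξ j) •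
      (Z q i j * Z q s t * L q (ζ i + ξ j + (ζ s + ξ t))) := by
  rw [Zt_eq, Zt_eq, (hasWeight_Z hq s t).mul_L_mul]

/-- Two distinct indices force `n ≥ 2`, so `q ^ 4 ≠ 1` is available; for `n = 1` no quadratic
relation arises. -/
theorem sq_add_one_ne_zero (hq4 : 2 ≤ n → q ^ 4 ≠ 1) {i j : Fin n} (h : i < j) :
    q ^ 2 + 1 ≠ 0 := by
  have := j.2
  intro h0
  refine hq4 (by omega) ?_
  linear_combination (q ^ 2 - 1) * h0

/-- By `Zt_mul_Zt`, every product of two generators is a power of `q` times the untwisted product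
and a single `L`. The powers given by the weights are exactly those in the relations. -/
theorem lift_genM_rel (hq : q ≠ 0) (hq4 : 2 ≤ n → q ^ 4 ≠ 1)
    {a b : FreeAlgebra ℂ (Fin n × Fin n)} (h : ModRel q ζ ξ a b) :
    FreeAlgebra.lift ℂ (genM q ζ ξ) a = FreeAlgebra.lift ℂ (genM q ζ ξ) b := by
  have he := isSerreFamily_E (q := q) n
  apply Subtype.ext
  cases h with
  | row i j k h =>
    have hr := gridZ_row hq (sq_add_one_ne_zero hq4 h) he i h
    simp only [← Z_eq_gridZ] at hr
    simp only [X, map_mul, map_smul, FreeAlgebra.lift_ι_apply, MulMemClass.coe_mul,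
      Subalgebra.coe_smul, genM]
    rw [Zt_mul_Zt ζ ξ hq, Zt_mul_Zt ζ ξ hq, hr, smul_mul_assoc, smul_smul, smul_smul,
      zpow_add₀ hq, zpow_sub₀ hq, add_comm (ζ i + ξ j)]
    congr 1
    field_simp
  | col i j k h =>
    have hr := gridZ_col hq (sq_add_one_ne_zero hq4 h) he j h
    simp only [← Z_eq_gridZ] at hr
    simp only [X, map_mul, map_smul, FreeAlgebra.lift_ι_apply, MulMemClass.coe_mul,
      Subalgebra.coe_smul, genM]
    rw [Zt_mul_Zt ζ ξ hq, Zt_mul_Zt ζ ξ hq, hr, smul_mul_assoc, smul_smul, smul_smul,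
      zpow_add₀ hq, zpow_sub₀ hq, add_comm (ζ i + ξ j)]
    congr 1
    field_simp
  | anti i j s t h h' =>
    have hr := gridZ_anti hq (sq_add_one_ne_zero hq4 h) he h h'
    simp only [← Z_eq_gridZ] at hr
    simp only [X, map_mul, map_smul, FreeAlgebra.lift_ι_apply, MulMemClass.coe_mul,
      Subalgebra.coe_smul, genM]
    rw [Zt_mul_Zt ζ ξ hq, Zt_mul_Zt ζ ξ hq, hr, smul_smul, zpow_sub₀ hq, add_comm (ζ i + ξ j)]
    congr 1
    field_simp
  | diag i j s t h h' =>
    have hr := gridZ_diag hq (sq_add_one_ne_zero hq4 h) he h h'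
    simp only [← Z_eq_gridZ] at hr
    rw [sub_eq_iff_eq_add'] at hr
    simp only [X, map_mul, map_smul, map_add, FreeAlgebra.lift_ι_apply, MulMemClass.coe_mul,
      AddMemClass.coe_add, Subalgebra.coe_smul, genM]
    -- All three products carry the same `L`, because `ζ_i + ξ_t + ζ_s + ξ_j` is a rearrangement of
    -- `ζ_i + ξ_j + ζ_s + ξ_t`.
    rw [Zt_mul_Zt ζ ξ hq, Zt_mul_Zt ζ ξ hq, Zt_mul_Zt ζ ξ hq, hr, add_mul, smul_mul_assoc,
      smul_smul, smul_smul, smul_add, smul_smul, zpow_sub₀ hq, zpow_sub₀ hq,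
      add_comm (ζ i + ξ j), show ζ i + ξ t + (ζ s + ξ j) = ζ s + ξ t + (ζ i + ξ j) by abel]
    congr 2 <;> field_simp

/-! ### Lexicographic listing of the generators and straightening -/

section LexVar

variable {A : Type*} [Ring A]

/-- A family indexed by pairs, listed in lexicographic order. -/
noncomputable def lexVar (f : Fin n × Fin n → A) (l : ℕ) : A :=
  if h : l < n * n then f (finProdFinEquiv.symm ⟨l, h⟩) else 0

theorem lexVar_coe (f : Fin n × Fin n → A) (l : Fin (n * n)) :
    lexVar f l = f (finProdFinEquiv.symm l) := by
  rw [lexVar, dif_pos l.2]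

theorem lexVar_finProdFinEquiv (f : Fin n × Fin n → A) (p : Fin n × Fin n) :
    lexVar f (finProdFinEquiv p : Fin (n * n)) = f p := by
  rw [lexVar_coe, Equiv.symm_apply_apply]

theorem image_lexVar (f : Fin n × Fin n → A) :
    lexVar f '' Set.Iio (n * n) = Set.range f := by
  ext a
  constructor
  · rintro ⟨l, hl, rfl⟩
    exact ⟨_, (lexVar_coe f ⟨l, hl⟩).symm⟩
  · rintro ⟨p, rfl⟩
    exact ⟨_, (finProdFinEquiv p).2, lexVar_finProdFinEquiv f p⟩

theorem finProdFinEquiv_lt {i j s t : Fin n} :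
    ((finProdFinEquiv (i, j) : Fin (n * n)) : ℕ) < (finProdFinEquiv (s, t) : Fin (n * n)) ↔
      i < s ∨ i = s ∧ j < t := by
  have hj := j.2
  have ht := t.2
  simp only [finProdFinEquiv_apply_val, Fin.lt_def, Fin.ext_iff]
  rcases lt_trichotomy (i : ℕ) s with h | h | h
  · have := Nat.mul_le_mul_left n (Nat.succ_le_of_lt h)
    rw [Nat.mul_succ] at this
    omega
  · rw [h]
    omega
  · have := Nat.mul_le_mul_left n (Nat.succ_le_of_lt h)
    rw [Nat.mul_succ] at this
    omega

variable [Algebra ℂ A]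

theorem mem_firstSpan_lexVar (f : Fin n × Fin n → A) {i j s t : Fin n}
    (h : i < s ∨ i = s ∧ j < t) :
    f (i, j) ∈ firstSpan ℂ (lexVar f) (finProdFinEquiv (s, t) : Fin (n * n)) := by
  rw [← lexVar_finProdFinEquiv f]
  exact mem_firstSpan (finProdFinEquiv_lt.2 h)

/-- Stated for any family satisfying the relations, so that it serves both the modified algebra and
the abstract quotient. In the diagonal case `(i, t)` and `(s, j)` both precede `(s, t)`, hence the
extra term is admissible. -/
theorem straightens_lexVar (hq : q ≠ 0) {f : Fin n × Fin n → A}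
    (hf : ∀ {a b}, ModRel q ζ ξ a b → FreeAlgebra.lift ℂ f a = FreeAlgebra.lift ℂ f b) :
    Straightens ℂ (lexVar f) (n * n) := by
  suffices h : ∀ i j s t : Fin n, i < s ∨ i = s ∧ j < t → ∃ c : ℂ, c ≠ 0 ∧
      f (s, t) * f (i, j) - c • (f (i, j) * f (s, t)) ∈
        firstSpan ℂ (lexVar f) (finProdFinEquiv (s, t) : Fin (n * n)) ^ 2 by
    intro k hk l hl
    obtain ⟨⟨s, t⟩, hst⟩ := finProdFinEquiv.surjective (⟨k, hk⟩ : Fin (n * n))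
    obtain ⟨⟨i, j⟩, hij⟩ := finProdFinEquiv.surjective (⟨l, hl.trans hk⟩ : Fin (n * n))
    have h1 := congrArg Fin.val hst
    have h2 := congrArg Fin.val hij
    simp only at h1 h2
    rw [← h1, ← h2, lexVar_finProdFinEquiv, lexVar_finProdFinEquiv]
    rw [← h1, ← h2] at hl
    exact h i j s t (finProdFinEquiv_lt.1 hl)
  have key : ∀ {i j s t : Fin n} {m : ℤ}, f (i, j) * f (s, t) = q ^ m • (f (s, t) * f (i, j)) →
      ∃ c : ℂ, c ≠ 0 ∧ f (s, t) * f (i, j) - c • (f (i, j) * f (s, t)) ∈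
        firstSpan ℂ (lexVar f) (finProdFinEquiv (s, t) : Fin (n * n)) ^ 2 := by
    intro i j s t m hm
    refine ⟨(q ^ m)⁻¹, inv_ne_zero (zpow_ne_zero _ hq), ?_⟩
    rw [hm, inv_smul_smul₀ (zpow_ne_zero _ hq), sub_self]
    exact zero_mem _
  intro i j s t hlt
  rcases hlt with his | ⟨rfl, hjt⟩
  · rcases lt_trichotomy j t with hjt | rfl | htj
    · have h1 := hf (ModRel.diag i j s t his hjt)
      simp only [X, map_mul, map_add, map_smul, FreeAlgebra.lift_ι_apply] at h1
      have h0 := zpow_ne_zero (pairing (root s t) (ζ i + ξ j) - pairing (root i j) (ζ s + ξ t)) hq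
      refine ⟨_, inv_ne_zero h0, ?_⟩
      rw [h1, smul_add, inv_smul_smul₀ h0, sub_add_cancel_left, sq]
      exact neg_mem (Submodule.smul_mem _ _ (Submodule.smul_mem _ _ (Submodule.mul_mem_mul
        (mem_firstSpan_lexVar f (.inl his)) (mem_firstSpan_lexVar f (.inr ⟨rfl, hjt⟩)))))
    · have h1 := hf (ModRel.col i j s his)
      simp only [X, map_mul, map_smul, FreeAlgebra.lift_ι_apply] at h1
      exact key h1
    · have h1 := hf (ModRel.anti i j s t his htj)
      simp only [X, map_mul, map_smul, FreeAlgebra.lift_ι_apply] at h1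
      exact key h1
  · have h1 := hf (ModRel.row i j t hjt)
    simp only [X, map_mul, map_smul, FreeAlgebra.lift_ι_apply] at h1
    exact key h1

end LexVar

theorem firstAdjoin_lexVar_genM : firstAdjoin ℂ (lexVar (genM q ζ ξ)) (n * n) = ⊤ := by
  rw [firstAdjoin, image_lexVar]
  have h : Set.range (genM q ζ ξ) = ((↑) : modifiedAlgebra q ζ ξ → Uq (2 * n - 1) q) ⁻¹'
      Set.range fun p : Fin n × Fin n => Zt q ζ ξ p.1 p.2 := by
    ext x
    simp only [Set.mem_range, Set.mem_preimage, genM, Subtype.ext_iff]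
  rw [h]
  exact Algebra.adjoin_adjoin_coe_preimage

theorem straightens_lexVar_ringQuot (hq : q ≠ 0) :
    Straightens ℂ (lexVar fun p : Fin n × Fin n =>
      RingQuot.mkAlgHom ℂ (ModRel q ζ ξ) (X p.1 p.2)) (n * n) := by
  refine straightens_lexVar (A := RingQuot (ModRel q ζ ξ)) ζ ξ hq fun {a b} h => ?_
  have hm : FreeAlgebra.lift ℂ (fun p : Fin n × Fin n =>
      RingQuot.mkAlgHom ℂ (ModRel q ζ ξ) (X p.1 p.2)) = RingQuot.mkAlgHom ℂ (ModRel q ζ ξ) := by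
    ext p
    simp [X]
  rw [hm, RingQuot.mkAlgHom_rel ℂ h]

theorem firstAdjoin_lexVar_ringQuot :
    firstAdjoin ℂ (lexVar fun p : Fin n × Fin n =>
      RingQuot.mkAlgHom ℂ (ModRel q ζ ξ) (X p.1 p.2)) (n * n) = ⊤ := by
  rw [firstAdjoin, image_lexVar]
  have h : (Set.range fun p : Fin n × Fin n => RingQuot.mkAlgHom ℂ (ModRel q ζ ξ) (X p.1 p.2)) =
      RingQuot.mkAlgHom ℂ (ModRel q ζ ξ) '' Set.range (FreeAlgebra.ι ℂ) := by
    rw [← Set.range_comp]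
    rfl
  rw [h, ← AlgHom.map_adjoin, FreeAlgebra.adjoin_range_ι, Algebra.map_top,
    AlgHom.range_eq_top]
  exact RingQuot.mkAlgHom_surjective ℂ _

/-- `y` is a non-zero multiple of `x L_θ` for some weight `θ`, where `x` is a weight vector. -/
def IsTwist {r : ℕ} (x y : Uq r q) : Prop :=
  ∃ γ, HasWeight γ x ∧ ∃ c : ℂ, c ≠ 0 ∧ ∃ θ, y = c • (x * L q θ)

theorem isTwist_one {r : ℕ} : IsTwist (1 : Uq r q) 1 :=
  ⟨0, hasWeight_one, 1, one_ne_zero, 0, by simp [L_zero]⟩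

theorem IsTwist.mul {r : ℕ} (hq : q ≠ 0) {x y x' y' : Uq r q} (h : IsTwist x y)
    (h' : IsTwist x' y') : IsTwist (x * x') (y * y') := by
  obtain ⟨γ, hx, c, hc, θ, rfl⟩ := h
  obtain ⟨γ', hx', c', hc', θ', rfl⟩ := h'
  refine ⟨γ + γ', hx.mul hq hx', c * c' * q ^ pairing γ' θ,
    mul_ne_zero (mul_ne_zero hc hc') (zpow_ne_zero _ hq), θ + θ', ?_⟩
  rw [smul_mul_smul_comm, hx'.mul_L_mul, smul_smul]

theorem IsTwist.pow {r : ℕ} (hq : q ≠ 0) {x y : Uq r q} (h : IsTwist x y) (m : ℕ) :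
    IsTwist (x ^ m) (y ^ m) := by
  induction m with
  | zero => simpa using isTwist_one
  | succ m ih => simpa only [pow_succ] using ih.mul hq h

theorem IsTwist.ordMon {r : ℕ} (hq : q ≠ 0) {x y : ℕ → Uq r q} {k : ℕ}
    (h : ∀ l < k, IsTwist (x l) (y l)) (a : Fin k → ℕ) :
    IsTwist (ordMon x k a) (ordMon y k a) := by
  induction k with
  | zero => exact isTwist_one
  | succ k ih => exact (ih (fun l hl => h l (by omega)) _).mul hq ((h k (by omega)).pow hq _)

theorem isTwist_Zt (hq : q ≠ 0) (i j : Fin n) : IsTwist (Z q i j) (Zt q ζ ξ i j) :=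
  ⟨root i j, hasWeight_Z hq i j, 1, one_ne_zero, ζ i + ξ j, by rw [one_smul, Zt_eq]⟩

/-- The Feigin homomorphism evaluated on the vacuum vector of the Verma module. -/
noncomputable def feiginEval (n : ℕ) (hq : q ≠ 0) (h₀ : TorusLattice) :
    Uq (2 * n - 1) q →ₗ[ℂ] TorusLattice →₀ ℂ :=
  LinearMap.applyₗ (Finsupp.single h₀ 1) ∘ₗ (feiginHom n hq).toLinearMap ∘ₗ
    LinearMap.applyₗ 1 ∘ₗ (vermaRep hq).toLinearMap

theorem feiginEval_apply (hq : q ≠ 0) (h₀ : TorusLattice) (u : Uq (2 * n - 1) q) :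
    feiginEval n hq h₀ u = feiginHom n hq (vermaRep hq u 1) (Finsupp.single h₀ 1) := rfl

/-- The factor `L q θ` acts first, on the vacuum, and fixes it; what remains is a product of left
multiplications, carried by the Feigin homomorphism to the torus. -/
theorem feiginEval_twist (hq : q ≠ 0) (h₀ : TorusLattice) (a : Fin (n * n) → ℕ) (c : ℂ)
    (θ : WeightLattice (2 * n - 1)) :
    feiginEval n hq h₀
      (c • (ordMon (fun l => gridZ q (extendNodes n (E q)) (l / n) (l % n)) (n * n) a * L q θ)) =
    c • ordMon (fun l => gridZ q (feiginE n q n) (l / n) (l % n)) (n * n) a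
        (Finsupp.single h₀ 1) := by
  rw [feiginEval_apply, map_smul, map_mul, vermaRep_L, map_ordMon]
  simp only [vermaRep_gridZ]
  rw [← map_ordMon]
  simp only [LinearMap.smul_apply, map_smul, Module.End.mul_apply, opL_one, Algebra.coe_lmul_eq_mul,
    LinearMap.mul_apply', mul_one]
  have hg : ∀ i j, feiginHom n hq (gridZ q (extendNodes n (posE q)) i j) =
      gridZ q (feiginE n q n) i j := by
    intro i j
    refine (map_gridZ (B := Module.End ℂ (TorusLattice →₀ ℂ)) (feiginHom n hq) q _ i j).trans ?_
    simp only [feiginHom_extendNodes]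
  have h := (map_ordMon (K := ℂ) (A := Module.End ℂ (TorusLattice →₀ ℂ)) (feiginHom n hq)
    (fun l => gridZ q (extendNodes n (posE q)) (l / n) (l % n)) (n * n) a).trans
    (ordMon_congr (fun l _ => hg (l / n) (l % n)) a)
  exact congrArg (fun g : Module.End ℂ (TorusLattice →₀ ℂ) => c • g (Finsupp.single h₀ 1)) h

/-- A twisted ordered monomial is a non-zero multiple of the untwisted one times some `L_θ`. Under
`feiginEval` it becomes a unit multiple of a member of the independent family of
`linearIndependent_ordMon_feigin`. -/
theorem linearIndependent_ordMon_genM (hq : q ≠ 0) (hq2 : q ^ 2 ≠ 1) :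
    LinearIndependent ℂ (ordMon (lexVar (genM q ζ ξ)) (n * n)) := by
  have h : ∀ a : Fin (n * n) → ℕ, IsTwist
      (ordMon (fun l => gridZ q (extendNodes n (E q)) (l / n) (l % n)) (n * n) a)
      (ordMon (lexVar (genM q ζ ξ)) (n * n) a).val := by
    intro a
    have hv := map_ordMon (K := ℂ) (A := Uq (2 * n - 1) q) (B := modifiedAlgebra q ζ ξ)
      (modifiedAlgebra q ζ ξ).val (lexVar (genM q ζ ξ)) (n * n) a
    rw [Subalgebra.coe_val] at hv
    rw [hv]
    refine IsTwist.ordMon hq (fun l hl => ?_) a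
    have := isTwist_Zt ζ ξ hq (finProdFinEquiv.symm (⟨l, hl⟩ : Fin (n * n))).1
      (finProdFinEquiv.symm (⟨l, hl⟩ : Fin (n * n))).2
    rw [Z_eq_gridZ] at this
    rw [lexVar, dif_pos hl]
    exact this
  choose γ hγ c hc θ hθ using h
  refine LinearIndependent.of_comp
    (feiginEval n hq 0 ∘ₗ (modifiedAlgebra q ζ ξ).val.toLinearMap) ?_
  have h1 := (linearIndependent_ordMon_feigin n q hq hq2 0).units_smul
    (fun a => Units.mk0 (c a) (hc a))
  convert h1 using 1
  ext1 a
  simp only [Function.comp_apply, LinearMap.comp_apply, AlgHom.toLinearMap_apply,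
    Subalgebra.val_apply, Pi.smul_apply']
  rw [hθ a, feiginEval_twist]
  rfl

end Modified

end QuantumMatrix

/-! ### The theorem assembled from straightening and independence -/

theorem mainTheorem1 (n : ℕ) (hn : 1 ≤ n) (q : ℂ) (hq0 : q ≠ 0) (hq2 : q ^ 2 ≠ 1)
    (hq4 : 2 ≤ n → q ^ 4 ≠ 1)
    (ζ ξ : Fin n → QuantumMatrix.WeightLattice (2 * n - 1)) :
    -- iterated Ore extension of `ℂ` in the variables `Z̃_{i,j}`, in lexicographic order
    QuantumMatrix.IsIteratedOreExtension ℂ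
      (fun k : Fin (n * n) => QuantumMatrix.genM q ζ ξ (finProdFinEquiv.symm k)) ∧
    -- a domain
    IsDomain (QuantumMatrix.modifiedAlgebra q ζ ξ) ∧
    -- graded by the degree in the generators, with the Hilbert series of a polynomial ring
    DirectSum.IsInternal (QuantumMatrix.gradedPart q ζ ξ) ∧
    QuantumMatrix.hilbertSeries (QuantumMatrix.gradedPart q ζ ξ) =
      QuantumMatrix.hilbertSeries (MvPolynomial.homogeneousSubmodule (Fin n × Fin n) ℂ) ∧
    -- presented by the quadratic relations
    ∃ e : RingQuot (QuantumMatrix.ModRel q ζ ξ) ≃ₐ[ℂ] QuantumMatrix.modifiedAlgebra q ζ ξ,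
      ∀ i j : Fin n,
        e (RingQuot.mkAlgHom ℂ (QuantumMatrix.ModRel q ζ ξ) (QuantumMatrix.X i j)) =
          QuantumMatrix.genM q ζ ξ (i, j) := by
  open QuantumMatrix in
  have hrel := fun {a b : FreeAlgebra ℂ (Fin n × Fin n)} (h : ModRel q ζ ξ a b) =>
    lift_genM_rel ζ ξ hq0 hq4 h
  have hst := straightens_lexVar (A := modifiedAlgebra q ζ ξ) ζ ξ hq0 hrel
  have hli := linearIndependent_ordMon_genM ζ ξ hq0 hq2
  have hgen := firstAdjoin_lexVar_genM (q := q) ζ ξ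
  have hgr : gradedPart q ζ ξ = fun d => firstSpan ℂ (lexVar (genM q ζ ξ)) (n * n) ^ d := by
    ext1 d
    rw [gradedPart, firstSpan, image_lexVar]
  refine ⟨?_, isDomain_of_straightens hst hli hgen, ?_, ?_, ?_⟩
  · simpa only [lexVar_coe] using isIteratedOreExtension_of_straightens hst hli hgen
  · rw [hgr]
    exact isInternal_of_straightens hst hli hgen
  · rw [hgr]
    exact hilbertSeries_of_straightens hst hli finProdFinEquiv
  · let f : RingQuot (ModRel q ζ ξ) →ₐ[ℂ] modifiedAlgebra q ζ ξ :=
      RingQuot.liftAlgHom ℂ ⟨FreeAlgebra.lift ℂ (genM q ζ ξ), fun {_ _} h => hrel h⟩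
    have hf : ∀ i j, f (RingQuot.mkAlgHom ℂ (ModRel q ζ ξ) (X i j)) = genM q ζ ξ (i, j) := by
      intro i j
      simp [f, X]
    -- The listing is extended by zero past `n * n`, so both sides agree there as well.
    have hfl : (fun l => f (lexVar (fun p : Fin n × Fin n =>
        RingQuot.mkAlgHom ℂ (ModRel q ζ ξ) (X p.1 p.2)) l)) = lexVar (genM q ζ ξ) := by
      ext1 l
      unfold lexVar
      split_ifs
      · exact hf _ _
      · exact map_zero f
    have hb := bijective_of_straightens (K := ℂ) (A := modifiedAlgebra q ζ ξ)
      (B := RingQuot (ModRel q ζ ξ)) f (y := lexVar (fun p : Fin n × Fin n =>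
        RingQuot.mkAlgHom ℂ (ModRel q ζ ξ) (X p.1 p.2))) (N := n * n)
    rw [hfl] at hb
    exact ⟨AlgEquiv.ofBijective f
      (hb (straightens_lexVar_ringQuot ζ ξ hq0) (firstAdjoin_lexVar_ringQuot ζ ξ) hli hgen), hf⟩
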